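/- For $N\ge 1$ and $\tau\in[0,1)$ let $G_\tau=\sqrt{\tfrac{1+\tau}{2}}\,G_1+i\sqrt{\tfrac{1-\tau}{2}}\,G_2$, where $G_1,G_2$ are independent real $N\times N$ matrices with i.i.d. standard normal entries (the interpolating Ginibre ensemble). Its mean eigenvalue density $p^{(\tau)}_N(x,y)=\big\langle\sum_{a=1}^N\delta^{(2)}(z-z_a)\big\rangle$, $z=x+iy$, is the continuous function on $\mathbb{C}\cong\mathbb{R}^2$ such that $$\Big\langle \sum_{a=1}^N f(z_a)\Big\rangle=\int_{\mathbb{R}^2} f(x+iy)\,p^{(\tau)}_N(x,y)\,dx\,dy$$ for every continuous compactly supported $f:\mathbb{C}\to\mathbb{R}$, where $z_1,\dots,z_N$ are the eigenvalues of $G_\tau$ counted with multiplicity. Proposition (weak non-reality regime). Let $\delta\in\mathbb{R}\setminus\{0\}$ be fixed. For all sufficiently large $N$ the density $p^{(\tau)}_N$ with $\tau=1-\delta^2/N$ exists, and for every $\tilde x\in(-1,1)$ and every $y\in\mathbb{R}$ $$\lim_{N\to\infty}p^{\left(\tau=1-\frac{\delta^2}{N}\right)}_N\big(\sqrt N\,\tilde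 x,\,y\big)=\frac{2}{\pi}\int_1^\infty e^{(1-t^2)(2y^2+\delta_x^2)}\left(\delta_x^2t^2+2y^2\right)dt,\qquad \delta_x=\delta\sqrt{1-\tilde x^2},$$ where the integral on the right converges absolutely. -/

import Mathlib

open MeasureTheory ProbabilityTheory Filter Topology

noncomputable section

/-- The real Ginibre ensemble: the law of an `N × N` matrix whose entries are independent
real standard normal variables. -/
def realGinibre (N : ℕ) : Measure (Fin N → Fin N → ℝ) :=
  Measure.pi fun _ => Measure.pi fun _ => gaussianReal 0 1

/-- The matrix `G_τ = √((1+τ)/2) G₁ + i √((1-τ)/2) G₂` built from two real matrices. -/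
def interpolatingMatrix {N : ℕ} (τ : ℝ) (G₁ G₂ : Fin N → Fin N → ℝ) :
    Matrix (Fin N) (Fin N) ℂ :=
  Matrix.of fun i j =>
    (Real.sqrt ((1 + τ) / 2) * G₁ i j : ℂ) + Complex.I * (Real.sqrt ((1 - τ) / 2) * G₂ i j : ℂ)

/-- The linear statistic `∑ₐ f(zₐ)` over the eigenvalues `z₁, …, z_N` of `X`,
counted with algebraic multiplicity. -/
def eigenvalueSum {N : ℕ} (X : Matrix (Fin N) (Fin N) ℂ) (f : ℂ → ℝ) : ℝ :=
  (X.charpoly.roots.map f).sum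

/-- The expectation `⟨∑ₐ f(zₐ)⟩` over the interpolating Ginibre ensemble, in which `G₁` and `G₂`
are two independent real Ginibre matrices. -/
def meanEigenvalueSum (N : ℕ) (τ : ℝ) (f : ℂ → ℝ) : ℝ :=
  ∫ G, eigenvalueSum (interpolatingMatrix τ G.1 G.2) f ∂((realGinibre N).prod (realGinibre N))

/-- `p` is the mean eigenvalue density `⟨∑ₐ δ⁽²⁾(z - zₐ)⟩` of the interpolating Ginibre ensemble:
the continuous function on `ℂ` with `⟨∑ₐ f(zₐ)⟩ = ∫ f(z) p(z) d²z` for all continuous compactly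
supported test functions `f`. There is at most one such `p`; its total mass is `N`. -/
structure IsMeanEigenvalueDensity (N : ℕ) (τ : ℝ) (p : ℂ → ℝ) : Prop where
  continuous : Continuous p
  mean_eq : ∀ f : ℂ → ℝ, Continuous f → HasCompactSupport f →
    meanEigenvalueSum N τ f = ∫ z, f z * p z

end

/-! An exact formula for the density at finite `N` is derived first; its limit is then taken under
an integral sign.

Exact formula. Given the last columns `Y` of a matrix, an eigenvalue `z` and an eigenvector `(1, w)`
determine the first column. For almost every `Y` no eigenvector has first coordinate zero
(`ae_isGenericChart`), and for almost every first column all eigenvalues are simple, so a sum over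
eigenvalues is a sum over preimages of the map from `(z, w)` to the first column. The area formula
turns its mean into an integral over `z`, `w`, `Y` of the test function, the matrix density and the
squared modulus of a Jacobian determinant (`lintegral_firstColumn`).

The integral over `Y` is a Gaussian conditional mean given `X v = z v`, with `v = (1, w)`. The rows
are independent, and the residual of a row after regression on its product with `v` has an explicit
covariance that is a rank two perturbation of the identity. Hence the mean of `|det|²` is a mixed
discriminant, computed by a polynomial identity and a 2 × 2 determinant (`mixedDet_vecMulVec_add`,
`det_conditional_covariance`, `lintegral_normSq_det`). The outcome depends on `v` only through `|v|`
and `|vᵀ v| / |v|²`. The law of this ratio in the projective chart comes from hyperbolic area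
(`lintegral_projective_gramRatio`), and a single integral over `s ∈ (0, 1)` remains, namely
`eigenvalueDensity`.

Limit. In the variable `v = s⁻² - 1` and with `κ = 1 - τ²`, the integrand contains `(1 + κ v) ^ (-N
/ 2)` and two Poisson probabilities of mean `N x² + y²` (`densityProfile_eq_scaledProfile`). As `N κ
→ 2 δ²`, the power tends to `exp (-δ² v)`; as `x² < 1`, the probabilities tend to `1` and `0`. A
constant majorant (`abs_scaledProfile_le`) allows dominated convergence, and `t = s⁻¹` gives the
stated integral. Since a continuous density is unique, the limit holds for any density `p`. -/

noncomputable section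

/-! ### The area formula, counting preimages -/

section AreaFormula

open Set

variable {E : Type*} [NormedAddCommGroup E] [NormedSpace ℝ E] [FiniteDimensional ℝ E]
  [MeasurableSpace E] [BorelSpace E]

/-- The regular points of a map can be partitioned into countably many measurable sets on which the
map is injective. -/
theorem exists_measurable_partition_injOn (f : E → E) (f' : E → E →L[ℝ] E)
    (hf' : ∀ x, HasFDerivAt f (f' x) x) (hc : Continuous f') :
    ∃ t : ℕ → Set E, Pairwise (Function.onFun Disjoint t) ∧ (∀ n, MeasurableSet (t n)) ∧
      (⋃ n, t n) = {x | (f' x).det ≠ 0} ∧ ∀ n, InjOn f (t n) := by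
  classical
  set s : Set E := {x | (f' x).det ≠ 0} with hs
  have hsm : MeasurableSet s := by
    have : Continuous fun x => (f' x).det := ContinuousLinearMap.continuous_det.comp hc
    exact (isOpen_ne_fun this continuous_const).measurableSet
  -- Half of the threshold `‖A⁻¹‖⁻¹` below which a Lipschitz perturbation of an invertible `A` stays
  -- injective. The value `1` only keeps the radius nonzero, for singular `A` and for the trivial
  -- space.
  let r : (E →L[ℝ] E) → NNReal := fun A =>
    if h : A.det ≠ 0 then
      (if ‖((A.toContinuousLinearEquivOfDetNeZero h).symm : E →L[ℝ] E)‖₊⁻¹ / 2 = 0 then 1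
        else ‖((A.toContinuousLinearEquivOfDetNeZero h).symm : E →L[ℝ] E)‖₊⁻¹ / 2)
    else 1
  have rpos : ∀ A, r A ≠ 0 := by
    intro A
    simp only [r]
    split_ifs <;> simp_all
  obtain ⟨t, A, tdisj, tm, tcov, tapp, tA⟩ :=
    exists_partition_approximatesLinearOn_of_hasFDerivWithinAt f s f'
      (fun x _ => (hf' x).hasFDerivWithinAt) r rpos
  refine ⟨fun n => s ∩ t n, ?_, fun n => hsm.inter (tm n), ?_, ?_⟩
  · intro i j hij
    exact (tdisj hij).mono inter_subset_right inter_subset_right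
  · rw [← inter_iUnion]
    exact inter_eq_left.2 tcov
  · intro n
    rcases s.eq_empty_or_nonempty with hse | hse
    · simp [hse]
    obtain ⟨y, hy, hAy⟩ := tA hse n
    have hdet : (A n).det ≠ 0 := by rw [hAy]; exact hy
    rcases subsingleton_or_nontrivial E with hE | hE
    · exact fun a _ b _ _ => Subsingleton.elim a b
    have happ := tapp n
    have hcoe : ((A n).toContinuousLinearEquivOfDetNeZero hdet : E →L[ℝ] E) = A n := by
      ext; simp
    have hne : ‖((A n).toContinuousLinearEquivOfDetNeZero hdet).symm.toContinuousLinearMap‖₊ ≠ 0 :=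
      (ContinuousLinearEquiv.nnnorm_symm_pos _).ne'
    have hr : r (A n) =
        ‖((A n).toContinuousLinearEquivOfDetNeZero hdet).symm.toContinuousLinearMap‖₊⁻¹ / 2 := by
      simp only [r, dif_pos hdet]
      rw [if_neg]
      simpa using hne
    rw [← hcoe] at happ
    refine happ.injOn (Or.inr ?_)
    rw [hcoe, hr]
    exact NNReal.half_lt_self (inv_ne_zero hne)

/-- The area formula for differentiable maps of a finite-dimensional space into itself, counting
preimages. -/
theorem lintegral_abs_det_fderiv_mul_eq_lintegral_tsum (μ : Measure E) [μ.IsAddHaarMeasure]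
    (f : E → E) (f' : E → E →L[ℝ] E)
    (hf' : ∀ x, HasFDerivAt f (f' x) x) (hc : Continuous f') (g : E → ENNReal)
    (hg : Measurable g) :
    ∫⁻ u, ENNReal.ofReal |(f' u).det| * g u ∂μ = ∫⁻ x, ∑' u, (f ⁻¹' {x}).indicator g u ∂μ := by
  classical
  obtain ⟨t, tdisj, tm, tU, tinj⟩ := exists_measurable_partition_injOn f f' hf' hc
  -- The sum has at most one nonzero term: `h n` is `g` composed with the inverse of `f` on `t n`,
  -- extended by zero.
  let h : ℕ → E → ENNReal := fun n x => ∑' u, (t n ∩ f ⁻¹' {x}).indicator g u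
  have hmem : ∀ n, ∀ u ∈ t n, h n (f u) = g u := by
    intro n u hu
    simp only [h]
    rw [tsum_eq_single u]
    · exact indicator_of_mem (show u ∈ t n ∩ f ⁻¹' {f u} from ⟨hu, rfl⟩) _
    · intro v hv
      refine indicator_of_notMem (fun hv' => hv ?_) _
      exact tinj n hv'.1 hu hv'.2
  have hout : ∀ n x, x ∉ f '' t n → h n x = 0 := by
    intro n x hx
    simp only [h, ENNReal.tsum_eq_zero]
    intro u
    exact indicator_of_notMem (fun hu => hx ⟨u, hu.1, hu.2⟩) _
  have hmeas : ∀ n, Measurable (h n) := by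
    intro n
    have he := measurableEmbedding_of_fderivWithin (tm n)
      (fun x _ => (hf' x).hasFDerivWithinAt) (tinj n)
    have : h n = Function.extend ((t n).domRestrict f) (fun u => g u) 0 := by
      ext x
      by_cases hx : x ∈ f '' t n
      · obtain ⟨u, hu, rfl⟩ := hx
        rw [hmem n u hu]
        exact (he.injective.extend_apply (fun u : t n => g u) 0 (⟨u, hu⟩ : t n)).symm
      · rw [hout n x hx, Function.extend_apply']
        · rfl
        · rintro ⟨u, rfl⟩
          exact hx ⟨u, u.2, rfl⟩
    rw [this]
    exact he.measurable_extend (hg.comp measurable_subtype_coe) measurable_zero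
  have hint : ∀ n, ∫⁻ x, h n x ∂μ = ∫⁻ u in t n, ENNReal.ofReal |(f' u).det| * g u ∂μ := by
    intro n
    have himg : MeasurableSet (f '' t n) :=
      measurable_image_of_fderivWithin (tm n) (fun x _ => (hf' x).hasFDerivWithinAt) (tinj n)
    have h1 : ∫⁻ x, h n x ∂μ = ∫⁻ x in f '' t n, h n x ∂μ := by
      rw [← lintegral_indicator himg]
      refine lintegral_congr fun x => ?_
      by_cases hx : x ∈ f '' t n
      · rw [indicator_of_mem hx]
      · rw [indicator_of_notMem hx, hout n x hx]
    rw [h1, lintegral_image_eq_lintegral_abs_det_fderiv_mul μ (tm n)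
      (fun x _ => (hf' x).hasFDerivWithinAt) (tinj n)]
    refine setLIntegral_congr_fun (tm n) fun u hu => ?_
    simp only [hmem n u hu]
  -- Sard: for almost every `x` all preimages are regular, hence covered by the sets `t n`.
  have hcrit : μ (f '' {x | (f' x).det = 0}) = 0 :=
    addHaar_image_eq_zero_of_det_fderivWithin_eq_zero μ
      (fun x _ => (hf' x).hasFDerivWithinAt) (fun x hx => hx)
  have hae : ∀ᵐ x ∂μ, ∑' u, (f ⁻¹' {x}).indicator g u = ∑' n, h n x := by
    have : ∀ᵐ x ∂μ, x ∉ f '' {x | (f' x).det = 0} := measure_eq_zero_iff_ae_notMem.1 hcrit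
    filter_upwards [this] with x hx
    simp only [h]
    rw [ENNReal.tsum_comm]
    refine tsum_congr fun u => ?_
    by_cases hu : f u = x
    · have hdu : u ∈ ⋃ n, t n := by
        rw [tU]
        exact fun h0 => hx ⟨u, h0, hu⟩
      obtain ⟨n, hn⟩ := mem_iUnion.1 hdu
      rw [tsum_eq_single n]
      · rw [indicator_of_mem (show u ∈ f ⁻¹' {x} from hu),
          indicator_of_mem (show u ∈ t n ∩ f ⁻¹' {x} from ⟨hn, hu⟩)]
      · intro k hk
        exact indicator_of_notMem
          (fun hk' => disjoint_left.1 (tdisj hk) hk'.1 hn) _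
    · rw [indicator_of_notMem (show u ∉ f ⁻¹' {x} from hu), eq_comm, ENNReal.tsum_eq_zero]
      exact fun n => indicator_of_notMem (fun h => hu h.2) _
  rw [lintegral_congr_ae hae, lintegral_tsum fun n => (hmeas n).aemeasurable]
  simp only [hint]
  rw [← lintegral_iUnion tm tdisj, tU, ← lintegral_indicator]
  · refine lintegral_congr fun u => ?_
    by_cases hu : (f' u).det = 0
    · simp [hu]
    · rw [indicator_of_mem (show u ∈ {x | (f' x).det ≠ 0} from hu)]
  · rw [← tU]
    exact MeasurableSet.iUnion tm

end AreaFormula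

/-! ### Mixed discriminants -/

section MixedDeterminant

open Matrix Polynomial Equiv Finset

variable {n : Type*} [Fintype n] [DecidableEq n]

/-- The (unnormalised) mixed discriminant of a family of matrices. -/
def mixedDet {R : Type*} [CommRing R] (T : n → Matrix n n R) : R :=
  ∑ σ : Perm n, ∑ π : Perm n, ((Perm.sign σ : ℤ) : R) * ((Perm.sign π : ℤ) : R) *
    ∏ j, T j (σ j) (π j)

/-- If `T j` is the second moment matrix of row `j` of a random matrix with independent rows, the
double sum is the mean of `|det|²`. Summing over `σ` alone leaves ordinary determinants, which are
multiplicative. -/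
theorem mixedDet_eq_sum_det {R : Type*} [CommRing R] (T : n → Matrix n n R) :
    mixedDet T = ∑ π : Perm n, ((Perm.sign π : ℤ) : R) *
      (Matrix.of fun k j => T j k (π j)).det := by
  rw [mixedDet, Finset.sum_comm]
  refine Finset.sum_congr rfl fun π _ => ?_
  rw [Matrix.det_apply', Finset.mul_sum]
  refine Finset.sum_congr rfl fun σ _ => ?_
  simp only [Matrix.of_apply]
  ring

theorem mixedDet_transpose {R : Type*} [CommRing R] (T : n → Matrix n n R) :
    mixedDet (fun j => (T j)ᵀ) = mixedDet T := by
  rw [mixedDet, mixedDet, Finset.sum_comm]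
  refine Finset.sum_congr rfl fun π _ => Finset.sum_congr rfl fun σ _ => ?_
  simp only [Matrix.transpose_apply]
  ring

theorem mixedDet_mul_left {R : Type*} [CommRing R] (P : Matrix n n R) (T : n → Matrix n n R) :
    mixedDet (fun j => P * T j) = P.det * mixedDet T := by
  rw [mixedDet_eq_sum_det, mixedDet_eq_sum_det, Finset.mul_sum]
  refine Finset.sum_congr rfl fun π _ => ?_
  have : (Matrix.of fun k j => (P * T j) k (π j)) = P * Matrix.of fun k j => T j k (π j) := by
    ext k j
    simp [Matrix.mul_apply]
  rw [this, Matrix.det_mul]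
  ring

theorem mixedDet_mul_right {R : Type*} [CommRing R] (Q : Matrix n n R) (T : n → Matrix n n R) :
    mixedDet (fun j => T j * Q) = Q.det * mixedDet T := by
  rw [← mixedDet_transpose]
  simp only [Matrix.transpose_mul]
  rw [mixedDet_mul_left, mixedDet_transpose, Matrix.det_transpose]

/-- The matrix with the rows of the identity in `J`, and those of `S` elsewhere. -/
def identityRows {R : Type*} [CommRing R] (J : Finset n) (S : Matrix n n R) : Matrix n n R :=
  Matrix.of fun i j => if i ∈ J then (1 : Matrix n n R) i j else S i j

theorem det_add_eq_sum_det {R : Type*} [CommRing R] (A B : Matrix n n R) :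
    (A + B).det = ∑ J : Finset n, (Matrix.of fun i j => if i ∈ J then A i j else B i j).det := by
  have h := (Matrix.detRowAlternating (n := n) (R := R)).map_add_univ (fun i => A i) (fun i => B i)
  refine h.trans (Finset.sum_congr rfl fun J _ => ?_)
  refine congrArg (Matrix.detRowAlternating (n := n) (R := R)) ?_
  funext i j
  by_cases hi : i ∈ J <;> simp [hi]

theorem det_diagonal_add_smul {R : Type*} [CommRing R] (d : n → R) (c : R) (S : Matrix n n R) :
    (Matrix.diagonal d + c • S).det =
      ∑ J : Finset n, (∏ j ∈ J, d j) * c ^ (Fintype.card n - J.card) * (identityRows J S).det := by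
  rw [det_add_eq_sum_det]
  refine Finset.sum_congr rfl fun J _ => ?_
  have h : (Matrix.of fun i j => if i ∈ J then Matrix.diagonal d i j else (c • S) i j) =
      Matrix.of fun i j => (if i ∈ J then d i else c) * identityRows J S i j := by
    ext i j
    by_cases hi : i ∈ J
    · simp [identityRows, hi, Matrix.diagonal_apply, Matrix.one_apply]
    · simp [identityRows, hi]
  rw [h, Matrix.det_mul_column, Finset.prod_ite]
  congr 2
  · congr 1
    ext
    simp
  · rw [Finset.prod_const]
    congr 1
    rw [← Finset.card_compl]
    congr 1
    ext
    simp

theorem card_perm_fixing (J : Finset n) :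
    (univ.filter fun π : Perm n => ∀ j ∈ J, π j = j).card =
      (Fintype.card n - J.card).factorial := by
  rw [← Fintype.card_subtype]
  have e := Perm.subtypeEquivSubtypePerm (fun a : n => a ∉ J)
  have h1 := Fintype.card_congr e
  rw [Fintype.card_perm] at h1
  have h2 : Fintype.card {a : n // a ∉ J} = Fintype.card n - J.card := by
    rw [Fintype.card_subtype_compl]
    simp
  rw [← h2, h1]
  exact Fintype.card_congr (Equiv.subtypeEquivRight fun π => by simp)

/-- For fixed `π`, the substitution `σ ↦ σ * π⁻¹` turns the inner sum into one determinant, in which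
the unit entry of index `j` survives exactly when `π` fixes `j`. In the expansion over sets `J` of
unit rows, each `J` is counted once for every permutation fixing it pointwise, whence the factorial.
-/
theorem mixedDet_single_add {R : Type*} [CommRing R] (S : Matrix n n R) :
    mixedDet (fun j => Matrix.single j j 1 + S) =
      ∑ J : Finset n, ((Fintype.card n - J.card).factorial : R) *
        (identityRows J S).det := by
  have h1 : mixedDet (fun j => Matrix.single j j 1 + S) =
      ∑ π : Perm n, (Matrix.diagonal (fun l => if π l = l then (1 : R) else 0) + S).det := by
    rw [mixedDet, Finset.sum_comm]
    refine Finset.sum_congr rfl fun π _ => ?_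
    rw [Matrix.det_apply']
    refine Fintype.sum_equiv (Equiv.mulRight π⁻¹) _ _ fun σ => ?_
    rw [Equiv.coe_mulRight, Perm.sign_mul, Perm.sign_inv]
    rw [← Equiv.prod_comp π (fun l => (Matrix.diagonal (fun l => if π l = l then (1 : R) else 0) +
      S) ((σ * π⁻¹) l) l)]
    rw [Units.val_mul, Int.cast_mul]
    congr 1
    refine Finset.prod_congr rfl fun j _ => ?_
    have hσ : (σ * π⁻¹) (π j) = σ j := by simp
    rw [hσ, Matrix.add_apply, Matrix.add_apply]
    congr 1
    by_cases h : π j = j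
    · by_cases h' : σ j = j
      · simp [h, h']
      · simp [h, Ne.symm h', h']
    · simp only [Matrix.single_apply, Matrix.diagonal_apply, Ne.symm h, and_false, if_false]
      rw [eq_comm, ite_eq_right_iff, ite_eq_right_iff]
      intro h1 h2
      rw [h1] at h2
      exact absurd (π.injective h2) h
  rw [h1]
  have h2 := fun π : Perm n =>
    det_diagonal_add_smul (fun l => if π l = l then (1 : R) else 0) 1 S
  simp only [one_smul, one_pow, mul_one] at h2
  simp only [h2]
  rw [Finset.sum_comm]
  refine Finset.sum_congr rfl fun J _ => ?_
  rw [← Finset.sum_mul]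
  congr 1
  rw [← card_perm_fixing J, Finset.card_filter]
  push_cast
  refine Finset.sum_congr rfl fun π _ => ?_
  rw [Finset.prod_ite_zero]
  simp

/-- The linear functional `X ^ k ↦ k!` on polynomials. -/
def factorialFunctional : ℂ[X] →ₗ[ℂ] ℂ :=
  Polynomial.lsum fun k => (k.factorial : ℂ) • LinearMap.id

theorem factorialFunctional_C_mul_X_pow (c : ℂ) (k : ℕ) :
    factorialFunctional (C c * X ^ k) = k.factorial * c := by
  rw [Polynomial.C_mul_X_pow_eq_monomial, factorialFunctional, Polynomial.lsum_apply,
    Polynomial.sum_monomial_index] <;> simp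

/-- The same expansion as in `mixedDet_single_add`, with powers of `X` where the factorials stood;
`factorialFunctional` exchanges the two. -/
theorem det_one_add_X_smul_eq_sum (S : Matrix n n ℂ) :
    ((1 : Matrix n n ℂ[X]) + (X : ℂ[X]) • S.map C).det =
      ∑ J : Finset n, C (identityRows J S).det * X ^ (Fintype.card n - J.card) := by
  have h1 := det_diagonal_add_smul (fun _ : n => (1 : ℂ[X])) X (S.map C)
  rw [Matrix.diagonal_one] at h1
  rw [h1]
  refine Finset.sum_congr rfl fun J _ => ?_
  rw [Finset.prod_const_one, one_mul, mul_comm]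
  congr 1
  rw [RingHom.map_det]
  congr 1
  ext i j : 2
  by_cases hi : i ∈ J
  · simp [identityRows, hi, Matrix.one_apply, apply_ite]
  · simp [identityRows, hi]

/-- For invertible `A` and `B`, the mixed discriminant of the matrices `Aⱼᵀ Bⱼ + S` built from the
rows `Aⱼ`, `Bⱼ`. -/
theorem mixedDet_vecMulVec_add (A B S : Matrix n n ℂ) (hA : A.det ≠ 0) (hB : B.det ≠ 0) :
    mixedDet (fun j => Matrix.vecMulVec (A j) (B j) + S) =
      factorialFunctional ((Aᵀ * B).map C + (X : ℂ[X]) • S.map C).det := by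
  -- Taking `Aᵀ` out on the left and `B` on the right leaves the matrix units `single j j 1` of the
  -- previous case.
  set S' := Aᵀ⁻¹ * S * B⁻¹ with hS'
  have hAt : IsUnit Aᵀ.det := by rw [Matrix.det_transpose]; exact hA.isUnit
  have hBu : IsUnit B.det := hB.isUnit
  have hS : S = Aᵀ * S' * B := by
    rw [hS', Matrix.mul_assoc, Matrix.nonsing_inv_mul_cancel_right _ _ hBu,
      Matrix.mul_nonsing_inv_cancel_left _ _ hAt]
  have h1 : (fun j => Matrix.vecMulVec (A j) (B j) + S) =
      fun j => Aᵀ * ((Matrix.single j j 1 + S') * B) := by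
    ext j : 1
    rw [Matrix.add_mul, Matrix.mul_add, ← Matrix.mul_assoc Aᵀ S', ← hS]
    congr 1
    ext k l
    simp [Matrix.vecMulVec_apply, Matrix.mul_apply, Matrix.single_apply, Finset.sum_ite_eq,
      ite_and]
  rw [h1, mixedDet_mul_left, mixedDet_mul_right (T := fun j => Matrix.single j j 1 + S'),
    mixedDet_single_add]
  have h2 : (Aᵀ * B).map C + (X : ℂ[X]) • S.map C =
      Aᵀ.map C * ((1 + (X : ℂ[X]) • S'.map C) * B.map C) := by
    rw [Matrix.add_mul, Matrix.mul_add, Matrix.one_mul, Matrix.smul_mul, Matrix.mul_smul,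
      ← Matrix.map_mul, ← Matrix.map_mul, ← Matrix.map_mul, ← Matrix.mul_assoc, ← hS]
  rw [h2, Matrix.det_mul, Matrix.det_mul, det_one_add_X_smul_eq_sum]
  have h3 : (Aᵀ.map (C : ℂ →+* ℂ[X])).det = C Aᵀ.det := by
    rw [RingHom.map_det]; rfl
  have h4 : (B.map (C : ℂ →+* ℂ[X])).det = C B.det := by
    rw [RingHom.map_det]; rfl
  rw [h3, h4]
  simp only [Finset.sum_mul, Finset.mul_sum, map_sum]
  refine Finset.sum_congr rfl fun J _ => ?_
  have : C Aᵀ.det * (C ((identityRows J S').det) *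
      X ^ (Fintype.card n - J.card) * C B.det) =
      C (Aᵀ.det * B.det * (identityRows J S').det) *
        X ^ (Fintype.card n - J.card) := by
    simp only [C_mul]; ring
  rw [this, factorialFunctional_C_mul_X_pow]
  ring

end MixedDeterminant

/-! ### Rank two perturbations of scalar matrices -/

section RankTwo

open Matrix Finset

variable {n : Type*} [Fintype n] [DecidableEq n]

/-- Sylvester's determinant identity after division by `c`; the power of `c` is the difference of
the two dimensions. -/
theorem det_smul_one_add_mul (c : ℂ) (hc : c ≠ 0) (U : Matrix n (Fin 2) ℂ)
    (V : Matrix (Fin 2) n ℂ) (hn : 2 ≤ Fintype.card n) :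
    (c • (1 : Matrix n n ℂ) + U * V).det =
      c ^ (Fintype.card n - 2) * (c • (1 : Matrix (Fin 2) (Fin 2) ℂ) + V * U).det := by
  have h1 : c • (1 : Matrix n n ℂ) + U * V = c • (1 + (c⁻¹ • U) * V) := by
    rw [Matrix.smul_mul, smul_add, smul_smul, mul_inv_cancel₀ hc, one_smul]
  have h2 : c • (1 : Matrix (Fin 2) (Fin 2) ℂ) + V * U = c • (1 + V * (c⁻¹ • U)) := by
    rw [Matrix.mul_smul, smul_add, smul_smul, mul_inv_cancel₀ hc, one_smul]
  rw [h1, h2, Matrix.det_smul, Matrix.det_smul, Matrix.det_one_add_mul_comm, Fintype.card_fin,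
    ← mul_assoc, ← pow_add, Nat.sub_add_cancel hn]

/-- The `n × 2` matrix with columns `v` and `w`. -/
def twoColumns (v w : n → ℂ) : Matrix n (Fin 2) ℂ := Matrix.of fun j => ![v j, w j]

theorem twoColumns_transpose_mul_self {n : Type*} [Fintype n] (v w : n → ℂ) :
    (twoColumns v w)ᵀ * twoColumns v w =
      !![∑ j, v j * v j, ∑ j, v j * w j; ∑ j, v j * w j, ∑ j, w j * w j] := by
  ext a b
  fin_cases a <;> fin_cases b <;> simp [twoColumns, Matrix.mul_apply, mul_comm]

theorem twoColumns_mul_mul_apply {n : Type*} (v w : n → ℂ) (a b c d : ℂ) (j k : n) :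
    (twoColumns v w * !![a, b; c, d] * (twoColumns v w)ᵀ) j k =
      a * v j * v k + b * v j * w k + c * w j * v k + d * w j * w k := by
  simp [twoColumns, Matrix.mul_apply, Fin.sum_univ_two]
  ring

/-- `det (Bᵀ B' + t S)` for rank two perturbations `B`, `B'`, `S` of scalar matrices. -/
theorem det_conditional_covariance (v w : n → ℂ) (p s s' τ z z' t D : ℂ)
    (hp : ∑ j, v j * w j = p) (hs : ∑ j, v j * v j = s) (hs' : ∑ j, w j * w j = s')
    (hD : D = p ^ 2 - τ ^ 2 * (s * s')) (hD0 : D ≠ 0) (hc : z * z' + t ≠ 0)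
    (hn : 2 ≤ Fintype.card n) (B B' S : Matrix n n ℂ)
    (hB : ∀ j k, B j k = z * (1 : Matrix n n ℂ) j k + v j * w k -
      z * v j * ((p * w k - τ ^ 2 * s' * v k) / D) - z' * w j * (τ * (p * v k - s * w k) / D))
    (hB' : ∀ j k, B' j k = z' * (1 : Matrix n n ℂ) j k + w j * v k -
      z' * w j * ((p * v k - τ ^ 2 * s * w k) / D) - z * v j * (τ * (p * w k - s' * v k) / D))
    (hS : ∀ k l, S k l = (1 : Matrix n n ℂ) k l - (p * w k - τ ^ 2 * s' * v k) / D * v l -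
      τ * (τ * (p * v k - s * w k) / D) * w l) :
    (Bᵀ * B' + t • S).det = (z * z' + t) ^ (Fintype.card n - 2) *
      (p ^ 2 * ((z - τ * (p ^ 2 - s * s') / D * z') * (z' - τ * (p ^ 2 - s * s') / D * z) +
        t * ((1 - τ ^ 2) * p ^ 2 / D))) := by
  set U := twoColumns v w with hU
  -- `M`, `M'` and `K` are the coordinates, with respect to `v` and `w`, of `B`, `B'` and `S`
  -- without their scalar parts. Only the Gram matrix `Uᵀ * U` enters the reduced determinant.
  set M : Matrix (Fin 2) (Fin 2) ℂ :=
    !![z * τ ^ 2 * s' / D, 1 - z * p / D; - z' * τ * p / D, z' * τ * s / D] with hM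
  set M' : Matrix (Fin 2) (Fin 2) ℂ :=
    !![z * τ * s' / D, - z * τ * p / D; 1 - z' * p / D, z' * τ ^ 2 * s / D] with hM'
  set K : Matrix (Fin 2) (Fin 2) ℂ :=
    !![τ ^ 2 * s' / D, - τ ^ 2 * p / D; - p / D, τ ^ 2 * s / D] with hK
  have eB : B = z • (1 : Matrix n n ℂ) + U * M * Uᵀ := by
    ext j k
    rw [Matrix.add_apply, twoColumns_mul_mul_apply, hB, Matrix.smul_apply, smul_eq_mul]
    ring
  have eB' : B' = z' • (1 : Matrix n n ℂ) + U * M' * Uᵀ := by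
    ext j k
    rw [Matrix.add_apply, twoColumns_mul_mul_apply, hB', Matrix.smul_apply, smul_eq_mul]
    ring
  have eS : S = (1 : Matrix n n ℂ) + U * K * Uᵀ := by
    ext j k
    rw [Matrix.add_apply, twoColumns_mul_mul_apply, hS]
    ring
  have e : Bᵀ * B' + t • S = (z * z' + t) • (1 : Matrix n n ℂ) +
      U * ((z • M' + z' • Mᵀ + Mᵀ * (Uᵀ * U) * M' + t • K) * Uᵀ) := by
    rw [eB, eB', eS]
    simp only [Matrix.transpose_add, Matrix.transpose_smul, Matrix.transpose_one,
      Matrix.transpose_mul, Matrix.transpose_transpose, Matrix.add_mul, Matrix.mul_add,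
      Matrix.smul_mul, Matrix.mul_smul, Matrix.one_mul, Matrix.mul_one, smul_add, smul_smul,
      add_smul, Matrix.mul_assoc]
    rw [mul_comm z z']
    abel
  have hG := twoColumns_transpose_mul_self v w
  rw [hp, hs, hs', ← hU] at hG
  rw [e, det_smul_one_add_mul _ hc _ _ hn, Matrix.mul_assoc _ Uᵀ U, hG]
  congr 1
  rw [hM, hM', hK]
  clear_value U
  clear hB hB' hS eB eB' eS e hM hM' hK hG hU hp hs hs' B B' S M M' K U hc
  simp only [Matrix.det_fin_two, Matrix.add_apply, Matrix.smul_apply, Matrix.mul_apply,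
    Fin.sum_univ_two, Matrix.transpose_apply, Matrix.of_apply, Matrix.cons_val', Matrix.cons_val_zero,
    Matrix.cons_val_one, Matrix.cons_val_fin_one, smul_eq_mul, Matrix.one_apply_eq]
  simp only [mul_zero, mul_one, zero_add, Matrix.one_apply, Fin.zero_eq_one_iff,
    Fin.one_eq_zero_iff, OfNat.ofNat_ne_one, if_false]
  field_simp
  rw [hD]
  ring

/-- Serves to show that the conditional mean is invertible, as `mixedDet_vecMulVec_add` requires. -/
theorem det_conditional_mean (v w : n → ℂ) (p s s' τ z z' D : ℂ)
    (hp : ∑ j, v j * w j = p) (hs : ∑ j, v j * v j = s) (hs' : ∑ j, w j * w j = s')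
    (hD : D = p ^ 2 - τ ^ 2 * (s * s')) (hD0 : D ≠ 0) (hc : z ≠ 0)
    (hn : 2 ≤ Fintype.card n) (B : Matrix n n ℂ)
    (hB : ∀ j k, B j k = z * (1 : Matrix n n ℂ) j k + v j * w k -
      z * v j * ((p * w k - τ ^ 2 * s' * v k) / D) - z' * w j * (τ * (p * v k - s * w k) / D)) :
    B.det = z ^ (Fintype.card n - 2) * (p * (z - τ * (p ^ 2 - s * s') / D * z')) := by
  set U := twoColumns v w with hU
  set M : Matrix (Fin 2) (Fin 2) ℂ :=
    !![z * τ ^ 2 * s' / D, 1 - z * p / D; - z' * τ * p / D, z' * τ * s / D] with hM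
  have eB : B = z • (1 : Matrix n n ℂ) + U * (M * Uᵀ) := by
    ext j k
    rw [← Matrix.mul_assoc, Matrix.add_apply, twoColumns_mul_mul_apply, hB, Matrix.smul_apply,
      smul_eq_mul]
    ring
  have hG := twoColumns_transpose_mul_self v w
  rw [hp, hs, hs', ← hU] at hG
  rw [eB, det_smul_one_add_mul _ hc _ _ hn, Matrix.mul_assoc _ Uᵀ U, hG]
  congr 1
  rw [hM]
  clear_value U
  clear hB eB hM hG hU hp hs hs' B M U
  simp only [Matrix.det_fin_two, Matrix.add_apply, Matrix.smul_apply, Matrix.mul_apply,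
    Fin.sum_univ_two, Matrix.of_apply, Matrix.cons_val', Matrix.cons_val_zero,
    Matrix.cons_val_one, Matrix.cons_val_fin_one, smul_eq_mul, Matrix.one_apply_eq]
  simp only [mul_zero, mul_one, zero_add, Matrix.one_apply, Fin.zero_eq_one_iff,
    Fin.one_eq_zero_iff, OfNat.ofNat_ne_one, if_false]
  field_simp
  rw [hD]
  ring

end RankTwo

/-! ### The law of `G_τ` -/

section Law

open Complex

theorem lintegral_fin_prod_eq_prod {α : Type*} [MeasurableSpace α] :
    ∀ {N : ℕ} (μ : Fin N → Measure α) [∀ i, SigmaFinite (μ i)] (f : Fin N → α → ENNReal),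
      (∀ i, Measurable (f i)) →
      ∫⁻ x, ∏ i, f i (x i) ∂Measure.pi μ = ∏ i, ∫⁻ x, f i x ∂μ i
  | 0, μ, _, f, _ => by simp
  | N + 1, μ, _, f, hf => by
    have hm : Measurable fun y : Fin N → α => ∏ i : Fin N, f i.succ (y i) :=
      Finset.measurable_prod _ fun i _ => (hf _).comp (measurable_pi_apply i)
    rw [(measurePreserving_piFinSuccAbove μ 0).symm.lintegral_map_equiv
      (fun x => ∏ i, f i (x i)) _]
    simp only [MeasurableEquiv.piFinSuccAbove_symm_apply, Fin.prod_univ_succ, Fin.insertNthEquiv_apply,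
      Fin.insertNth_zero, Fin.cons_zero, Fin.cons_succ]
    rw [← lintegral_fin_prod_eq_prod (fun i => μ (Fin.succ i)) (fun i => f i.succ)
      fun i => hf i.succ]
    exact lintegral_prod_mul (hf 0).aemeasurable hm.aemeasurable

theorem pi_withDensity {α : Type*} [MeasurableSpace α] {N : ℕ} (μ : Fin N → Measure α)
    [∀ i, SigmaFinite (μ i)] (f : Fin N → α → ENNReal) (hf : ∀ i, Measurable (f i))
    [∀ i, SigmaFinite ((μ i).withDensity (f i))] :
    (Measure.pi fun i => (μ i).withDensity (f i)) =
      (Measure.pi μ).withDensity fun x => ∏ i, f i (x i) := by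
  refine Measure.pi_eq fun s hs => ?_
  rw [withDensity_apply _ (MeasurableSet.univ_pi hs), ← lintegral_indicator (MeasurableSet.univ_pi hs)]
  have : ∀ x : Fin N → α, (Set.univ.pi s).indicator (fun x => ∏ i, f i (x i)) x =
      ∏ i, (s i).indicator (f i) (x i) := by
    intro x
    by_cases hx : x ∈ Set.univ.pi s
    · rw [Set.indicator_of_mem hx]
      exact Finset.prod_congr rfl fun i _ => (Set.indicator_of_mem (hx i trivial) _).symm
    · rw [Set.indicator_of_notMem hx]
      simp only [Set.mem_pi, Set.mem_univ, true_imp_iff, not_forall] at hx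
      obtain ⟨i, hi⟩ := hx
      exact (Finset.prod_eq_zero (Finset.mem_univ i) (Set.indicator_of_notMem hi _)).symm
  simp only [this]
  rw [lintegral_fin_prod_eq_prod μ _ fun i => (hf i).indicator (hs i)]
  refine Finset.prod_congr rfl fun i _ => ?_
  rw [lintegral_indicator (hs i), withDensity_apply _ (hs i)]

/-- The density of an entry of `G_τ`. -/
def entryDensity (τ : ℝ) (c : ℂ) : ℝ :=
  1 / (Real.pi * Real.sqrt (1 - τ ^ 2)) *
    Real.exp (-(c.re ^ 2 / (1 + τ) + c.im ^ 2 / (1 - τ)))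

/-- The law of an entry of `G_τ`. -/
def entryLaw (τ : ℝ) : Measure ℂ :=
  volume.withDensity fun c => ENNReal.ofReal (entryDensity τ c)

theorem entryDensity_nonneg (τ : ℝ) (c : ℂ) : 0 ≤ entryDensity τ c := by
  unfold entryDensity; positivity

theorem continuous_entryDensity (τ : ℝ) : Continuous (entryDensity τ) := by
  unfold entryDensity; fun_prop

/-- An entry of `G_τ` as a function of two standard normal variables. -/
def entryMap (τ : ℝ) (x : ℝ × ℝ) : ℂ :=
  (Real.sqrt ((1 + τ) / 2) * x.1 : ℂ) + I * (Real.sqrt ((1 - τ) / 2) * x.2 : ℂ)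

theorem continuous_entryMap (τ : ℝ) : Continuous (entryMap τ) := by
  unfold entryMap; fun_prop

theorem measurePreserving_entryMap {τ : ℝ} (hτ : |τ| < 1) :
    MeasurePreserving (entryMap τ) ((gaussianReal 0 1).prod (gaussianReal 0 1)) (entryLaw τ) := by
  have h1 : 0 < 1 + τ := by linarith [(abs_lt.1 hτ).1]
  have h2 : 0 < 1 - τ := by linarith [(abs_lt.1 hτ).2]
  refine ⟨(continuous_entryMap τ).measurable, ?_⟩
  set a := Real.sqrt ((1 + τ) / 2) with ha
  set b := Real.sqrt ((1 - τ) / 2) with hb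
  have ha0 : 0 < a := Real.sqrt_pos.2 (by positivity)
  have hb0 : 0 < b := Real.sqrt_pos.2 (by positivity)
  have ha2 : a ^ 2 = (1 + τ) / 2 := Real.sq_sqrt (by positivity)
  have hb2 : b ^ 2 = (1 - τ) / 2 := Real.sq_sqrt (by positivity)
  have hcomp : entryMap τ = Complex.measurableEquivRealProd.symm ∘
      Prod.map (fun x => a * x) (fun x => b * x) := by
    ext x
    apply Complex.ext <;> simp [entryMap, ← ha, ← hb, measurableEquivRealProd_symm_apply]
  rw [hcomp, ← Measure.map_map Complex.measurableEquivRealProd.symm.measurable (by fun_prop),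
    ← Measure.map_prod_map _ _ (by fun_prop) (by fun_prop), gaussianReal_map_const_mul,
    gaussianReal_map_const_mul]
  set va : NNReal := NNReal.mk (a ^ 2) (sq_nonneg a) * 1 with hva
  set vb : NNReal := NNReal.mk (b ^ 2) (sq_nonneg b) * 1 with hvb
  have hva' : (va : ℝ) = (1 + τ) / 2 := by rw [hva, mul_one]; exact ha2
  have hvb' : (vb : ℝ) = (1 - τ) / 2 := by rw [hvb, mul_one]; exact hb2
  have hva0 : va ≠ 0 := by
    intro h; rw [h] at hva'; simp at hva'; linarith
  have hvb0 : vb ≠ 0 := by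
    intro h; rw [h] at hvb'; simp at hvb'; linarith
  rw [gaussianReal_of_var_ne_zero _ hva0, gaussianReal_of_var_ne_zero _ hvb0,
    prod_withDensity (measurable_gaussianPDF _ _) (measurable_gaussianPDF _ _)]
  refine Measure.ext_of_lintegral _ fun h hh => ?_
  have hmd : Measurable fun c : ℂ => ENNReal.ofReal (entryDensity τ c) :=
    (continuous_entryDensity τ).measurable.ennreal_ofReal
  rw [lintegral_map hh Complex.measurableEquivRealProd.symm.measurable, entryLaw,
    lintegral_withDensity_eq_lintegral_mul _ (by fun_prop)
      (show Measurable fun a => h (Complex.measurableEquivRealProd.symm a) from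
        hh.comp Complex.measurableEquivRealProd.symm.measurable),
    lintegral_withDensity_eq_lintegral_mul _ hmd hh,
    Complex.volume_preserving_equiv_real_prod.symm.lintegral_map_equiv _
      Complex.measurableEquivRealProd.symm]
  refine lintegral_congr fun x => ?_
  simp only [Pi.mul_apply]
  congr 1
  rw [gaussianPDF, gaussianPDF, ← ENNReal.ofReal_mul (gaussianPDFReal_nonneg _ _ _)]
  congr 1
  rw [gaussianPDFReal, gaussianPDFReal, entryDensity, hva', hvb', mul_mul_mul_comm, ← Real.exp_add,
    ← mul_inv, ← Real.sqrt_mul (by positivity), one_div]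
  congr 2
  · have : 2 * Real.pi * ((1 + τ) / 2) * (2 * Real.pi * ((1 - τ) / 2)) =
        Real.pi ^ 2 * (1 - τ ^ 2) := by ring
    rw [this, Real.sqrt_mul (by positivity), Real.sqrt_sq Real.pi_pos.le]
  · simp [measurableEquivRealProd_symm_apply]
    field_simp
    ring

theorem isProbabilityMeasure_entryLaw {τ : ℝ} (hτ : |τ| < 1) :
    IsProbabilityMeasure (entryLaw τ) := by
  rw [← (measurePreserving_entryMap hτ).map_eq]
  exact Measure.isProbabilityMeasure_map (continuous_entryMap τ).aemeasurable

instance (τ : ℝ) : SigmaFinite (entryLaw τ) := by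
  unfold entryLaw
  exact SigmaFinite.withDensity_ofReal _

/-- The law of `G_τ`. -/
def matrixLaw (N : ℕ) (τ : ℝ) : Measure (Fin N → Fin N → ℂ) :=
  Measure.pi fun _ => Measure.pi fun _ => entryLaw τ

/-- The two arrays of normal variables are zipped into one array of independent pairs, on which
`entryMap` acts entrywise. -/
theorem measurePreserving_interpolatingMatrix (N : ℕ) {τ : ℝ} (hτ : |τ| < 1) :
    MeasurePreserving
      (fun G : (Fin N → Fin N → ℝ) × (Fin N → Fin N → ℝ) =>
        fun i j => interpolatingMatrix τ G.1 G.2 i j)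
      ((realGinibre N).prod (realGinibre N)) (matrixLaw N τ) := by
  have hP := isProbabilityMeasure_entryLaw hτ
  have e1 := measurePreserving_arrowProdEquivProdArrow (Fin N → ℝ) (Fin N → ℝ) (Fin N)
    (fun _ => Measure.pi fun _ => gaussianReal 0 1) (fun _ => Measure.pi fun _ => gaussianReal 0 1)
  have e2 : MeasurePreserving
      (fun (a : Fin N → (Fin N → ℝ) × (Fin N → ℝ)) i =>
        (MeasurableEquiv.arrowProdEquivProdArrow ℝ ℝ (Fin N)).symm (a i))
      (Measure.pi fun _ => (Measure.pi fun _ => gaussianReal 0 1).prod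
        (Measure.pi fun _ => gaussianReal 0 1))
      (Measure.pi fun _ => Measure.pi fun _ => (gaussianReal 0 1).prod (gaussianReal 0 1)) :=
    measurePreserving_pi _ _ fun _ => (measurePreserving_arrowProdEquivProdArrow ℝ ℝ (Fin N)
      (fun _ => gaussianReal 0 1) (fun _ => gaussianReal 0 1)).symm
  have e3 : MeasurePreserving
      (fun (a : Fin N → Fin N → ℝ × ℝ) i j => entryMap τ (a i j))
      (Measure.pi fun _ => Measure.pi fun _ => (gaussianReal 0 1).prod (gaussianReal 0 1))
      (matrixLaw N τ) :=
    measurePreserving_pi _ _ (f := fun (_ : Fin N) (a : Fin N → ℝ × ℝ) j => entryMap τ (a j))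
      fun _ => measurePreserving_pi _ _ fun _ => measurePreserving_entryMap hτ
  exact e3.comp (e2.comp e1.symm)

/-- The density of `G_τ`. -/
def matrixDensity {N : ℕ} (τ : ℝ) (X : Fin N → Fin N → ℂ) : ℝ :=
  ∏ i, ∏ j, entryDensity τ (X i j)

theorem continuous_matrixDensity {N : ℕ} (τ : ℝ) :
    Continuous (matrixDensity τ : (Fin N → Fin N → ℂ) → ℝ) := by
  have := continuous_entryDensity τ
  unfold matrixDensity
  fun_prop

theorem matrixLaw_eq_withDensity (N : ℕ) {τ : ℝ} (hτ : |τ| < 1) :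
    matrixLaw N τ = volume.withDensity fun X => ENNReal.ofReal (matrixDensity τ X) := by
  have hP := isProbabilityMeasure_entryLaw hτ
  have hmd : Measurable fun c : ℂ => ENNReal.ofReal (entryDensity τ c) :=
    (continuous_entryDensity τ).measurable.ennreal_ofReal
  have h1 : (Measure.pi fun _ : Fin N => entryLaw τ) =
      (volume : Measure (Fin N → ℂ)).withDensity
        fun r => ∏ j, ENNReal.ofReal (entryDensity τ (r j)) := by
    have : ∀ _ : Fin N, SigmaFinite
      ((volume : Measure ℂ).withDensity fun c => ENNReal.ofReal (entryDensity τ c)) :=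
      fun _ => (inferInstance : SigmaFinite (entryLaw τ))
    exact pi_withDensity (fun _ : Fin N => (volume : Measure ℂ)) _ fun _ => hmd
  have hs : SigmaFinite ((volume : Measure (Fin N → ℂ)).withDensity
        fun r => ∏ j, ENNReal.ofReal (entryDensity τ (r j))) := by
    rw [← h1]; infer_instance
  have hm2 : Measurable fun r : Fin N → ℂ => ∏ j, ENNReal.ofReal (entryDensity τ (r j)) :=
    Finset.measurable_prod _ fun j _ => hmd.comp (measurable_pi_apply j)
  have : ∀ _ : Fin N, SigmaFinite ((volume : Measure (Fin N → ℂ)).withDensity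
        fun r => ∏ j, ENNReal.ofReal (entryDensity τ (r j))) := fun _ => hs
  rw [matrixLaw, h1, pi_withDensity (fun _ : Fin N => (volume : Measure (Fin N → ℂ)))
    (fun _ r => ∏ j, ENNReal.ofReal (entryDensity τ (r j))) fun _ => hm2]
  change (volume : Measure (Fin N → Fin N → ℂ)).withDensity _ = _
  congr 1
  ext X
  rw [matrixDensity, ENNReal.ofReal_prod_of_nonneg
    fun _ _ => Finset.prod_nonneg fun _ _ => entryDensity_nonneg _ _]
  refine Finset.prod_congr rfl fun i _ => ?_
  rw [ENNReal.ofReal_prod_of_nonneg fun _ _ => entryDensity_nonneg _ _]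

theorem lintegral_matrixLaw (N : ℕ) {τ : ℝ} (hτ : |τ| < 1) {h : (Fin N → Fin N → ℂ) → ENNReal}
    (hh : Measurable h) :
    ∫⁻ X, h X ∂matrixLaw N τ = ∫⁻ X, ENNReal.ofReal (matrixDensity τ X) * h X := by
  rw [matrixLaw_eq_withDensity N hτ, lintegral_withDensity_eq_lintegral_mul _
    (continuous_matrixDensity τ).measurable.ennreal_ofReal hh]
  rfl

end Law

/-! ### Second moments of the entries and of affine forms in a row -/

section Moments

open Complex ComplexConjugate

theorem memLp_entryLaw {τ : ℝ} (hτ : |τ| < 1) : MemLp (fun c : ℂ => c) 2 (entryLaw τ) := by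
  have h := measurePreserving_entryMap hτ
  rw [← h.map_eq, memLp_map_measure_iff (by fun_prop) h.aemeasurable]
  have h1 : MemLp (fun x : ℝ => x) 2 (gaussianReal 0 1) := memLp_id_gaussianReal' 2 (by simp)
  have hS : MemLp (fun x : ℝ × ℝ => (x.1 : ℂ)) 2 ((gaussianReal 0 1).prod (gaussianReal 0 1)) :=
    (h1.comp_measurePreserving measurePreserving_fst).ofReal
  have hT : MemLp (fun x : ℝ × ℝ => (x.2 : ℂ)) 2 ((gaussianReal 0 1).prod (gaussianReal 0 1)) :=
    (h1.comp_measurePreserving measurePreserving_snd).ofReal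
  exact (hS.const_mul _).add ((hT.const_mul _).const_mul _)

theorem integral_sq_gaussianReal : ∫ x, x ^ 2 ∂gaussianReal 0 1 = 1 := by
  have h := variance_eq_sub (memLp_id_gaussianReal' (μ := 0) (v := 1) 2 (by simp))
  rw [variance_id_gaussianReal] at h
  simpa [integral_id_gaussianReal] using h.symm

theorem integral_entryLaw {τ : ℝ} (hτ : |τ| < 1) {h : ℂ → ℂ} (hh : Continuous h) :
    ∫ c, h c ∂entryLaw τ =
      ∫ x : ℝ × ℝ, h (entryMap τ x) ∂(gaussianReal 0 1).prod (gaussianReal 0 1) := by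
  rw [← (measurePreserving_entryMap hτ).map_eq, integral_map (continuous_entryMap τ).aemeasurable
    hh.aestronglyMeasurable]

theorem gaussian_pair_moments :
    let γ := (gaussianReal 0 1).prod (gaussianReal 0 1)
    (Integrable (fun x : ℝ × ℝ => (x.1 : ℂ)) γ ∧ Integrable (fun x : ℝ × ℝ => (x.2 : ℂ)) γ ∧
    Integrable (fun x : ℝ × ℝ => (x.1 : ℂ) ^ 2) γ ∧ Integrable (fun x : ℝ × ℝ => (x.2 : ℂ) ^ 2) γ ∧
    Integrable (fun x : ℝ × ℝ => (x.1 : ℂ) * x.2) γ) ∧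
    ∫ x, (x.1 : ℂ) ∂γ = 0 ∧ ∫ x, (x.2 : ℂ) ∂γ = 0 ∧ ∫ x, (x.1 : ℂ) ^ 2 ∂γ = 1 ∧
    ∫ x, (x.2 : ℂ) ^ 2 ∂γ = 1 ∧ ∫ x, (x.1 : ℂ) * x.2 ∂γ = 0 := by
  intro γ
  have h1 : MemLp (fun x : ℝ => x) 2 (gaussianReal 0 1) := memLp_id_gaussianReal' 2 (by simp)
  have h1C : MemLp (fun x : ℝ => (x : ℂ)) 2 (gaussianReal 0 1) := h1.ofReal
  have i1 : Integrable (fun x : ℝ => (x : ℂ)) (gaussianReal 0 1) := h1C.integrable (by norm_num)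
  have i2 : Integrable (fun x : ℝ => (x : ℂ) ^ 2) (gaussianReal 0 1) := by
    simpa using h1.integrable_sq.ofReal (𝕜 := ℂ)
  have e1 : ∫ x : ℝ, (x : ℂ) ∂gaussianReal 0 1 = 0 := by
    rw [integral_complex_ofReal, integral_id_gaussianReal, ofReal_zero]
  have e2 : ∫ x : ℝ, (x : ℂ) ^ 2 ∂gaussianReal 0 1 = 1 := by
    have : ∀ x : ℝ, (x : ℂ) ^ 2 = ((x ^ 2 : ℝ) : ℂ) := fun x => by push_cast; rfl
    simp only [this]
    rw [integral_complex_ofReal, integral_sq_gaussianReal, ofReal_one]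
  refine ⟨⟨i1.comp_fst _, i1.comp_snd _, i2.comp_fst _, i2.comp_snd _, i1.mul_prod i1⟩,
    ?_, ?_, ?_, ?_, ?_⟩
  · rw [integral_fun_fst (fun x : ℝ => (x : ℂ)), e1, smul_zero]
  · rw [integral_fun_snd (fun x : ℝ => (x : ℂ)), e1, smul_zero]
  · rw [integral_fun_fst (fun x : ℝ => (x : ℂ) ^ 2), e2]; simp
  · rw [integral_fun_snd (fun x : ℝ => (x : ℂ) ^ 2), e2]; simp
  · rw [integral_prod_mul (fun x : ℝ => (x : ℂ)) (fun x : ℝ => (x : ℂ)), e1, zero_mul]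

theorem entryLaw_moments {τ : ℝ} (hτ : |τ| < 1) :
    ∫ c, c ∂entryLaw τ = 0 ∧ ∫ c, c * c ∂entryLaw τ = τ ∧ ∫ c, c * conj c ∂entryLaw τ = 1 := by
  have h1 : 0 < 1 + τ := by linarith [(abs_lt.1 hτ).1]
  have h2 : 0 < 1 - τ := by linarith [(abs_lt.1 hτ).2]
  obtain ⟨⟨i1, i2, i3, i4, i5⟩, e1, e2, e3, e4, e5⟩ := gaussian_pair_moments
  rw [integral_entryLaw hτ (h := fun c => c) continuous_id, integral_entryLaw hτ (h := fun c => c * c) (by fun_prop),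
    integral_entryLaw hτ (h := fun c => c * conj c) (by fun_prop)]
  simp only [entryMap]
  set a := Real.sqrt ((1 + τ) / 2) with ha
  set b := Real.sqrt ((1 - τ) / 2) with hb
  have ha2 : (a : ℂ) ^ 2 = (1 + τ) / 2 := by
    rw [← ofReal_pow, Real.sq_sqrt (by positivity)]; push_cast; rfl
  have hb2 : (b : ℂ) ^ 2 = (1 - τ) / 2 := by
    rw [← ofReal_pow, Real.sq_sqrt (by positivity)]; push_cast; rfl
  refine ⟨?_, ?_, ?_⟩
  · rw [integral_add (i1.const_mul _) ((i2.const_mul _).const_mul _), integral_const_mul,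
      integral_const_mul, integral_const_mul, e1, e2]
    simp
  · have : ∀ x : ℝ × ℝ, ((a : ℂ) * x.1 + I * (b * x.2)) * (a * x.1 + I * (b * x.2)) =
        (a : ℂ) ^ 2 * (x.1 : ℂ) ^ 2 + (- (b : ℂ) ^ 2 * (x.2 : ℂ) ^ 2 +
          2 * I * a * b * ((x.1 : ℂ) * x.2)) := by
      intro x
      linear_combination (b : ℂ) ^ 2 * (x.2 : ℂ) ^ 2 * I_sq
    simp only [this]
    have i6 : Integrable (fun x : ℝ × ℝ => - (b : ℂ) ^ 2 * (x.2 : ℂ) ^ 2 +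
        2 * I * a * b * ((x.1 : ℂ) * x.2)) ((gaussianReal 0 1).prod (gaussianReal 0 1)) :=
      (i4.const_mul _).add (i5.const_mul _)
    rw [integral_add (i3.const_mul _) i6,
      integral_add (i4.const_mul _) (i5.const_mul _), integral_const_mul, integral_const_mul,
      integral_const_mul, e3, e4, e5, ha2, hb2]
    ring
  · have : ∀ x : ℝ × ℝ, ((a : ℂ) * x.1 + I * (b * x.2)) * conj (a * x.1 + I * (b * x.2) : ℂ) =
        (a : ℂ) ^ 2 * (x.1 : ℂ) ^ 2 + (b : ℂ) ^ 2 * (x.2 : ℂ) ^ 2 := by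
      intro x
      simp only [map_add, map_mul, conj_ofReal, conj_I]
      linear_combination - (b : ℂ) ^ 2 * (x.2 : ℂ) ^ 2 * I_sq
    simp only [this]
    rw [integral_add (i3.const_mul _) (i4.const_mul _), integral_const_mul, integral_const_mul,
      e3, e4, ha2, hb2]
    ring

theorem integral_affine_mul_affine {Ω ι : Type*} [MeasurableSpace Ω] [Fintype ι] (μ : Measure Ω)
    [IsProbabilityMeasure μ] (ξ : ι → Ω → ℂ) (h1 : ∀ a, Integrable (ξ a) μ)
    (h2 : ∀ a b, Integrable (fun ω => ξ a ω * ξ b ω) μ) (h0 : ∀ a, ∫ ω, ξ a ω ∂μ = 0)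
    (e e' : ℂ) (C C' : ι → ℂ) :
    Integrable (fun ω => (e + ∑ a, C a * ξ a ω) * (e' + ∑ a, C' a * ξ a ω)) μ ∧
    ∫ ω, (e + ∑ a, C a * ξ a ω) * (e' + ∑ a, C' a * ξ a ω) ∂μ =
      e * e' + ∑ a, ∑ b, C a * C' b * ∫ ω, ξ a ω * ξ b ω ∂μ := by
  have hexp : ∀ ω, (e + ∑ a, C a * ξ a ω) * (e' + ∑ a, C' a * ξ a ω) =
      e * e' + (∑ a, (e' * C a + e * C' a) * ξ a ω +
        ∑ a, ∑ b, C a * C' b * (ξ a ω * ξ b ω)) := by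
    intro ω
    have : (∑ a, C a * ξ a ω) * (∑ b, C' b * ξ b ω) = ∑ a, ∑ b, C a * C' b * (ξ a ω * ξ b ω) := by
      rw [Finset.sum_mul_sum]
      exact Finset.sum_congr rfl fun a _ => Finset.sum_congr rfl fun b _ => by ring
    rw [← this]
    simp only [add_mul, Finset.sum_add_distrib, mul_assoc, ← Finset.mul_sum]
    ring
  have i1 : Integrable (fun ω => ∑ a, (e' * C a + e * C' a) * ξ a ω) μ :=
    integrable_finsetSum _ fun a _ => (h1 a).const_mul _
  have i2 : Integrable (fun ω => ∑ a, ∑ b, C a * C' b * (ξ a ω * ξ b ω)) μ :=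
    integrable_finsetSum _ fun a _ => integrable_finsetSum _ fun b _ => (h2 a b).const_mul _
  have i3 : Integrable (fun ω => ∑ a, (e' * C a + e * C' a) * ξ a ω +
      ∑ a, ∑ b, C a * C' b * (ξ a ω * ξ b ω)) μ := i1.add i2
  simp only [hexp]
  refine ⟨(integrable_const _).add i3, ?_⟩
  rw [integral_add (integrable_const _) i3, integral_add i1 i2,
    integral_finsetSum _ fun a _ => (h1 a).const_mul _,
    integral_finsetSum _ fun a _ => integrable_finsetSum _ fun b _ => (h2 a b).const_mul _]
  have : ∀ a, ∫ ω, ∑ b, C a * C' b * (ξ a ω * ξ b ω) ∂μ =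
      ∑ b, C a * C' b * ∫ ω, ξ a ω * ξ b ω ∂μ := by
    intro a
    rw [integral_finsetSum _ fun b _ => (h2 a b).const_mul _]
    exact Finset.sum_congr rfl fun b _ => integral_const_mul _ _
  simp only [this, integral_const_mul, h0]
  simp

/-- The entries and their conjugates form a family of `2N` centred variables. Independence kills
pairs with distinct indices; the four pairs at one index have means `τ`, `1`, `1`, `τ`. -/
theorem integral_row_affine {N : ℕ} {τ : ℝ} (hτ : |τ| < 1) (e e' : ℂ) (c d c' d' : Fin N → ℂ) :
    Integrable (fun r : Fin N → ℂ => (e + ∑ i, (c i * r i + d i * conj (r i))) *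
      (e' + ∑ i, (c' i * r i + d' i * conj (r i)))) (Measure.pi fun _ => entryLaw τ) ∧
    ∫ r : Fin N → ℂ, (e + ∑ i, (c i * r i + d i * conj (r i))) *
      (e' + ∑ i, (c' i * r i + d' i * conj (r i))) ∂(Measure.pi fun _ => entryLaw τ) =
      e * e' + ∑ i, (τ * c i * c' i + c i * d' i + d i * c' i + τ * d i * d' i) := by
  have hP := isProbabilityMeasure_entryLaw hτ
  obtain ⟨m1, m2, m3⟩ := entryLaw_moments hτ
  set μ : Measure (Fin N → ℂ) := Measure.pi fun _ => entryLaw τ with hμ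
  have mp : ∀ i, MeasurePreserving (Function.eval i) μ (entryLaw τ) :=
    fun i => measurePreserving_eval _ i
  have l2 : ∀ i, MemLp (fun r : Fin N → ℂ => r i) 2 μ :=
    fun i => (memLp_entryLaw hτ).comp_measurePreserving (mp i)
  have l2' : ∀ i, MemLp (fun r : Fin N → ℂ => conj (r i)) 2 μ := fun i => (l2 i).star
  have int1 : ∀ (i : Fin N) (h : ℂ → ℂ), Continuous h →
      ∫ r, h (r i) ∂μ = ∫ x, h x ∂entryLaw τ := by
    intro i h hh
    rw [← (mp i).map_eq, integral_map (mp i).aemeasurable hh.aestronglyMeasurable]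
  have ind : ∀ (i j : Fin N), i ≠ j → ∀ (g h : ℂ → ℂ), Continuous g → Continuous h →
      ∫ r, g (r i) * h (r j) ∂μ = (∫ x, g x ∂entryLaw τ) * ∫ x, h x ∂entryLaw τ := by
    intro i j hij g h hg hh
    have hI : iIndepFun (fun (k : Fin N) (r : Fin N → ℂ) => r k) μ :=
      iIndepFun_pi (X := fun (_ : Fin N) (x : ℂ) => x) fun _ => aemeasurable_id
    have := (hI.indepFun hij).comp hg.measurable hh.measurable
    have h2 := this.integral_fun_mul_eq_mul_integral (hg.comp (by fun_prop)).aestronglyMeasurable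
      (hh.comp (by fun_prop)).aestronglyMeasurable
    simp only [Function.comp_apply] at h2
    rw [h2, int1 i g hg, int1 j h hh]
  have m1' : ∫ x, conj x ∂entryLaw τ = 0 := by rw [integral_conj, m1, map_zero]
  have m2' : ∫ x, conj x * conj x ∂entryLaw τ = τ := by
    have : ∀ x : ℂ, conj x * conj x = conj (x * x) := fun x => by simp
    simp only [this]
    rw [integral_conj, m2, conj_ofReal]
  have m3' : ∫ x, conj x * x ∂entryLaw τ = 1 := by
    simp only [mul_comm (conj _)]; exact m3
  let ξ : Fin N ⊕ Fin N → (Fin N → ℂ) → ℂ :=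
    Sum.elim (fun i r => r i) (fun i r => conj (r i))
  have hξ2 : ∀ a, MemLp (ξ a) 2 μ := by
    rintro (i | i)
    exacts [l2 i, l2' i]
  have key := integral_affine_mul_affine μ ξ (fun a => (hξ2 a).integrable (by norm_num))
    (fun a b => (hξ2 a).integrable_mul (hξ2 b)) (by
      rintro (i | i)
      · exact (int1 i (fun x => x) continuous_id).trans m1
      · exact (int1 i (fun x => conj x) continuous_conj).trans m1') e e'
    (Sum.elim c d) (Sum.elim c' d')
  simp only [Fintype.sum_sum_type, Sum.elim_inl, Sum.elim_inr, ξ] at key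
  simp only [← Finset.sum_add_distrib] at key
  refine ⟨key.1, key.2.trans ?_⟩
  congr 1
  refine Finset.sum_congr rfl fun i _ => ?_
  have hsingle : ∀ (g h : ℂ → ℂ), Continuous g → Continuous h → ∫ x, g x ∂entryLaw τ = 0 →
      ∀ C : Fin N → ℂ, ∑ j, C j * ∫ r, g (r i) * h (r j) ∂μ =
        C i * ∫ x, g x * h x ∂entryLaw τ := by
    intro g h hg hh h0 C
    rw [Finset.sum_eq_single i]
    · rw [int1 i (fun x => g x * h x) (hg.mul hh)]
    · intro j _ hj
      rw [ind i j (Ne.symm hj) g h hg hh, h0, zero_mul, mul_zero]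
    · simp
  have s1 := hsingle (fun x => x) (fun x => x) continuous_id continuous_id m1 fun j => c i * c' j
  have s2 := hsingle (fun x => x) (fun x => conj x) continuous_id continuous_conj m1
    fun j => c i * d' j
  have s3 := hsingle (fun x => conj x) (fun x => x) continuous_conj continuous_id m1'
    fun j => d i * c' j
  have s4 := hsingle (fun x => conj x) (fun x => conj x) continuous_conj continuous_conj m1'
    fun j => d i * d' j
  rw [m2] at s1; rw [m3] at s2; rw [m3'] at s3; rw [m2'] at s4
  simp only [Finset.sum_add_distrib, s1, s2, s3, s4]
  ring

end Moments

/-! ### Regression on `X v` and the conditioned determinant -/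

section ExpectedDeterminant

open Complex ComplexConjugate Matrix

variable {N : ℕ}

/-- `|v|²` as a real number. -/
def vnorm (v : Fin N → ℂ) : ℝ := ∑ j, normSq (v j)

/-- The bilinear square `vᵀ v`. -/
def vsq (v : Fin N → ℂ) : ℂ := ∑ j, v j * v j

/-- The determinant `|v|⁴ - τ² |vᵀ v|²` of the covariance of `X v`. -/
def vdisc (τ : ℝ) (v : Fin N → ℂ) : ℝ := vnorm v ^ 2 - τ ^ 2 * normSq (vsq v)

theorem vnorm_nonneg (v : Fin N → ℂ) : 0 ≤ vnorm v :=
  Finset.sum_nonneg fun _ _ => normSq_nonneg _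

theorem vnorm_pos {v : Fin N → ℂ} (hv : v ≠ 0) : 0 < vnorm v := by
  obtain ⟨j, hj⟩ := Function.ne_iff.1 hv
  exact Finset.sum_pos' (fun _ _ => normSq_nonneg _) ⟨j, Finset.mem_univ j, normSq_pos.2 hj⟩

theorem sum_mul_conj (v : Fin N → ℂ) : ∑ j, v j * conj (v j) = (vnorm v : ℂ) := by
  simp only [mul_conj, vnorm, ofReal_sum]

theorem sum_conj_mul_conj (v : Fin N → ℂ) : ∑ j, conj (v j) * conj (v j) = conj (vsq v) := by
  simp only [vsq, map_sum, map_mul]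

theorem normSq_vsq_le (v : Fin N → ℂ) : normSq (vsq v) ≤ vnorm v ^ 2 := by
  rw [normSq_eq_norm_sq]
  refine pow_le_pow_left₀ (norm_nonneg _) ?_ 2
  refine (norm_sum_le _ _).trans_eq ?_
  exact Finset.sum_congr rfl fun j _ => by rw [norm_mul, normSq_eq_norm_sq, sq]

theorem vdisc_pos {τ : ℝ} (hτ : |τ| < 1) {v : Fin N → ℂ} (hv : v ≠ 0) : 0 < vdisc τ v := by
  have h1 := normSq_vsq_le v
  have h2 : τ ^ 2 < 1 := (sq_lt_one_iff_abs_lt_one τ).2 hτ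
  have h3 := pow_pos (vnorm_pos hv) 2
  have h4 := normSq_nonneg (vsq v)
  unfold vdisc
  nlinarith

/-- The coefficient of `ξ` in the regression of a row `r` on `ξ = r ⬝ v`. -/
def regCoeff (τ : ℝ) (v : Fin N → ℂ) (k : Fin N) : ℂ :=
  ((vnorm v : ℂ) * conj (v k) - τ ^ 2 * conj (vsq v) * v k) / vdisc τ v

/-- The coefficient of `conj ξ` in the regression of a row `r` on `ξ = r ⬝ v`. -/
def regCoeffConj (τ : ℝ) (v : Fin N → ℂ) (k : Fin N) : ℂ :=
  τ * ((vnorm v : ℂ) * v k - vsq v * conj (v k)) / vdisc τ v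

/-- The regression of a row `r` on `ξ = r ⬝ v`. -/
def regression (τ : ℝ) (v : Fin N → ℂ) (ξ : ℂ) (k : Fin N) : ℂ :=
  regCoeff τ v k * ξ + regCoeffConj τ v k * conj ξ

theorem vdisc_coe (τ : ℝ) (v : Fin N → ℂ) :
    (vdisc τ v : ℂ) = (vnorm v : ℂ) ^ 2 - τ ^ 2 * (vsq v * conj (vsq v)) := by
  rw [vdisc, mul_conj]; push_cast; rfl

/-- Together with `regCoeffConj_mul_add`, these are the normal equations of the regression: the
products of the residual with `conj ξ` and with `ξ` have mean zero. -/
theorem regCoeff_mul_add {τ : ℝ} {v : Fin N → ℂ} (hd : vdisc τ v ≠ 0) (k : Fin N) :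
    regCoeff τ v k * vnorm v + τ * regCoeffConj τ v k * conj (vsq v) = conj (v k) := by
  have hd' : (vdisc τ v : ℂ) ≠ 0 := ofReal_ne_zero.2 hd
  rw [regCoeff, regCoeffConj]
  field_simp
  rw [vdisc_coe]
  ring

theorem regCoeffConj_mul_add {τ : ℝ} {v : Fin N → ℂ} (hd : vdisc τ v ≠ 0) (k : Fin N) :
    regCoeffConj τ v k * vnorm v + τ * regCoeff τ v k * vsq v = τ * v k := by
  have hd' : (vdisc τ v : ℂ) ≠ 0 := ofReal_ne_zero.2 hd
  rw [regCoeff, regCoeffConj]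
  field_simp
  rw [vdisc_coe]
  ring

/-- The covariance of a row conditioned on its product with `v`. -/
def condCov (τ : ℝ) (v : Fin N → ℂ) : Matrix (Fin N) (Fin N) ℂ :=
  Matrix.of fun k l => (1 : Matrix (Fin N) (Fin N) ℂ) k l - regCoeff τ v k * v l -
    τ * regCoeffConj τ v k * conj (v l)

/-- The residual is linear in the entries and their conjugates, so `integral_row_affine` applies;
the normal equations remove all terms quadratic in the regression coefficients. -/
theorem row_covariance {τ : ℝ} (hτ : |τ| < 1) {v : Fin N → ℂ} (hv : v ≠ 0) (e e' : ℂ)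
    (k l : Fin N) :
    Integrable (fun r : Fin N → ℂ => (e - (r k - regression τ v (∑ i, r i * v i) k)) *
      conj (e' - (r l - regression τ v (∑ i, r i * v i) l))) (Measure.pi fun _ => entryLaw τ) ∧
    ∫ r : Fin N → ℂ, (e - (r k - regression τ v (∑ i, r i * v i) k)) *
      conj (e' - (r l - regression τ v (∑ i, r i * v i) l)) ∂(Measure.pi fun _ => entryLaw τ) =
      e * conj e' + condCov τ v k l := by
  have hd := (vdisc_pos hτ hv).ne'
  set one : Matrix (Fin N) (Fin N) ℂ := 1 with hone
  have hsel : ∀ (r : Fin N → ℂ) (k : Fin N), ∑ i, one k i * r i = r k := by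
    intro r k
    simp [hone, Matrix.one_apply]
  have h1 : ∀ (r : Fin N → ℂ) (e : ℂ) (k : Fin N),
      e - (r k - regression τ v (∑ i, r i * v i) k) =
      e + ∑ i, ((regCoeff τ v k * v i - one k i) * r i +
        (regCoeffConj τ v k * conj (v i)) * conj (r i)) := by
    intro r e k
    rw [regression, map_sum, Finset.mul_sum, Finset.mul_sum, ← hsel r k]
    simp only [sub_mul, Finset.sum_add_distrib, Finset.sum_sub_distrib, map_mul]
    simp only [hsel]
    have e1 : ∀ x, regCoeff τ v k * (r x * v x) = regCoeff τ v k * v x * r x := fun x => by ring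
    have e2 : ∀ x, regCoeffConj τ v k * (conj (r x) * conj (v x)) =
      regCoeffConj τ v k * conj (v x) * conj (r x) := fun x => by ring
    simp only [e1, e2]
    ring
  have h2 : ∀ (r : Fin N → ℂ),
      conj (e' - (r l - regression τ v (∑ i, r i * v i) l)) =
      conj e' + ∑ i, ((conj (regCoeffConj τ v l) * v i) * r i +
        (conj (regCoeff τ v l) * conj (v i) - one l i) * conj (r i)) := by
    intro r
    have hone' : ∀ i, conj (one l i) = one l i := by
      intro i
      rw [hone, Matrix.one_apply]
      split_ifs <;> simp
    rw [h1]
    simp only [map_add, map_sum, map_sub, map_mul, conj_conj, hone']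
    congr 1
    exact Finset.sum_congr rfl fun i _ => by ring
  simp only [h1 _ e, h2]
  obtain ⟨a1, a2⟩ := integral_row_affine (N := N) hτ e (conj e')
    (fun i => regCoeff τ v k * v i - one k i) (fun i => regCoeffConj τ v k * conj (v i))
    (fun i => conj (regCoeffConj τ v l) * v i) (fun i => conj (regCoeff τ v l) * conj (v i) - one l i)
  refine ⟨a1, a2.trans ?_⟩
  congr 1
  have hexp : ∀ i, ((τ : ℂ) * (regCoeff τ v k * v i - one k i) * (conj (regCoeffConj τ v l) * v i) +
      (regCoeff τ v k * v i - one k i) * (conj (regCoeff τ v l) * conj (v i) - one l i) +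
      regCoeffConj τ v k * conj (v i) * (conj (regCoeffConj τ v l) * v i) +
      τ * (regCoeffConj τ v k * conj (v i)) * (conj (regCoeff τ v l) * conj (v i) - one l i)) =
      τ * regCoeff τ v k * conj (regCoeffConj τ v l) * (v i * v i) -
      τ * conj (regCoeffConj τ v l) * (one k i * v i) +
      (regCoeff τ v k * conj (regCoeff τ v l) + regCoeffConj τ v k * conj (regCoeffConj τ v l)) *
        (v i * conj (v i)) - regCoeff τ v k * (one l i * v i) -
      conj (regCoeff τ v l) * (one k i * conj (v i)) + one k i * one l i +
      τ * regCoeffConj τ v k * conj (regCoeff τ v l) * (conj (v i) * conj (v i)) -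
      τ * regCoeffConj τ v k * (one l i * conj (v i)) := by
    intro i; ring
  simp only [hexp, Finset.sum_add_distrib, Finset.sum_sub_distrib, ← Finset.mul_sum, hsel,
    sum_mul_conj, sum_conj_mul_conj]
  rw [condCov, Matrix.of_apply]
  have h3 := regCoeff_mul_add hd k
  have h4 := regCoeffConj_mul_add hd k
  have h5 : one l k = one k l := by
    rw [hone, Matrix.one_apply, Matrix.one_apply]
    simp only [eq_comm]
  rw [show ∑ i, v i * v i = vsq v from rfl, h5]
  linear_combination conj (regCoeff τ v l) * h3 + conj (regCoeffConj τ v l) * h4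

/-- The matrix `z - X + v v*`, in which `X` is replaced by its regression residual. -/
def bordered (z : ℂ) (v : Fin N → ℂ) (X : Fin N → Fin N → ℂ) : Matrix (Fin N) (Fin N) ℂ :=
  Matrix.of fun j k => z * (1 : Matrix (Fin N) (Fin N) ℂ) j k - X j k + v j * conj (v k)

/-- Replace `X v` by `ζ` in the regression of `X` on `X v`. -/
def condition (τ : ℝ) (v ζ : Fin N → ℂ) (X : Fin N → Fin N → ℂ) : Fin N → Fin N → ℂ :=
  fun j k => X j k - regression τ v (∑ i, X j i * v i) k + regression τ v (ζ j) k

/-- The mean of `bordered` after conditioning on `X v = z v`. -/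
def condMean (τ : ℝ) (z : ℂ) (v : Fin N → ℂ) : Matrix (Fin N) (Fin N) ℂ :=
  Matrix.of fun j k => z * (1 : Matrix (Fin N) (Fin N) ℂ) j k + v j * conj (v k) -
    regression τ v (z * v j) k

/-- `condition` acts row by row, so the rows stay independent and each term of the double Leibniz
expansion integrates to a product over rows. -/
theorem integral_det_mul_conj_det {τ : ℝ} (hτ : |τ| < 1) {v : Fin N → ℂ} (hv : v ≠ 0) (z : ℂ) :
    Integrable (fun X => (bordered z v (condition τ v (fun j => z * v j) X)).det *
      conj (bordered z v (condition τ v (fun j => z * v j) X)).det) (matrixLaw N τ) ∧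
    ∫ X, (bordered z v (condition τ v (fun j => z * v j) X)).det *
      conj (bordered z v (condition τ v (fun j => z * v j) X)).det ∂matrixLaw N τ =
    mixedDet fun j => Matrix.vecMulVec (condMean τ z v j) (fun l => conj (condMean τ z v j l)) +
      condCov τ v := by
  have hP := isProbabilityMeasure_entryLaw hτ
  have hent : ∀ (X : Fin N → Fin N → ℂ) j k,
      bordered z v (condition τ v (fun j => z * v j) X) j k =
      condMean τ z v j k - (X j k - regression τ v (∑ i, X j i * v i) k) := by
    intro X j k
    simp only [bordered, condition, condMean, Matrix.of_apply]
    ring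
  have hdet : ∀ X : Fin N → Fin N → ℂ,
      (bordered z v (condition τ v (fun j => z * v j) X)).det *
      conj (bordered z v (condition τ v (fun j => z * v j) X)).det =
      ∑ σ : Equiv.Perm (Fin N), ∑ π : Equiv.Perm (Fin N),
        ((Equiv.Perm.sign σ : ℤ) : ℂ) * ((Equiv.Perm.sign π : ℤ) : ℂ) *
        ∏ j, (condMean τ z v j (σ j) - (X j (σ j) - regression τ v (∑ i, X j i * v i) (σ j))) *
          conj (condMean τ z v j (π j) -
            (X j (π j) - regression τ v (∑ i, X j i * v i) (π j))) := by
    intro X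
    rw [← Matrix.det_transpose, Matrix.det_apply', map_sum, Finset.sum_mul_sum]
    refine Finset.sum_congr rfl fun σ _ => Finset.sum_congr rfl fun π _ => ?_
    rw [Finset.prod_mul_distrib, map_mul, map_prod, map_intCast]
    simp only [Matrix.transpose_apply, hent]
    ring
  have hi : ∀ σ π : Equiv.Perm (Fin N), Integrable (fun X : Fin N → Fin N → ℂ =>
      ((Equiv.Perm.sign σ : ℤ) : ℂ) * ((Equiv.Perm.sign π : ℤ) : ℂ) *
        ∏ j, (condMean τ z v j (σ j) - (X j (σ j) - regression τ v (∑ i, X j i * v i) (σ j))) *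
          conj (condMean τ z v j (π j) -
            (X j (π j) - regression τ v (∑ i, X j i * v i) (π j)))) (matrixLaw N τ) := by
    intro σ π
    refine Integrable.const_mul ?_ _
    exact Integrable.fintype_prod (μ := fun _ : Fin N => Measure.pi fun _ : Fin N => entryLaw τ)
      (f := fun j (r : Fin N → ℂ) =>
        (condMean τ z v j (σ j) - (r (σ j) - regression τ v (∑ i, r i * v i) (σ j))) *
          conj (condMean τ z v j (π j) - (r (π j) - regression τ v (∑ i, r i * v i) (π j))))
      fun j => (row_covariance hτ hv _ _ _ _).1
  simp only [hdet]
  refine ⟨integrable_finsetSum _ fun σ _ => integrable_finsetSum _ fun π _ => hi σ π, ?_⟩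
  rw [integral_finsetSum _ fun σ _ => integrable_finsetSum _ fun π _ => hi σ π, mixedDet]
  refine Finset.sum_congr rfl fun σ _ => ?_
  rw [integral_finsetSum _ fun π _ => hi σ π]
  refine Finset.sum_congr rfl fun π _ => ?_
  rw [integral_const_mul]
  congr 1
  have := integral_fintype_prod_eq_prod
    (μ := fun _ : Fin N => Measure.pi fun _ : Fin N => entryLaw τ)
    (f := fun j (r : Fin N → ℂ) =>
        (condMean τ z v j (σ j) - (r (σ j) - regression τ v (∑ i, r i * v i) (σ j))) *
          conj (condMean τ z v j (π j) - (r (π j) - regression τ v (∑ i, r i * v i) (π j))))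
  rw [matrixLaw, this]
  refine Finset.prod_congr rfl fun j _ => ?_
  rw [(row_covariance hτ hv _ _ _ _).2, Matrix.add_apply, Matrix.vecMulVec_apply]

end ExpectedDeterminant

/-! ### Closed form of the conditioned second moment -/

section ClosedForm

open Complex ComplexConjugate Matrix

/-- The truncated exponential series. -/
def truncExp (n : ℕ) (r : ℝ) : ℝ := ∑ j ∈ Finset.range (n + 1), r ^ j / j.factorial

/-- The mean of `|det (z - G)|²` for an `n × n` Ginibre matrix `G`, as a function of `r = |z|²`. -/
def ginibreMoment (n : ℕ) (r : ℝ) : ℝ := n.factorial * truncExp n r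

/-- The binomial term `r ^ m * X ^ (k - m)` contributes `k! * r ^ m / m!`, a term of the truncated
exponential. -/
theorem factorialFunctional_add_X_pow (k : ℕ) (r : ℝ) :
    factorialFunctional ((Polynomial.C (r : ℂ) + Polynomial.X) ^ k) = ginibreMoment k r := by
  rw [add_pow, map_sum, ginibreMoment, truncExp, Finset.mul_sum]
  push_cast
  refine Finset.sum_congr rfl fun m hm => ?_
  have hmk : m ≤ k := Nat.lt_succ_iff.1 (Finset.mem_range.1 hm)
  have : Polynomial.C (r : ℂ) ^ m * Polynomial.X ^ (k - m) * ((k.choose m : ℕ) : Polynomial ℂ) =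
      Polynomial.C ((r : ℂ) ^ m * (k.choose m : ℂ)) * Polynomial.X ^ (k - m) := by
    rw [Polynomial.C_mul, Polynomial.C_pow]
    rw [show (Polynomial.C ((k.choose m : ℕ) : ℂ)) = ((k.choose m : ℕ) : Polynomial ℂ) from
      map_natCast _ _]
    ring
  rw [this, factorialFunctional_C_mul_X_pow, Nat.cast_choose ℂ hmk]
  have h1 : ((m.factorial : ℕ) : ℂ) ≠ 0 := Nat.cast_ne_zero.2 m.factorial_ne_zero
  have h2 : (((k - m).factorial : ℕ) : ℂ) ≠ 0 := Nat.cast_ne_zero.2 (k - m).factorial_ne_zero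
  field_simp

theorem factorialFunctional_add_X_pow_mul (k : ℕ) (r : ℝ) (a b : ℂ) :
    factorialFunctional ((Polynomial.C (r : ℂ) + Polynomial.X) ^ k *
      (Polynomial.C a + Polynomial.C b * Polynomial.X)) =
      a * ginibreMoment k r + b * (ginibreMoment (k + 1) r - r * ginibreMoment k r) := by
  have : (Polynomial.C (r : ℂ) + Polynomial.X) ^ k *
      (Polynomial.C a + Polynomial.C b * Polynomial.X) =
      a • (Polynomial.C (r : ℂ) + Polynomial.X) ^ k +
      b • ((Polynomial.C (r : ℂ) + Polynomial.X) ^ (k + 1) -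
        (r : ℂ) • (Polynomial.C (r : ℂ) + Polynomial.X) ^ k) := by
    simp only [Polynomial.smul_eq_C_mul]
    ring
  rw [this]
  simp only [map_add, map_sub, map_smul, factorialFunctional_add_X_pow, smul_eq_mul]

variable {N : ℕ}

/-- The coefficient `m` such that the reduced matrix has mean `m z̄` in one diagonal entry. -/
def reducedMean (τ : ℝ) (v : Fin N → ℂ) : ℝ :=
  τ * (vnorm v ^ 2 - normSq (vsq v)) / vdisc τ v

/-- The variance of the entries of one column of the reduced matrix. -/
def reducedVar (τ : ℝ) (v : Fin N → ℂ) : ℝ := (1 - τ ^ 2) * vnorm v ^ 2 / vdisc τ v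

/-- The conditional mean of the squared Jacobian of the eigenvector parametrisation. -/
def reducedMoment (N : ℕ) (z : ℂ) (m σ : ℝ) : ℝ :=
  normSq (z - m * conj z) * ginibreMoment (N - 2) (normSq z) +
    σ * (ginibreMoment (N - 1) (normSq z) - normSq z * ginibreMoment (N - 2) (normSq z))

/-- Ensures `z - m * conj z ≠ 0` for `z ≠ 0`, hence invertibility of the conditional mean. -/
theorem abs_reducedMean_lt {τ : ℝ} (hτ : |τ| < 1) {v : Fin N → ℂ} (hv : v ≠ 0) :
    |reducedMean τ v| < 1 := by
  have hd := vdisc_pos hτ hv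
  have h1 := normSq_vsq_le v
  have h4 := normSq_nonneg (vsq v)
  have h5 := pow_pos (vnorm_pos hv) 2
  have h2 : τ ^ 2 < 1 := (sq_lt_one_iff_abs_lt_one τ).2 hτ
  rw [reducedMean, abs_div, abs_of_pos hd, div_lt_one hd, abs_mul,
    abs_of_nonneg (sub_nonneg.2 h1), vdisc]
  have h0 := abs_nonneg τ
  rw [← sq_abs τ] at h2 ⊢
  nlinarith [mul_nonneg (mul_nonneg h0 (sub_nonneg.2 hτ.le)) h4]

/-- The mixed discriminant is `factorialFunctional` of a polynomial determinant. That polynomial is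
identified through its values at all `t ≠ -|z|²`, where the rank two reduction is available. -/
theorem lintegral_normSq_det {τ : ℝ} (hτ : |τ| < 1) {v : Fin N → ℂ} (hv : v ≠ 0) {z : ℂ}
    (hz : z ≠ 0) (hN : 2 ≤ N) :
    ∫⁻ X, ENNReal.ofReal (normSq (bordered z v (condition τ v (fun j => z * v j) X)).det)
      ∂matrixLaw N τ =
    ENNReal.ofReal (vnorm v ^ 2 * reducedMoment N z (reducedMean τ v) (reducedVar τ v)) := by
  have hd := vdisc_pos hτ hv
  have hp := vnorm_pos hv
  have hdC : (vdisc τ v : ℂ) ≠ 0 := ofReal_ne_zero.2 hd.ne'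
  have hcard : 2 ≤ Fintype.card (Fin N) := by simpa using hN
  obtain ⟨hint, hval⟩ := integral_det_mul_conj_det hτ hv z
  set A := condMean τ z v with hA
  set A' : Matrix (Fin N) (Fin N) ℂ := A.map conj with hA'
  have hAe : ∀ j k, A j k = z * (1 : Matrix (Fin N) (Fin N) ℂ) j k + v j * conj (v k) -
      z * v j * (((vnorm v : ℂ) * conj (v k) - τ ^ 2 * conj (vsq v) * v k) / vdisc τ v) -
      conj z * conj (v j) * (τ * ((vnorm v : ℂ) * v k - vsq v * conj (v k)) / vdisc τ v) := by
    intro j k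
    rw [hA, condMean, Matrix.of_apply, regression, regCoeff, regCoeffConj, map_mul]
    ring
  have hAe' : ∀ j k, A' j k = conj z * (1 : Matrix (Fin N) (Fin N) ℂ) j k + conj (v j) * v k -
      conj z * conj (v j) * (((vnorm v : ℂ) * v k - τ ^ 2 * vsq v * conj (v k)) / vdisc τ v) -
      z * v j * (τ * ((vnorm v : ℂ) * conj (v k) - conj (vsq v) * v k) / vdisc τ v) := by
    intro j k
    have : conj ((1 : Matrix (Fin N) (Fin N) ℂ) j k) = (1 : Matrix (Fin N) (Fin N) ℂ) j k := by
      rw [Matrix.one_apply]; split_ifs <;> simp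
    rw [hA', Matrix.map_apply, hAe]
    simp only [map_add, map_sub, map_mul, map_div₀, map_pow, conj_conj, conj_ofReal, this]
  have hdet : A.det ≠ 0 := by
    rw [det_conditional_mean v (fun j => conj (v j)) (vnorm v) (vsq v) (conj (vsq v)) τ z (conj z)
      (vdisc τ v) (sum_mul_conj v) rfl (sum_conj_mul_conj v) (vdisc_coe τ v) hdC hz hcard A hAe]
    refine mul_ne_zero (pow_ne_zero _ hz) (mul_ne_zero (ofReal_ne_zero.2 hp.ne') ?_)
    have : (τ : ℂ) * ((vnorm v : ℂ) ^ 2 - vsq v * conj (vsq v)) / vdisc τ v =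
        (reducedMean τ v : ℂ) := by
      rw [reducedMean, mul_conj]; push_cast; rfl
    rw [this, sub_ne_zero]
    intro h
    have h' := congrArg norm h
    rw [norm_mul, norm_conj, norm_real, Real.norm_eq_abs] at h'
    have h3 := abs_reducedMean_lt hτ hv
    have h4 := norm_pos_iff.2 hz
    nlinarith
  have hdet' : A'.det ≠ 0 := by
    have : A'.det = conj A.det := by
      rw [hA', RingHom.map_det]; rfl
    rw [this]
    simpa using hdet
  have hmix := mixedDet_vecMulVec_add A A' (condCov τ v) hdet hdet'
  have hpoly : ((Aᵀ * A').map Polynomial.C + (Polynomial.X : Polynomial ℂ) •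
      (condCov τ v).map Polynomial.C).det =
      (Polynomial.C ((normSq z : ℝ) : ℂ) + Polynomial.X) ^ (N - 2) *
      (Polynomial.C ((vnorm v ^ 2 * normSq (z - reducedMean τ v * conj z) : ℝ) : ℂ) +
        Polynomial.C ((vnorm v ^ 2 * reducedVar τ v : ℝ) : ℂ) * Polynomial.X) := by
    refine Polynomial.eq_of_infinite_eval_eq _ _ ?_
    refine Set.Infinite.mono (s := {t : ℂ | t ≠ - (z * conj z)}) ?_ ?_
    · intro t ht
      have hc : z * conj z + t ≠ 0 := by
        intro h
        exact ht (by linear_combination h)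
      have := det_conditional_covariance v (fun j => conj (v j)) (vnorm v) (vsq v) (conj (vsq v))
        τ z (conj z) t (vdisc τ v) (sum_mul_conj v) rfl (sum_conj_mul_conj v) (vdisc_coe τ v) hdC
        hc hcard A A' (condCov τ v) hAe hAe' (fun k l => by
          rw [condCov, Matrix.of_apply, regCoeff, regCoeffConj])
      have he : Polynomial.eval t ((Aᵀ * A').map Polynomial.C + (Polynomial.X : Polynomial ℂ) •
          (condCov τ v).map Polynomial.C).det = (Aᵀ * A' + t • condCov τ v).det := by
        rw [← Polynomial.coe_evalRingHom, RingHom.map_det]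
        congr 1
        ext j k
        simp only [RingHom.mapMatrix_apply, Matrix.map_apply, Matrix.add_apply, Matrix.smul_apply,
          smul_eq_mul, Polynomial.coe_evalRingHom, Polynomial.eval_add, Polynomial.eval_mul,
          Polynomial.eval_C, Polynomial.eval_X]
      rw [Set.mem_ofPred_eq, he, this, Fintype.card_fin]
      simp only [Polynomial.eval_mul, Polynomial.eval_pow, Polynomial.eval_add, Polynomial.eval_C,
        Polynomial.eval_X]
      rw [← mul_conj z]
      congr 1
      push_cast
      rw [← mul_conj (z - reducedMean τ v * conj z), reducedMean, reducedVar]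
      simp only [map_sub, map_mul, conj_ofReal, conj_conj]
      push_cast
      rw [← mul_conj (vsq v)]
      ring
    · exact (Set.finite_singleton _).infinite_compl
  rw [hpoly, factorialFunctional_add_X_pow_mul] at hmix
  have hreal : ∀ X : Fin N → Fin N → ℂ,
      (bordered z v (condition τ v (fun j => z * v j) X)).det *
      conj (bordered z v (condition τ v (fun j => z * v j) X)).det =
      ((normSq (bordered z v (condition τ v (fun j => z * v j) X)).det : ℝ) : ℂ) :=
    fun X => mul_conj _
  simp only [hreal] at hint hval
  have hint' : Integrable (fun X : Fin N → Fin N → ℂ =>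
      normSq (bordered z v (condition τ v (fun j => z * v j) X)).det) (matrixLaw N τ) := by
    have := hint.re
    simpa using this
  rw [← ofReal_integral_eq_lintegral_ofReal hint' (ae_of_all _ fun _ => normSq_nonneg _)]
  congr 1
  have hmix' : mixedDet (fun j => Matrix.vecMulVec (A j) (fun l => conj (A j l)) + condCov τ v) =
    mixedDet (fun j => Matrix.vecMulVec (A j) (A' j) + condCov τ v) := rfl
  rw [hmix', hmix, integral_complex_ofReal] at hval
  have hN1 : N - 2 + 1 = N - 1 := by omega
  rw [hN1] at hval
  have : ((vnorm v ^ 2 * reducedMoment N z (reducedMean τ v) (reducedVar τ v) : ℝ) : ℂ) =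
      ((vnorm v ^ 2 * normSq (z - reducedMean τ v * conj z) : ℝ) : ℂ) *
        (ginibreMoment (N - 2) (normSq z) : ℂ) + ((vnorm v ^ 2 * reducedVar τ v : ℝ) : ℂ) *
        ((ginibreMoment (N - 1) (normSq z) : ℂ) -
          ((normSq z : ℝ) : ℂ) * (ginibreMoment (N - 2) (normSq z) : ℂ)) := by
    rw [reducedMoment]
    push_cast
    ring
  rw [← this] at hval
  exact ofReal_injective hval

end ClosedForm

/-! ### Adapted coordinates and the Gaussian quadratic form -/

section Conditioning

open Complex ComplexConjugate Matrix

theorem lintegral_matrix_eq_lintegral_cons {m n : ℕ} (h : (Fin n → Fin (m + 1) → ℂ) → ENNReal)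
    (hh : Measurable h) :
    ∫⁻ X, h X = ∫⁻ Y : Fin n → Fin m → ℂ, ∫⁻ x : Fin n → ℂ,
      h fun j => Fin.cons (x j) (Y j) := by
  have e1 := volume_measurePreserving_arrowProdEquivProdArrow ℂ (Fin m → ℂ) (Fin n)
  have e2 : MeasurePreserving (MeasurableEquiv.piCongrRight fun _ : Fin n =>
      (MeasurableEquiv.piFinSuccAbove (fun _ : Fin (m + 1) => ℂ) 0).symm)
      (volume : Measure (Fin n → ℂ × (Fin m → ℂ))) volume :=
    volume_preserving_pi fun _ => (volume_preserving_piFinSuccAbove (fun _ : Fin (m + 1) => ℂ) 0).symm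
  rw [e2.lintegral_map_equiv h _, e1.symm.lintegral_map_equiv _ _]
  have hc : ∀ a : (Fin n → ℂ) × (Fin n → Fin m → ℂ),
      (MeasurableEquiv.piCongrRight fun _ : Fin n =>
        (MeasurableEquiv.piFinSuccAbove (fun _ : Fin (m + 1) => ℂ) 0).symm)
        ((MeasurableEquiv.arrowProdEquivProdArrow ℂ (Fin m → ℂ) (Fin n)).symm a) =
      fun j => Fin.cons (a.1 j) (a.2 j) := by
    intro a
    funext j
    exact Fin.insertNth_zero' (a.1 j) (a.2 j)
  simp only [hc]
  have hm : Measurable fun a : (Fin n → ℂ) × (Fin n → Fin m → ℂ) =>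
      h fun j => Fin.cons (a.1 j) (a.2 j) := by
    refine hh.comp (measurable_pi_lambda _ fun j => measurable_pi_lambda _ fun k => ?_)
    refine Fin.cases ?_ (fun k => ?_) k
    · simp only [Fin.cons_zero]; fun_prop
    · simp only [Fin.cons_succ]; fun_prop
  exact lintegral_prod_symm _ hm.aemeasurable

/-- The matrix `X` with last columns `Y` and with `X (1, w) = ξ`. -/
def chartMatrix {m n : ℕ} (w : Fin m → ℂ) (ξ : Fin n → ℂ) (Y : Fin n → Fin m → ℂ) :
    Fin n → Fin (m + 1) → ℂ :=
  fun j => Fin.cons (ξ j - ∑ k, Y j k * w k) (Y j)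

theorem continuous_chartMatrix {m n : ℕ} :
    Continuous fun a : (Fin m → ℂ) × (Fin n → ℂ) × (Fin n → Fin m → ℂ) =>
      chartMatrix a.1 a.2.1 a.2.2 := by
  refine continuous_pi fun j => continuous_pi fun k => ?_
  unfold chartMatrix
  refine Fin.cases ?_ (fun k => ?_) k
  · simp only [Fin.cons_zero]; fun_prop
  · simp only [Fin.cons_succ]; fun_prop

theorem sum_chartMatrix_mul {m n : ℕ} (w : Fin m → ℂ) (ξ : Fin n → ℂ) (Y : Fin n → Fin m → ℂ)
    (j : Fin n) :
    ∑ i, chartMatrix w ξ Y j i * (Fin.cons 1 w : Fin (m + 1) → ℂ) i = ξ j := by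
  rw [Fin.sum_univ_succ]
  simp [chartMatrix]

/-- For fixed `w` and `Y`, passing from the first column to `ξ = X (1, w)` is a translation, so no
Jacobian factor appears. -/
theorem lintegral_matrix_eq_lintegral_chartMatrix {m n : ℕ} (w : Fin m → ℂ)
    (h : (Fin n → Fin (m + 1) → ℂ) → ENNReal) (hh : Measurable h) :
    ∫⁻ X, h X = ∫⁻ ξ : Fin n → ℂ, ∫⁻ Y : Fin n → Fin m → ℂ, h (chartMatrix w ξ Y) := by
  rw [lintegral_matrix_eq_lintegral_cons h hh,
    lintegral_lintegral_swap (f := fun ξ Y => h (chartMatrix w ξ Y))]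
  · refine lintegral_congr fun Y => ?_
    exact (lintegral_sub_right_eq_self (fun x : Fin n → ℂ => h fun j => Fin.cons (x j) (Y j))
      fun j => ∑ k, Y j k * w k).symm
  · refine (hh.comp ?_).aemeasurable
    exact (continuous_chartMatrix.comp
      (by fun_prop : Continuous fun a : (Fin n → ℂ) × (Fin n → Fin m → ℂ) =>
        (w, a.1, a.2))).measurable

variable {N : ℕ}

/-- The quadratic form in the density of an entry of `X v`. -/
def imageForm (τ : ℝ) (v : Fin N → ℂ) (ξ : ℂ) : ℝ :=
  (vnorm v * normSq ξ - τ * (conj (vsq v) * ξ ^ 2).re) / vdisc τ v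

/-- The quadratic form in the density of an entry of `X`. -/
def entryForm (τ : ℝ) (c : ℂ) : ℝ := c.re ^ 2 / (1 + τ) + c.im ^ 2 / (1 - τ)

theorem entryForm_coe {τ : ℝ} (hτ : |τ| < 1) (c : ℂ) :
    (entryForm τ c : ℂ) = (2 * (c * conj c) - τ * (c * c) - τ * (conj c * conj c)) /
      (2 * (1 - τ ^ 2)) := by
  have h1 : 0 < 1 + τ := by linarith [(abs_lt.1 hτ).1]
  have h2 : 0 < 1 - τ := by linarith [(abs_lt.1 hτ).2]
  have h3 : (1 + τ : ℂ) ≠ 0 := by exact_mod_cast h1.ne'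
  have h4 : (1 - τ : ℂ) ≠ 0 := by exact_mod_cast h2.ne'
  have h5 : (2 * (1 - (τ : ℂ) ^ 2)) = 2 * ((1 + τ) * (1 - τ)) := by ring
  rw [entryForm, h5]
  push_cast
  have hre : (c.re : ℂ) = (c + conj c) / 2 := by rw [add_conj]; push_cast; ring
  have him : (c.im : ℂ) ^ 2 = - ((c - conj c) / 2) ^ 2 := by
    rw [sub_conj]
    push_cast
    linear_combination (c.im : ℂ) ^ 2 * I_sq
  rw [hre, him]
  field_simp
  ring

theorem imageForm_coe (τ : ℝ) (v : Fin N → ℂ) (ξ : ℂ) :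
    (imageForm τ v ξ : ℂ) = (2 * vnorm v * (ξ * conj ξ) - τ * conj (vsq v) * ξ ^ 2 -
      τ * vsq v * conj ξ ^ 2) / (2 * vdisc τ v) := by
  rw [imageForm]
  push_cast
  rw [re_eq_add_conj, ← mul_conj]
  simp only [map_mul, map_pow, conj_conj]
  ring

theorem sum_regression_mul {τ : ℝ} {v : Fin N → ℂ} (hd : vdisc τ v ≠ 0) (ξ : ℂ) :
    ∑ k, regression τ v ξ k * v k = ξ := by
  have hd' : (vdisc τ v : ℂ) ≠ 0 := ofReal_ne_zero.2 hd
  have h : ∀ k, regression τ v ξ k * v k =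
      ξ / vdisc τ v * ((vnorm v : ℂ) * (v k * conj (v k)) - τ ^ 2 * conj (vsq v) * (v k * v k)) +
      conj ξ / vdisc τ v * τ * ((vnorm v : ℂ) * (v k * v k) - vsq v * (v k * conj (v k))) := by
    intro k
    rw [regression, regCoeff, regCoeffConj]
    ring
  simp only [h, Finset.sum_add_distrib, Finset.sum_sub_distrib, ← Finset.mul_sum, sum_mul_conj]
  rw [show ∑ i, v i * v i = vsq v from rfl]
  field_simp
  rw [vdisc_coe]
  ring

/-- The gradient of the quadratic form at the regression is a multiple of `v`, while residuals have
product zero with `v`; this kills the cross terms in `sum_entryForm`. -/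
theorem conj_regression_sub {τ : ℝ} (v : Fin N → ℂ) (ξ : ℂ) (k : Fin N) :
    conj (regression τ v ξ k) - τ * regression τ v ξ k =
      (1 - τ ^ 2) * ((vnorm v : ℂ) * conj ξ - τ * conj (vsq v) * ξ) / vdisc τ v * v k := by
  rw [regression, regCoeff, regCoeffConj]
  simp only [map_add, map_mul, map_sub, map_div₀, map_pow, conj_conj, conj_ofReal]
  ring

/-- Pythagoras for the form in the Gaussian density: residual and regression are orthogonal, and
`imageForm` is the value of the form on the regression. -/
theorem sum_entryForm {τ : ℝ} (hτ : |τ| < 1) {v : Fin N → ℂ} (hv : v ≠ 0) (r : Fin N → ℂ) :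
    ∑ k, entryForm τ (r k) = ∑ k, entryForm τ (r k - regression τ v (∑ i, r i * v i) k) +
      imageForm τ v (∑ i, r i * v i) := by
  have hd := (vdisc_pos hτ hv).ne'
  have hd' : (vdisc τ v : ℂ) ≠ 0 := ofReal_ne_zero.2 hd
  have h2 : τ ^ 2 < 1 := (sq_lt_one_iff_abs_lt_one τ).2 hτ
  have h3 : (1 - (τ : ℂ) ^ 2) ≠ 0 := by
    have : (1 - τ ^ 2 : ℝ) ≠ 0 := by linarith
    exact_mod_cast this
  set ξ := ∑ i, r i * v i with hξ
  set L := regression τ v ξ with hL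
  set C := (1 - (τ : ℂ) ^ 2) * ((vnorm v : ℂ) * conj ξ - τ * conj (vsq v) * ξ) / vdisc τ v with hC
  have hLC : ∀ k, conj (L k) - τ * L k = C * v k := fun k => conj_regression_sub v ξ k
  have hLC' : ∀ k, L k - τ * conj (L k) = conj C * conj (v k) := by
    intro k
    have := congrArg conj (hLC k)
    simpa only [map_sub, map_mul, conj_conj, conj_ofReal] using this
  have hLv : ∑ k, L k * v k = ξ := sum_regression_mul hd ξ
  have hconj : ∀ f : Fin N → ℂ, ∑ k, conj (f k) * conj (v k) = conj (∑ k, f k * v k) := by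
    intro f; simp only [map_sum, map_mul]
  apply ofReal_injective
  push_cast
  simp only [entryForm_coe hτ, imageForm_coe, ← Finset.sum_div]
  have hterm : ∀ k, (2 * (r k * conj (r k)) - τ * (r k * r k) - τ * (conj (r k) * conj (r k))) =
      (2 * ((r k - L k) * conj (r k - L k)) - τ * ((r k - L k) * (r k - L k)) -
        τ * (conj (r k - L k) * conj (r k - L k))) +
      (2 * C * (r k * v k) + 2 * conj C * (conj (r k) * conj (v k)) - C * (L k * v k) -
        conj C * (conj (L k) * conj (v k))) := by
    intro k
    rw [map_sub]
    linear_combination (2 * r k - L k) * hLC k + (2 * conj (r k) - conj (L k)) * hLC' k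
  simp only [hterm]
  simp only [Finset.sum_add_distrib, Finset.sum_sub_distrib, ← Finset.mul_sum, hconj, hLv, ← hξ]
  simp only [hC, map_mul, map_sub, map_div₀, map_pow, map_one, conj_conj, conj_ofReal]
  field_simp
  ring

theorem matrixDensity_eq_exp (τ : ℝ) (X : Fin N → Fin N → ℂ) :
    matrixDensity τ X = (∏ _i : Fin N, ∏ _j : Fin N, 1 / (Real.pi * Real.sqrt (1 - τ ^ 2))) *
      Real.exp (-∑ i, ∑ j, entryForm τ (X i j)) := by
  simp only [matrixDensity, entryDensity, Finset.prod_mul_distrib, ← Real.exp_sum, entryForm,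
    Finset.sum_neg_distrib]

end Conditioning

/-! ### Conditioning on `X v` -/

section ConditioningIntegral

open Complex ComplexConjugate Matrix

theorem sum_condition_mul {N : ℕ} {τ : ℝ} {v : Fin N → ℂ} (hd : vdisc τ v ≠ 0) (ζ : Fin N → ℂ)
    (X : Fin N → Fin N → ℂ) (j : Fin N) :
    ∑ i, condition τ v ζ X j i * v i = ζ j := by
  simp only [condition, add_mul, sub_mul, Finset.sum_add_distrib, Finset.sum_sub_distrib,
    sum_regression_mul hd]
  ring

theorem continuous_condition {N : ℕ} (τ : ℝ) (v ζ : Fin N → ℂ) :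
    Continuous (condition τ v ζ) := by
  unfold condition regression
  fun_prop

theorem sum_entryForm_condition {N : ℕ} {τ : ℝ} (hτ : |τ| < 1) {v : Fin N → ℂ} (hv : v ≠ 0)
    (ζ : Fin N → ℂ) (X : Fin N → Fin N → ℂ) :
    ∑ i, ∑ j, entryForm τ (X i j) = ∑ i, ∑ j, entryForm τ (condition τ v ζ X i j) +
      (∑ j, imageForm τ v (∑ i, X j i * v i) - ∑ j, imageForm τ v (ζ j)) := by
  have hd := (vdisc_pos hτ hv).ne'
  rw [← Finset.sum_sub_distrib, ← Finset.sum_add_distrib]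
  refine Finset.sum_congr rfl fun i _ => ?_
  rw [sum_entryForm hτ hv (X i), sum_entryForm hτ hv (condition τ v ζ X i),
    sum_condition_mul hd]
  have : ∀ k, condition τ v ζ X i k - regression τ v (ζ i) k =
      X i k - regression τ v (∑ l, X i l * v l) k := by
    intro k; rw [condition]; ring
  simp only [this]
  ring

/-- The law of `X` conditioned on the value of `X v`, in the eigenvector chart. -/
theorem lintegral_condition {m : ℕ} {τ : ℝ} (hτ : |τ| < 1) (w : Fin m → ℂ)
    (ζ : Fin (m + 1) → ℂ) (h : (Fin (m + 1) → Fin (m + 1) → ℂ) → ENNReal) (hh : Measurable h) :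
    ∫⁻ X, h (condition τ (Fin.cons 1 w) ζ X) ∂matrixLaw (m + 1) τ =
      ENNReal.ofReal (Real.exp (∑ j, imageForm τ (Fin.cons 1 w : Fin (m + 1) → ℂ) (ζ j))) *
      (∫⁻ ξ : Fin (m + 1) → ℂ, ENNReal.ofReal
        (Real.exp (-∑ j, imageForm τ (Fin.cons 1 w : Fin (m + 1) → ℂ) (ξ j)))) *
      ∫⁻ Y, ENNReal.ofReal (matrixDensity τ (chartMatrix w ζ Y)) * h (chartMatrix w ζ Y) := by
  set v : Fin (m + 1) → ℂ := Fin.cons 1 w with hv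
  have hv0 : v ≠ 0 := fun h0 => by simpa [hv] using congrFun h0 0
  have hd := (vdisc_pos hτ hv0).ne'
  have hcm : Measurable (condition τ v ζ) := (continuous_condition τ v ζ).measurable
  have hchart : ∀ ξ : Fin (m + 1) → ℂ, Continuous fun Y => chartMatrix w ξ Y := fun ξ =>
    continuous_chartMatrix.comp (by fun_prop : Continuous fun Y : Fin (m + 1) → Fin m → ℂ =>
      (w, ξ, Y))
  have hMD := (continuous_matrixDensity (N := m + 1) τ).measurable.ennreal_ofReal
  have hhc : Measurable fun X => h (condition τ v ζ X) := hh.comp hcm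
  have hm1 : Measurable fun X : Fin (m + 1) → Fin (m + 1) → ℂ =>
      ENNReal.ofReal (matrixDensity τ X) * h (condition τ v ζ X) := hMD.mul hhc
  have hm2 : Measurable fun Y => ENNReal.ofReal (matrixDensity τ (chartMatrix w ζ Y)) *
      h (chartMatrix w ζ Y) := (hMD.mul hh).comp (hchart ζ).measurable
  rw [lintegral_matrixLaw (m + 1) hτ hhc, lintegral_matrix_eq_lintegral_chartMatrix w _ hm1]
  have hinner : ∀ ξ : Fin (m + 1) → ℂ,
      ∫⁻ Y, ENNReal.ofReal (matrixDensity τ (chartMatrix w ξ Y)) *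
        h (condition τ v ζ (chartMatrix w ξ Y)) =
      ENNReal.ofReal (Real.exp (∑ j, imageForm τ v (ζ j))) *
        ENNReal.ofReal (Real.exp (-∑ j, imageForm τ v (ξ j))) *
      ∫⁻ Y, ENNReal.ofReal (matrixDensity τ (chartMatrix w ζ Y)) * h (chartMatrix w ζ Y) := by
    intro ξ
    -- Translating `Y` by the difference of the two regressions gives the matrices with images `ξ`
    -- and `ζ` the same residual, so `condition` carries the first to the second.
    rw [← lintegral_add_right_eq_self _ (fun j k =>
      regression τ v (ξ j) k.succ - regression τ v (ζ j) k.succ),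
      ← lintegral_const_mul _ hm2]
    refine lintegral_congr fun Y => ?_
    set Y' : Fin (m + 1) → Fin m → ℂ := Y + fun j k =>
      regression τ v (ξ j) k.succ - regression τ v (ζ j) k.succ with hY'
    have hcond : condition τ v ζ (chartMatrix w ξ Y') = chartMatrix w ζ Y := by
      have hsucc : ∀ j (k : Fin m),
          condition τ v ζ (chartMatrix w ξ Y') j k.succ = chartMatrix w ζ Y j k.succ := by
        intro j k
        rw [condition, hv, sum_chartMatrix_mul, ← hv]
        simp only [chartMatrix, Fin.cons_succ, hY', Pi.add_apply]
        ring
      funext j k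
      refine Fin.cases ?_ (fun k => hsucc j k) k
      have e1 := sum_condition_mul hd ζ (chartMatrix w ξ Y') j
      have e2 := sum_chartMatrix_mul w ζ Y j
      rw [← hv] at e2
      rw [Fin.sum_univ_succ] at e1 e2
      simp only [hsucc] at e1
      have hv1 : v 0 = 1 := by simp [hv]
      rw [hv1, mul_one] at e1 e2
      exact add_right_cancel (e1.trans e2.symm)
    rw [hcond, ← mul_assoc]
    congr 1
    rw [← ENNReal.ofReal_mul (Real.exp_nonneg _), ← Real.exp_add,
      ← ENNReal.ofReal_mul (Real.exp_nonneg _), matrixDensity_eq_exp, matrixDensity_eq_exp,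
      sum_entryForm_condition hτ hv0 ζ (chartMatrix w ξ Y'), hcond, mul_left_comm, ← Real.exp_add]
    congr 3
    have e3 := fun j => sum_chartMatrix_mul w ξ Y' j
    rw [← hv] at e3
    simp only [e3]
    ring
  simp only [hinner]
  have hcont : Continuous fun ξ : Fin (m + 1) → ℂ =>
      Real.exp (-∑ j, imageForm τ v (ξ j)) := by
    unfold imageForm
    have := Complex.continuous_re
    have := Complex.continuous_normSq
    fun_prop
  rw [lintegral_mul_const _ (by
    exact (measurable_const.mul hcont.measurable.ennreal_ofReal)),
    lintegral_const_mul _ hcont.measurable.ennreal_ofReal]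

theorem lintegral_exp_neg_sq_div {A : ℝ} (hA : 0 < A) :
    ∫⁻ x : ℝ, ENNReal.ofReal (Real.exp (-(x ^ 2 / A))) = ENNReal.ofReal (Real.sqrt (Real.pi * A)) := by
  have h1 : (fun x : ℝ => Real.exp (-(x ^ 2 / A))) = fun x => Real.exp (-(1 / A) * x ^ 2) := by
    ext x; congr 1; ring
  have h2 := integrable_exp_neg_mul_sq (b := 1 / A) (by positivity)
  rw [← h1] at h2
  rw [← ofReal_integral_eq_lintegral_ofReal h2 (ae_of_all _ fun _ => Real.exp_nonneg _), h1,
    integral_gaussian]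
  congr 2
  field_simp

theorem lintegral_complex_exp_neg {A B : ℝ} (hA : 0 < A) (hB : 0 < B) :
    ∫⁻ c : ℂ, ENNReal.ofReal (Real.exp (-(c.re ^ 2 / A + c.im ^ 2 / B))) =
      ENNReal.ofReal (Real.pi * Real.sqrt (A * B)) := by
  rw [Complex.volume_preserving_equiv_real_prod.symm.lintegral_map_equiv _
    Complex.measurableEquivRealProd.symm]
  simp only [measurableEquivRealProd_symm_apply, neg_add, Real.exp_add]
  have : ∀ a : ℝ × ℝ, ENNReal.ofReal (Real.exp (-(a.1 ^ 2 / A)) * Real.exp (-(a.2 ^ 2 / B))) =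
      ENNReal.ofReal (Real.exp (-(a.1 ^ 2 / A))) * ENNReal.ofReal (Real.exp (-(a.2 ^ 2 / B))) :=
    fun a => ENNReal.ofReal_mul (Real.exp_nonneg _)
  simp only [this]
  rw [Measure.volume_eq_prod, lintegral_prod_mul
    (f := fun x => ENNReal.ofReal (Real.exp (-(x ^ 2 / A))))
    (g := fun x => ENNReal.ofReal (Real.exp (-(x ^ 2 / B)))) (by fun_prop) (by fun_prop),
    lintegral_exp_neg_sq_div hA, lintegral_exp_neg_sq_div hB,
    ← ENNReal.ofReal_mul (Real.sqrt_nonneg _), ← Real.sqrt_mul (by positivity)]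
  congr 1
  rw [show Real.pi * A * (Real.pi * B) = Real.pi ^ 2 * (A * B) by ring,
    Real.sqrt_mul (by positivity), Real.sqrt_sq Real.pi_pos.le]

theorem lintegral_exp_neg_imageForm {N : ℕ} {τ : ℝ} (hτ : |τ| < 1) {v : Fin N → ℂ} (hv : v ≠ 0) :
    ∫⁻ ξ : ℂ, ENNReal.ofReal (Real.exp (-imageForm τ v ξ)) =
      ENNReal.ofReal (Real.pi * Real.sqrt (vdisc τ v)) := by
  have hd := vdisc_pos hτ hv
  have hp := vnorm_pos hv
  set s := ‖vsq v‖ with hs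
  have hs2 : normSq (vsq v) = s ^ 2 := normSq_eq_norm_sq _
  have hsp : s ≤ vnorm v := by
    have := normSq_vsq_le v
    rw [hs2] at this
    exact le_of_sq_le_sq this hp.le
  have hs0 : 0 ≤ s := norm_nonneg _
  obtain ⟨hτ1, hτ2⟩ := abs_lt.1 hτ
  have hA : 0 < vnorm v + τ * s := by nlinarith
  have hB : 0 < vnorm v - τ * s := by nlinarith
  have hAB : (vnorm v + τ * s) * (vnorm v - τ * s) = vdisc τ v := by
    rw [vdisc, hs2]; ring
  -- Rotation by half the argument of `vᵀ v` diagonalises the form, with denominators `|v|² ± τ |vᵀ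
  -- v|`, whose product is `vdisc τ v`.
  set u : Circle := Circle.exp (arg (vsq v) / 2) with hu
  have hu2 : conj (vsq v) * ((u : ℂ)) ^ 2 = s := by
    have h1 : ((u : ℂ)) ^ 2 = Complex.exp (arg (vsq v) * I) := by
      rw [hu, Circle.coe_exp, ← Complex.exp_nat_mul]
      congr 1; push_cast; ring
    have h2 : vsq v = s * Complex.exp (arg (vsq v) * I) := (norm_mul_exp_arg_mul_I _).symm
    have h3 : ∀ (θ : ℝ) (c : ℂ), c = s * Complex.exp (θ * I) →
        conj c * Complex.exp (θ * I) = s := by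
      rintro θ c rfl
      rw [map_mul, conj_ofReal, ← exp_conj, map_mul, conj_ofReal, conj_I, mul_assoc, ← exp_add]
      simp
    rw [h1]
    exact h3 _ _ h2
  have hrot := (rotation u).measurePreserving
  rw [← hrot.lintegral_comp_emb (rotation u).toHomeomorph.measurableEmbedding]
  rw [← hAB, ← lintegral_complex_exp_neg hA hB]
  refine lintegral_congr fun c => ?_
  congr 3
  rw [rotation_apply, imageForm, mul_pow, ← mul_assoc, hu2, normSq_mul, Circle.normSq_coe, one_mul,
    re_ofReal_mul, ← hAB]
  have : (c ^ 2).re = c.re ^ 2 - c.im ^ 2 := by rw [sq, mul_re]; ring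
  rw [this, normSq_apply]
  field_simp
  ring

end ConditioningIntegral

/-! ### Joint density of an eigenvalue and its eigenvector -/

section ChartDensity

open Complex ComplexConjugate Matrix

variable {m : ℕ}

/-- The Jacobian matrix of the parametrisation of the first column by an eigenvalue `z` and an
eigenvector `(1, w)`. -/
def chartJacobian {R : Type*} [CommRing R] (z : R) (w : Fin m → R) (Y : Fin (m + 1) → Fin m → R) :
    Matrix (Fin (m + 1)) (Fin (m + 1)) R :=
  Matrix.of fun j => Fin.cons ((Fin.cons 1 w : Fin (m + 1) → R) j)
    fun k => z * (1 : Matrix (Fin (m + 1)) (Fin (m + 1)) R) j k.succ - Y j k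

theorem det_updateCol_one {n : Type*} [Fintype n] [DecidableEq n] {R : Type*} [CommRing R] (i : n)
    (b : n → R) : ((1 : Matrix n n R).updateCol i b).det = b i := by
  rw [← Matrix.cramer_apply, Matrix.cramer_one]
  rfl

theorem det_updateRow_one {n : Type*} [Fintype n] [DecidableEq n] {R : Type*} [CommRing R] (i : n)
    (b : n → R) : ((1 : Matrix n n R).updateRow i b).det = b i := by
  rw [← Matrix.det_transpose, ← Matrix.updateCol_transpose, Matrix.transpose_one, det_updateCol_one]

theorem mul_updateCol_one_apply {n : Type*} [Fintype n] [DecidableEq n] {R : Type*} [CommRing R]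
    (A : Matrix n n R) (i : n) (b : n → R) (j k : n) :
    (A * (1 : Matrix n n R).updateCol i b) j k = if k = i then (A *ᵥ b) j else A j k := by
  rw [Matrix.mul_updateCol, Matrix.mul_one, Matrix.updateCol_apply]

/-- Since `X v = z v`, the matrix `z - X` is singular, and adding `v v*` restores the missing
direction. Replacing the first basis vector by `v` makes the first column `|v|² v`; the multiples of
`v` in the other columns are then a column operation. -/
theorem det_bordered_chartMatrix (z : ℂ) (w : Fin m → ℂ) (Y : Fin (m + 1) → Fin m → ℂ) :
    (bordered z (Fin.cons 1 w) (chartMatrix w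
      (fun j => z * (Fin.cons 1 w : Fin (m + 1) → ℂ) j) Y)).det =
      vnorm (Fin.cons 1 w : Fin (m + 1) → ℂ) * (chartJacobian z w Y).det := by
  set v : Fin (m + 1) → ℂ := Fin.cons 1 w with hv
  have hv1 : v 0 = 1 := by simp [hv]
  set X := chartMatrix w (fun j => z * v j) Y with hX
  set p : ℂ := ((vnorm v : ℝ) : ℂ) with hp
  set r : Fin (m + 1) → ℂ := Function.update (fun k => conj (v k)) 0 p with hr
  have h1 : bordered z v X * (1 : Matrix (Fin (m + 1)) (Fin (m + 1)) ℂ).updateCol 0 v =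
      chartJacobian z w Y * (1 : Matrix (Fin (m + 1)) (Fin (m + 1)) ℂ).updateRow 0 r := by
    ext j k
    rw [mul_updateCol_one_apply]
    have hR : ∀ k, (chartJacobian z w Y * (1 : Matrix (Fin (m + 1)) (Fin (m + 1)) ℂ).updateRow 0 r) j k
        = v j * r k + ∑ l : Fin m, (chartJacobian z w Y) j l.succ *
          (1 : Matrix (Fin (m + 1)) (Fin (m + 1)) ℂ) l.succ k := by
      intro k
      rw [Matrix.mul_apply, Fin.sum_univ_succ]
      refine congrArg₂ (· + ·) ?_ (Finset.sum_congr rfl fun l _ => ?_)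
      · rw [Matrix.updateRow_self, chartJacobian, Matrix.of_apply, Fin.cons_zero]
      · rw [Matrix.updateRow_ne (Fin.succ_ne_zero l)]
    rw [hR]
    refine Fin.cases ?_ (fun k => ?_) k
    · rw [if_pos rfl]
      have : ∀ l : Fin m, (1 : Matrix (Fin (m + 1)) (Fin (m + 1)) ℂ) l.succ 0 = 0 :=
        fun l => Matrix.one_apply_ne (Fin.succ_ne_zero l)
      simp only [this, mul_zero, Finset.sum_const_zero, add_zero, hr, Function.update_self]
      have hXv : ∑ i, X j i * v i = z * v j := sum_chartMatrix_mul w (fun j => z * v j) Y j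
      have h1v : ∑ i, (1 : Matrix (Fin (m + 1)) (Fin (m + 1)) ℂ) j i * v i = v j := by
        simp [Matrix.one_apply]
      have hvv : ∑ i, v i * conj (v i) = p := sum_mul_conj v
      have hterm : ∀ i, bordered z v X j i * v i =
          z * ((1 : Matrix (Fin (m + 1)) (Fin (m + 1)) ℂ) j i * v i) - X j i * v i +
            v j * (v i * conj (v i)) := by
        intro i
        rw [bordered, Matrix.of_apply]
        ring
      rw [Matrix.mulVec, dotProduct]
      simp only [hterm, Finset.sum_add_distrib, Finset.sum_sub_distrib, ← Finset.mul_sum, hXv, h1v,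
        hvv]
      ring
    · rw [if_neg (Fin.succ_ne_zero k)]
      have : ∀ l : Fin m, (1 : Matrix (Fin (m + 1)) (Fin (m + 1)) ℂ) l.succ k.succ =
          if l = k then 1 else 0 := by
        intro l
        rw [Matrix.one_apply]
        simp only [Fin.succ_inj]
      simp only [this, mul_ite, mul_one, mul_zero, Finset.sum_ite_eq', Finset.mem_univ, if_true]
      rw [hr, Function.update_of_ne (Fin.succ_ne_zero k), bordered, Matrix.of_apply, hX]
      simp only [chartJacobian, chartMatrix, Matrix.of_apply, Fin.cons_succ]
      ring
  have h2 := congrArg Matrix.det h1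
  rw [Matrix.det_mul, Matrix.det_mul, det_updateCol_one, det_updateRow_one, hv1, mul_one, hr,
    Function.update_self] at h2
  rw [h2, mul_comm]

/-- The joint density of an eigenvalue `z` and its eigenvector `v` in a chart. -/
def chartDensity {N : ℕ} (τ : ℝ) (z : ℂ) (v : Fin N → ℂ) : ℝ :=
  reducedMoment N z (reducedMean τ v) (reducedVar τ v) *
    Real.exp (-((vnorm v ^ 2 * normSq z - τ * normSq (vsq v) * (z ^ 2).re) / vdisc τ v)) /
    (Real.pi * Real.sqrt (vdisc τ v)) ^ N

theorem sum_imageForm_mul {N : ℕ} (τ : ℝ) (z : ℂ) (v : Fin N → ℂ) :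
    ∑ j, imageForm τ v (z * v j) =
      (vnorm v ^ 2 * normSq z - τ * normSq (vsq v) * (z ^ 2).re) / vdisc τ v := by
  simp only [imageForm, ← Finset.sum_div, Finset.sum_sub_distrib, ← Finset.mul_sum, normSq_mul]
  congr 2
  · rw [show ∑ i, normSq (v i) = vnorm v from rfl]; ring
  · rw [mul_assoc]
    congr 1
    have : ∀ j, (conj (vsq v) * (z * v j) ^ 2).re = (conj (vsq v) * z ^ 2 * (v j * v j)).re := by
      intro j; congr 1; ring
    simp only [this]
    rw [← re_sum, ← Finset.mul_sum, show ∑ i, v i * v i = vsq v from rfl, ← re_ofReal_mul,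
      ← mul_conj]
    congr 1; ring

/-- `lintegral_condition` is applied to the squared bordered determinant, whose mean
`lintegral_normSq_det` supplies. Solving for the integral over `Y` divides by the Gaussian
constants, and the factors `|v|⁴` cancel. -/
theorem lintegral_chartJacobian {τ : ℝ} (hτ : |τ| < 1) (hm : 1 ≤ m) {z : ℂ} (hz : z ≠ 0)
    (w : Fin m → ℂ) :
    ∫⁻ Y, ENNReal.ofReal (matrixDensity τ
        (chartMatrix w (fun j => z * (Fin.cons 1 w : Fin (m + 1) → ℂ) j) Y)) *
      ENNReal.ofReal (normSq (chartJacobian z w Y).det) =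
    ENNReal.ofReal (chartDensity τ z (Fin.cons 1 w : Fin (m + 1) → ℂ)) := by
  set v : Fin (m + 1) → ℂ := Fin.cons 1 w with hv
  have hv0 : v ≠ 0 := fun h0 => by simpa [hv] using congrFun h0 0
  have hd := vdisc_pos hτ hv0
  have hp := vnorm_pos hv0
  have hbm : Measurable fun X : Fin (m + 1) → Fin (m + 1) → ℂ =>
      ENNReal.ofReal (normSq (bordered z v X).det) := by
    refine Measurable.ennreal_ofReal (Continuous.measurable ?_)
    refine continuous_normSq.comp (Continuous.matrix_det ?_)
    unfold bordered
    fun_prop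
  have h1 := lintegral_condition hτ w (fun j => z * v j) _ hbm
  rw [← hv, lintegral_normSq_det hτ hv0 hz (by omega), sum_imageForm_mul] at h1
  have h2 : ∫⁻ ξ : Fin (m + 1) → ℂ, ENNReal.ofReal (Real.exp (-∑ j, imageForm τ v (ξ j))) =
      ENNReal.ofReal ((Real.pi * Real.sqrt (vdisc τ v)) ^ (m + 1)) := by
    have hmi : Measurable fun c => ENNReal.ofReal (Real.exp (-imageForm τ v c)) := by
      refine Measurable.ennreal_ofReal (Continuous.measurable ?_)
      unfold imageForm
      have := continuous_re
      have := continuous_normSq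
      fun_prop
    have := lintegral_fin_prod_eq_prod (N := m + 1) (fun _ => (volume : Measure ℂ))
      (fun _ c => ENNReal.ofReal (Real.exp (-imageForm τ v c))) fun _ => hmi
    rw [lintegral_exp_neg_imageForm hτ hv0, Finset.prod_const, Finset.card_univ, Fintype.card_fin,
      ← ENNReal.ofReal_pow (by positivity)] at this
    rw [← this]
    refine lintegral_congr fun ξ => ?_
    rw [← ENNReal.ofReal_prod_of_nonneg fun _ _ => Real.exp_nonneg _, ← Real.exp_sum,
      Finset.sum_neg_distrib]
  rw [h2] at h1
  have hb := det_bordered_chartMatrix z w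
  rw [← hv] at hb
  simp only [hb, normSq_mul, normSq_ofReal] at h1
  have hjm : Measurable fun Y : Fin (m + 1) → Fin m → ℂ => ENNReal.ofReal (matrixDensity τ
        (chartMatrix w (fun j => z * v j) Y)) *
      ENNReal.ofReal (normSq (chartJacobian z w Y).det) := by
    have hA : Continuous fun Y : Fin (m + 1) → Fin m → ℂ =>
        matrixDensity τ (chartMatrix w (fun j => z * v j) Y) :=
      (continuous_matrixDensity τ).comp (continuous_chartMatrix.comp
        (by fun_prop : Continuous fun Y : Fin (m + 1) → Fin m → ℂ => (w, (fun j => z * v j), Y)))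
    have hB : Continuous fun Y : Fin (m + 1) → Fin m → ℂ => normSq (chartJacobian z w Y).det := by
      refine continuous_normSq.comp (Continuous.matrix_det ?_)
      refine continuous_pi fun j => continuous_pi fun k => ?_
      refine Fin.cases ?_ (fun k => ?_) k
      · simp only [chartJacobian, Matrix.of_apply, Fin.cons_zero]; fun_prop
      · simp only [chartJacobian, Matrix.of_apply, Fin.cons_succ]; fun_prop
    exact hA.measurable.ennreal_ofReal.mul hB.measurable.ennreal_ofReal
  have h3 : ∀ Y : Fin (m + 1) → Fin m → ℂ,
      ENNReal.ofReal (matrixDensity τ (chartMatrix w (fun j => z * v j) Y)) *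
        ENNReal.ofReal (vnorm v * vnorm v * normSq (chartJacobian z w Y).det) =
      ENNReal.ofReal (vnorm v * vnorm v) *
        (ENNReal.ofReal (matrixDensity τ (chartMatrix w (fun j => z * v j) Y)) *
          ENNReal.ofReal (normSq (chartJacobian z w Y).det)) := by
    intro Y
    rw [ENNReal.ofReal_mul (by positivity)]
    ring
  simp only [h3] at h1
  rw [lintegral_const_mul _ hjm, ← ENNReal.ofReal_mul (Real.exp_nonneg _), ← mul_assoc,
    ← ENNReal.ofReal_mul (by positivity)] at h1
  set E := (vnorm v ^ 2 * normSq z - τ * normSq (vsq v) * (z ^ 2).re) / vdisc τ v with hE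
  set c := Real.exp E * (Real.pi * Real.sqrt (vdisc τ v)) ^ (m + 1) * (vnorm v * vnorm v) with hc
  have hsq : 0 < Real.sqrt (vdisc τ v) := Real.sqrt_pos.2 hd
  have hc0 : 0 < c := by positivity
  have hcne : ENNReal.ofReal c ≠ 0 := by simpa using hc0
  rw [eq_comm, ← ENNReal.eq_div_iff hcne ENNReal.ofReal_ne_top, ← ENNReal.ofReal_div_of_pos hc0]
    at h1
  rw [h1]
  congr 1
  rw [chartDensity, ← hE, Real.exp_neg, hc]
  field_simp

end ChartDensity

/-! ### The eigenvector chart and its Jacobian -/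

section ChartMap

open Complex ComplexConjugate Matrix

variable {m : ℕ}

/-- The first column of the matrix with last columns `Y`, eigenvalue `u 0` and eigenvector
`(1, u 1, …, u m)`. -/
def chartMap (Y : Fin (m + 1) → Fin m → ℂ) (u : Fin (m + 1) → ℂ) : Fin (m + 1) → ℂ :=
  fun j => u 0 * (Fin.cons 1 (Fin.tail u) : Fin (m + 1) → ℂ) j - ∑ k, Y j k * u k.succ

theorem chartMatrix_eq_cons_chartMap (Y : Fin (m + 1) → Fin m → ℂ) (u : Fin (m + 1) → ℂ) :
    chartMatrix (Fin.tail u) (fun j => u 0 * (Fin.cons 1 (Fin.tail u) : Fin (m + 1) → ℂ) j) Y =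
      fun j => Fin.cons (chartMap Y u j) (Y j) := rfl

/-- The derivative of `chartMap`. -/
def chartMapDeriv (Y : Fin (m + 1) → Fin m → ℂ) (u : Fin (m + 1) → ℂ) :
    (Fin (m + 1) → ℂ) →L[ℂ] (Fin (m + 1) → ℂ) :=
  LinearMap.toContinuousLinearMap (Matrix.toLin' (chartJacobian (u 0) (Fin.tail u) Y))

theorem hasFDerivAt_chartMap (Y : Fin (m + 1) → Fin m → ℂ) (u : Fin (m + 1) → ℂ) :
    HasFDerivAt (chartMap Y) (chartMapDeriv Y u) u := by
  have hproj : ∀ k : Fin (m + 1), HasFDerivAt (fun u : Fin (m + 1) → ℂ => u k)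
      (ContinuousLinearMap.proj (R := ℂ) k) u := fun k => hasFDerivAt_apply k u
  have hsum : ∀ j, HasFDerivAt (fun u : Fin (m + 1) → ℂ => ∑ k : Fin m, Y j k * u k.succ)
      (∑ k : Fin m, Y j k • ContinuousLinearMap.proj (R := ℂ) (φ := fun _ => ℂ) k.succ) u :=
    fun j => HasFDerivAt.fun_sum fun k _ => (hproj k.succ).const_mul (Y j k)
  refine hasFDerivAt_pi'.2 fun j => ?_
  have hone : ∀ (j : Fin m) (d : Fin (m + 1) → ℂ),
      ∑ x : Fin m, u 0 * (1 : Matrix (Fin (m + 1)) (Fin (m + 1)) ℂ) j.succ x.succ * d x.succ =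
        u 0 * d j.succ := by
    intro j d
    have : ∀ x : Fin m, (1 : Matrix (Fin (m + 1)) (Fin (m + 1)) ℂ) j.succ x.succ =
        if j = x then 1 else 0 := by
      intro x; rw [Matrix.one_apply]; simp only [Fin.succ_inj]
    simp [this]
  refine Fin.cases ?_ (fun j => ?_) j
  · have h0 := (hproj 0).sub (hsum 0)
    refine (h0.congr_fderiv ?_).congr_of_eventuallyEq (Eventually.of_forall fun u => ?_)
    · ext d
      have : ∀ x : Fin m, (1 : Matrix (Fin (m + 1)) (Fin (m + 1)) ℂ) 0 x.succ = 0 :=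
        fun x => Matrix.one_apply_ne (Fin.succ_ne_zero x).symm
      simp [chartMapDeriv, Matrix.mulVec, dotProduct, Fin.sum_univ_succ, chartJacobian, this,
        sub_eq_add_neg]
    · simp [chartMap]
  · have h1 := ((hproj 0).mul (hproj j.succ)).sub (hsum j.succ)
    refine (h1.congr_fderiv ?_).congr_of_eventuallyEq (Eventually.of_forall fun u => ?_)
    · ext d
      simp [chartMapDeriv, Matrix.mulVec, dotProduct, Fin.sum_univ_succ, chartJacobian, sub_mul,
        hone, Fin.tail]
      ring
    · simp [chartMap, Fin.tail]

theorem det_restrictScalars_chartMapDeriv (Y : Fin (m + 1) → Fin m → ℂ) (u : Fin (m + 1) → ℂ) :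
    ((chartMapDeriv Y u).restrictScalars ℝ).det =
      normSq (chartJacobian (u 0) (Fin.tail u) Y).det := by
  rw [ContinuousLinearMap.det]
  have : ((chartMapDeriv Y u).restrictScalars ℝ : (Fin (m + 1) → ℂ) →ₗ[ℝ] (Fin (m + 1) → ℂ)) =
      (Matrix.toLin' (chartJacobian (u 0) (Fin.tail u) Y)).restrictScalars ℝ := rfl
  rw [this, LinearMap.det_restrictScalars, Algebra.norm_complex_apply, LinearMap.det_toLin']

/-- The area formula for a holomorphic map, whose real Jacobian is the squared modulus of the
complex one. -/
theorem lintegral_normSq_chartJacobian_mul (Y : Fin (m + 1) → Fin m → ℂ)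
    (g : (Fin (m + 1) → ℂ) → ENNReal) (hg : Measurable g) :
    ∫⁻ u, ENNReal.ofReal (normSq (chartJacobian (u 0) (Fin.tail u) Y).det) * g u =
      ∫⁻ x, ∑' u, (chartMap Y ⁻¹' {x}).indicator g u := by
  have hder : ∀ u, HasFDerivAt (chartMap Y) ((chartMapDeriv Y u).restrictScalars ℝ) u :=
    fun u => (hasFDerivAt_chartMap Y u).restrictScalars ℝ
  have hcd : ContDiff ℝ 1 (chartMap Y) := by
    refine contDiff_pi.2 fun j => ?_
    refine Fin.cases ?_ (fun j => ?_) j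
    · simp only [chartMap, Fin.cons_zero]; fun_prop
    · simp only [chartMap, Fin.cons_succ, Fin.tail]; fun_prop
  have hc : Continuous fun u => (chartMapDeriv Y u).restrictScalars ℝ := by
    have he : (fun u => (chartMapDeriv Y u).restrictScalars ℝ) = fderiv ℝ (chartMap Y) :=
      funext fun u => (hder u).fderiv.symm
    rw [he]
    exact hcd.continuous_fderiv (by norm_num)
  rw [← lintegral_abs_det_fderiv_mul_eq_lintegral_tsum volume _ _ hder hc g hg]
  refine lintegral_congr fun u => ?_
  rw [det_restrictScalars_chartMapDeriv, abs_of_nonneg (normSq_nonneg _)]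

/-- Sard's theorem again; through `count_roots_charpoly_of_chartMap_eq` it makes eigenvalues simple
for almost every first column. -/
theorem ae_chartJacobian_det_ne_zero (Y : Fin (m + 1) → Fin m → ℂ) :
    ∀ᵐ x : Fin (m + 1) → ℂ, ∀ u, chartMap Y u = x →
      (chartJacobian (u 0) (Fin.tail u) Y).det ≠ 0 := by
  have h := addHaar_image_eq_zero_of_det_fderivWithin_eq_zero volume
    (s := {u | (chartJacobian (u 0) (Fin.tail u) Y).det = 0}) (f := chartMap Y)
    (f' := fun u => (chartMapDeriv Y u).restrictScalars ℝ)
    (fun u _ => ((hasFDerivAt_chartMap Y u).restrictScalars ℝ).hasFDerivWithinAt)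
    (fun u hu => by rw [det_restrictScalars_chartMapDeriv, show (chartJacobian (u 0) (Fin.tail u) Y).det = 0 from hu,
      map_zero])
  filter_upwards [measure_eq_zero_iff_ae_notMem.1 h] with x hx u hu h0
  exact hx ⟨u, h0, hu⟩

end ChartMap

/-! ### Preimages of the chart map correspond to eigenvalues -/

section RootCounting

open Complex ComplexConjugate Matrix

variable {m : ℕ}

/-- No matrix with last columns `Y` has an eigenvector with vanishing first coordinate. -/
def IsGenericChart (Y : Fin (m + 1) → Fin m → ℂ) : Prop :=
  ∀ (z : ℂ) (w : Fin m → ℂ), (∀ j, ∑ k, Y j k * w k = z * (Fin.cons 0 w : Fin (m + 1) → ℂ) j) →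
    w = 0

/-- The characteristic matrix sends `(1, w)` to `(X - u 0) (1, w)`, so a linear factor comes out of
column `0`. The cofactor is the Jacobian with `X` in place of the eigenvalue; if it does not vanish
at `u 0`, the root is simple. -/
theorem charpoly_eq_mul_of_chartMap_eq (Y : Fin (m + 1) → Fin m → ℂ) (x u : Fin (m + 1) → ℂ)
    (hu : chartMap Y u = x) :
    (Matrix.of fun j => (Fin.cons (x j) (Y j) : Fin (m + 1) → ℂ)).charpoly =
      (Polynomial.X - Polynomial.C (u 0)) *
        (chartJacobian (Polynomial.X : Polynomial ℂ) (fun k => Polynomial.C (Fin.tail u k))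
          (fun j k => Polynomial.C (Y j k))).det := by
  set M : Matrix (Fin (m + 1)) (Fin (m + 1)) ℂ :=
    Matrix.of fun j => (Fin.cons (x j) (Y j) : Fin (m + 1) → ℂ) with hM
  set v : Fin (m + 1) → Polynomial ℂ := Fin.cons 1 (fun k => Polynomial.C (Fin.tail u k)) with hv
  set J := chartJacobian (Polynomial.X : Polynomial ℂ) (fun k => Polynomial.C (Fin.tail u k))
          (fun j k => Polynomial.C (Y j k)) with hJ
  have hv' : ∀ j, v j = Polynomial.C ((Fin.cons 1 (Fin.tail u) : Fin (m + 1) → ℂ) j) := by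
    intro j
    refine Fin.cases ?_ (fun j => ?_) j
    · simp [hv]
    · simp [hv]
  have h1 : M.charmatrix * (1 : Matrix (Fin (m + 1)) (Fin (m + 1)) (Polynomial ℂ)).updateCol 0 v =
      J.updateCol 0 ((Polynomial.X - Polynomial.C (u 0)) • v) := by
    ext j k : 2
    rw [mul_updateCol_one_apply, Matrix.updateCol_apply]
    refine Fin.cases ?_ (fun k => ?_) k
    · rw [if_pos rfl, if_pos rfl]
      have hrow : ∑ i, M j i * (Fin.cons 1 (Fin.tail u) : Fin (m + 1) → ℂ) i =
          u 0 * (Fin.cons 1 (Fin.tail u) : Fin (m + 1) → ℂ) j := by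
        have hxj : x j = chartMap Y u j := by rw [hu]
        rw [Fin.sum_univ_succ]
        simp only [hM, Matrix.of_apply, Fin.cons_zero, Fin.cons_succ, hxj, chartMap, mul_one]
        exact sub_add_cancel _ _
      have h1v : ∑ i, (1 : Matrix (Fin (m + 1)) (Fin (m + 1)) (Polynomial ℂ)) j i * v i = v j := by
        simp [Matrix.one_apply]
      have hrow' : ∑ i, Polynomial.C (M j i) * v i = Polynomial.C (u 0) * v j := by
        simp only [hv', ← Polynomial.C_mul, ← hrow, map_sum]
      have hterm : ∀ i, M.charmatrix j i * v i = Polynomial.X *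
          ((1 : Matrix (Fin (m + 1)) (Fin (m + 1)) (Polynomial ℂ)) j i * v i) -
          Polynomial.C (M j i) * v i := by
        intro i
        rw [Matrix.charmatrix_apply, Matrix.diagonal_apply, Matrix.one_apply]
        split_ifs <;> simp [sub_mul]
      rw [Matrix.mulVec, dotProduct]
      simp only [hterm, Finset.sum_sub_distrib, ← Finset.mul_sum, h1v, hrow', Pi.smul_apply,
        smul_eq_mul]
      ring_nf
    · rw [if_neg (Fin.succ_ne_zero k), if_neg (Fin.succ_ne_zero k), Matrix.charmatrix_apply,
        Matrix.diagonal_apply, hJ, chartJacobian, Matrix.of_apply, Fin.cons_succ, Matrix.one_apply,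
        hM, Matrix.of_apply, Fin.cons_succ]
      split_ifs <;> simp
  have h2 := congrArg Matrix.det h1
  rw [Matrix.det_mul, det_updateCol_one, Matrix.det_updateCol_smul] at h2
  have hv1 : v 0 = 1 := by simp [hv]
  have h3 : J.updateCol 0 v = J := by
    ext j k : 2
    rw [Matrix.updateCol_apply]
    split_ifs with h
    · rw [h, hJ, chartJacobian, Matrix.of_apply, Fin.cons_zero]
    · rfl
  rw [hv1, mul_one, h3] at h2
  exact h2

theorem eval_det_chartJacobian (Y : Fin (m + 1) → Fin m → ℂ) (w : Fin m → ℂ) (z : ℂ) :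
    (chartJacobian (Polynomial.X : Polynomial ℂ) (fun k => Polynomial.C (w k))
      (fun j k => Polynomial.C (Y j k))).det.eval z = (chartJacobian z w Y).det := by
  rw [← Polynomial.coe_evalRingHom, RingHom.map_det]
  congr 1
  ext j k
  rw [RingHom.mapMatrix_apply, Matrix.map_apply, Polynomial.coe_evalRingHom]
  refine Fin.cases ?_ (fun k => ?_) k
  · simp only [chartJacobian, Matrix.of_apply, Fin.cons_zero]
    refine Fin.cases ?_ (fun j => ?_) j <;> simp
  · simp only [chartJacobian, Matrix.of_apply, Fin.cons_succ, Matrix.one_apply]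
    split_ifs <;> simp

theorem count_roots_charpoly_of_chartMap_eq (Y : Fin (m + 1) → Fin m → ℂ)
    (x u : Fin (m + 1) → ℂ) (hu : chartMap Y u = x)
    (hJ : (chartJacobian (u 0) (Fin.tail u) Y).det ≠ 0) :
    (Matrix.of fun j => (Fin.cons (x j) (Y j) : Fin (m + 1) → ℂ)).charpoly.roots.count (u 0) =
      1 := by
  have h := charpoly_eq_mul_of_chartMap_eq Y x u hu
  have h0 : (Matrix.of fun j => (Fin.cons (x j) (Y j) : Fin (m + 1) → ℂ)).charpoly ≠ 0 :=
    (Matrix.charpoly_monic _).ne_zero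
  rw [h] at h0 ⊢
  rw [Polynomial.roots_mul h0, Polynomial.roots_X_sub_C, Multiset.count_add,
    Multiset.count_singleton_self, Multiset.count_eq_zero.2]
  rw [Polynomial.mem_roots (right_ne_zero_of_mul h0), Polynomial.IsRoot,
    eval_det_chartJacobian Y (Fin.tail u) (u 0)]
  exact hJ

theorem exists_chartMap_eq_of_mem_roots (Y : Fin (m + 1) → Fin m → ℂ) (hY : IsGenericChart Y)
    (x : Fin (m + 1) → ℂ) (z : ℂ)
    (hz : z ∈ (Matrix.of fun j => (Fin.cons (x j) (Y j) : Fin (m + 1) → ℂ)).charpoly.roots) :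
    ∃ u, chartMap Y u = x ∧ u 0 = z := by
  set M : Matrix (Fin (m + 1)) (Fin (m + 1)) ℂ :=
    Matrix.of fun j => (Fin.cons (x j) (Y j) : Fin (m + 1) → ℂ) with hM
  have h1 := (Polynomial.mem_roots (Matrix.charpoly_monic M).ne_zero).1 hz
  rw [Polynomial.IsRoot, Matrix.eval_charpoly] at h1
  obtain ⟨v, hv0, hv⟩ := Matrix.exists_mulVec_eq_zero_iff.2 h1
  have hrow : ∀ j, x j * v 0 + ∑ k : Fin m, Y j k * v k.succ = z * v j := by
    intro j
    have := congrFun hv j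
    rw [Matrix.sub_mulVec, Pi.sub_apply, Pi.zero_apply, sub_eq_zero, Matrix.scalar_apply,
      Matrix.mulVec_diagonal, Matrix.mulVec, dotProduct, Fin.sum_univ_succ] at this
    simpa [hM] using this.symm
  have hv1 : v 0 ≠ 0 := by
    intro h0
    have hw := hY z (fun k => v k.succ) (fun j => by
      have := hrow j
      rw [h0, mul_zero, zero_add] at this
      rw [this]
      refine Fin.cases ?_ (fun j => ?_) j
      · rw [h0, Fin.cons_zero]
      · rw [Fin.cons_succ])
    refine hv0 (funext fun j => ?_)
    refine Fin.cases h0 (fun j => ?_) j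
    exact congrFun hw j
  refine ⟨Fin.cons z fun k => v k.succ / v 0, ?_, by simp⟩
  funext j
  have hc : (Fin.cons 1 (fun k => v k.succ / v 0) : Fin (m + 1) → ℂ) j = v j / v 0 := by
    refine Fin.cases ?_ (fun j => ?_) j
    · rw [Fin.cons_zero, div_self hv1]
    · rw [Fin.cons_succ]
  simp only [chartMap, Fin.cons_zero, Fin.cons_succ, Fin.tail_cons, hc, mul_div_assoc',
    ← Finset.sum_div]
  rw [← sub_div, ← hrow j, add_sub_cancel_right, mul_div_cancel_right₀ _ hv1]

/-- The difference of two normalised eigenvectors for one eigenvalue has first coordinate zero, so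
genericity makes it vanish. -/
theorem chartMap_injOn_eigenvalue (Y : Fin (m + 1) → Fin m → ℂ) (hY : IsGenericChart Y)
    (u u' : Fin (m + 1) → ℂ) (h : chartMap Y u = chartMap Y u') (h0 : u 0 = u' 0) : u = u' := by
  have hw := hY (u 0) (fun k => u k.succ - u' k.succ) (fun j => by
    have := congrFun h j
    simp only [chartMap, ← h0] at this
    simp only [mul_sub, Finset.sum_sub_distrib]
    have hc : (Fin.cons 0 (fun k => u k.succ - u' k.succ) : Fin (m + 1) → ℂ) j =
        (Fin.cons 1 (Fin.tail u) : Fin (m + 1) → ℂ) j -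
          (Fin.cons 1 (Fin.tail u') : Fin (m + 1) → ℂ) j := by
      refine Fin.cases ?_ (fun j => ?_) j
      · simp
      · simp [Fin.tail]
    rw [hc]
    linear_combination -this)
  funext j
  refine Fin.cases h0 (fun j => ?_) j
  exact sub_eq_zero.1 (congrFun hw j)

theorem tsum_chartMap_preimage (Y : Fin (m + 1) → Fin m → ℂ) (hY : IsGenericChart Y)
    (x : Fin (m + 1) → ℂ)
    (hx : ∀ u, chartMap Y u = x → (chartJacobian (u 0) (Fin.tail u) Y).det ≠ 0)
    (f : ℂ → ℝ) (hf : ∀ z, 0 ≤ f z) (c : ENNReal) :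
    ∑' u, (chartMap Y ⁻¹' {x}).indicator (fun u => ENNReal.ofReal (f (u 0)) * c) u =
      ENNReal.ofReal (eigenvalueSum (Matrix.of fun j =>
        (Fin.cons (x j) (Y j) : Fin (m + 1) → ℂ)) f) * c := by
  classical
  set M : Matrix (Fin (m + 1)) (Fin (m + 1)) ℂ :=
    Matrix.of fun j => (Fin.cons (x j) (Y j) : Fin (m + 1) → ℂ) with hM
  have hmem : ∀ u, chartMap Y u = x → u 0 ∈ M.charpoly.roots := fun u hu => by
    rw [← Multiset.one_le_count_iff_mem, count_roots_charpoly_of_chartMap_eq Y x u hu (hx u hu)]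
  have hnodup : M.charpoly.roots.Nodup := by
    rw [Multiset.nodup_iff_count_le_one]
    intro z
    by_cases hz : z ∈ M.charpoly.roots
    · obtain ⟨u, hu, rfl⟩ := exists_chartMap_eq_of_mem_roots Y hY x z hz
      exact (count_roots_charpoly_of_chartMap_eq Y x u hu (hx u hu)).le
    · rw [Multiset.count_eq_zero.2 hz]
      exact zero_le_one
  have hsum : eigenvalueSum M f = ∑ z ∈ M.charpoly.roots.toFinset, f z := by
    rw [eigenvalueSum, Finset.sum, Multiset.toFinset_val, Multiset.dedup_eq_self.2 hnodup]
  have hbij : Function.Bijective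
      (fun u : chartMap Y ⁻¹' {x} => (⟨u.1 0, Multiset.mem_toFinset.2 (hmem u.1 u.2)⟩ :
        M.charpoly.roots.toFinset)) := by
    constructor
    · rintro ⟨u, hu⟩ ⟨u', hu'⟩ h
      have h0 : u 0 = u' 0 := congrArg Subtype.val h
      exact Subtype.ext (chartMap_injOn_eigenvalue Y hY u u'
        ((show chartMap Y u = x from hu).trans (show chartMap Y u' = x from hu').symm) h0)
    · rintro ⟨z, hz⟩
      obtain ⟨u, hu, huz⟩ := exists_chartMap_eq_of_mem_roots Y hY x z (Multiset.mem_toFinset.1 hz)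
      exact ⟨⟨u, hu⟩, Subtype.ext huz⟩
  rw [← tsum_subtype (chartMap Y ⁻¹' {x}) fun u => ENNReal.ofReal (f (u 0)) * c,
    ENNReal.tsum_mul_right]
  congr 1
  refine ((Equiv.ofBijective _ hbij).tsum_eq (fun z : M.charpoly.roots.toFinset =>
    ENNReal.ofReal (f z.1))).trans ?_
  rw [tsum_fintype, hsum, ENNReal.ofReal_sum_of_nonneg fun z _ => hf z]
  exact Finset.sum_coe_sort M.charpoly.roots.toFinset fun z => ENNReal.ofReal (f z)

end RootCounting

/-! ### Almost every choice of the last columns is generic -/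

section Genericity

open Matrix

variable {m : ℕ}

/-- The rows of `Y` below the first one. -/
def lowerRows {R : Type*} (Y : Fin (m + 1) → Fin m → R) : Matrix (Fin m) (Fin m) R :=
  Matrix.of fun j => Y (Fin.succ j)

/-- The Krylov matrix of the first row of `Y` and the square matrix formed by the other rows. -/
def krylov {R : Type*} [CommRing R] (Y : Fin (m + 1) → Fin m → R) : Matrix (Fin m) (Fin m) R :=
  Matrix.of fun i => Y 0 ᵥ* lowerRows Y ^ (i : ℕ)

/-- If `(0, w)` is an eigenvector, `w` is an eigenvector of the lower block killed by the first row,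
hence killed by every row of the Krylov matrix. -/
theorem isGenericChart_of_det_krylov_ne_zero (Y : Fin (m + 1) → Fin m → ℂ)
    (h : (krylov Y).det ≠ 0) : IsGenericChart Y := by
  intro z w hw
  have h0 : Y 0 ⬝ᵥ w = 0 := by
    have := hw 0
    rwa [Fin.cons_zero, mul_zero] at this
  have h1 : lowerRows Y *ᵥ w = z • w := by
    funext j
    simpa [Matrix.mulVec, dotProduct, lowerRows] using hw j.succ
  have h2 : ∀ i : ℕ, lowerRows Y ^ i *ᵥ w = z ^ i • w := by
    intro i
    induction i with
    | zero => simp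
    | succ i ih => rw [pow_succ, ← Matrix.mulVec_mulVec, h1, Matrix.mulVec_smul, ih, smul_smul,
        pow_succ, mul_comm]
  refine Matrix.eq_zero_of_mulVec_eq_zero h (funext fun i => ?_)
  change (Y 0 ᵥ* lowerRows Y ^ (i : ℕ)) ⬝ᵥ w = 0
  rw [← Matrix.dotProduct_mulVec, h2, dotProduct_smul, h0, smul_zero]

theorem krylov_smul (s : ℂ) (Y : Fin (m + 1) → Fin m → ℂ) :
    (krylov (s • Y)).det = (∏ i : Fin m, s ^ ((i : ℕ) + 1)) * (krylov Y).det := by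
  rw [← Matrix.det_mul_column]
  congr 1
  ext i k
  have h : lowerRows (s • Y) = s • lowerRows Y := rfl
  simp only [krylov, Matrix.of_apply, h, smul_pow, Pi.smul_apply, Matrix.smul_vecMul,
    Matrix.vecMul_smul, smul_eq_mul]
  ring

theorem map_det_krylov {R S : Type*} [CommRing R] [CommRing S] (φ : R →+* S)
    (Y : Fin (m + 1) → Fin m → R) :
    φ (krylov Y).det = (krylov fun j k => φ (Y j k)).det := by
  rw [RingHom.map_det]
  congr 1
  ext i k
  have h : lowerRows (fun j k => φ (Y j k)) = φ.mapMatrix (lowerRows Y) := rfl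
  simp only [krylov, RingHom.mapMatrix_apply, Matrix.map_apply, Matrix.of_apply, h, Matrix.vecMul,
    dotProduct, map_sum, map_mul]
  rw [← RingHom.mapMatrix_apply, ← map_pow]
  rfl

/-- Columns with an invertible Krylov matrix. -/
def krylovBase (m : ℕ) : Fin (m + 1) → Fin m → ℂ :=
  Fin.cons (fun _ => 1) fun j k => Matrix.diagonal (fun k : Fin m => ((k : ℕ) : ℂ)) j k

/-- A row of ones over a diagonal matrix with distinct entries has a Vandermonde matrix, transposed,
as its Krylov matrix. -/
theorem det_krylovBase_ne_zero : (krylov (krylovBase m)).det ≠ 0 := by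
  have h : krylov (krylovBase m) = (Matrix.vandermonde fun k : Fin m => ((k : ℕ) : ℂ))ᵀ := by
    ext i k
    have h : lowerRows (krylovBase m) =
      Matrix.diagonal (fun k : Fin m => ((k : ℕ) : ℂ)) := by
        ext; simp [krylovBase, lowerRows]
    have h0 : krylovBase m 0 k = 1 := rfl
    simp only [krylov, Matrix.of_apply, h, Matrix.diagonal_pow, Matrix.vecMul_diagonal,
      Matrix.transpose_apply, Matrix.vandermonde_apply, h0, one_mul, Pi.pow_apply]
  rw [h, Matrix.det_transpose, Matrix.det_vandermonde_ne_zero_iff]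
  intro a b hab
  exact Fin.ext (Nat.cast_injective hab)

theorem finite_det_krylov_eq_zero (Y : Fin (m + 1) → Fin m → ℂ) :
    {s : ℂ | (krylov (krylovBase m + s • Y)).det = 0}.Finite := by
  set q : Polynomial ℂ := (krylov fun j k => Polynomial.C (krylovBase m j k) +
    Polynomial.X * Polynomial.C (Y j k)).det with hq
  have hev : ∀ s, q.eval s = (krylov (krylovBase m + s • Y)).det := by
    intro s
    rw [← Polynomial.coe_evalRingHom, hq, map_det_krylov]
    congr 2
    funext j k
    simp [mul_comm (Y j k)]
  have hq0 : q ≠ 0 := by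
    intro h
    have := hev 0
    rw [h, Polynomial.eval_zero, zero_smul, add_zero] at this
    exact det_krylovBase_ne_zero this.symm
  refine (q.roots.toFinset.finite_toSet).subset fun s hs => ?_
  rw [Finset.mem_coe, Multiset.mem_toFinset, Polynomial.mem_roots hq0, Polynomial.IsRoot, hev]
  exact hs

theorem continuous_det_krylov :
    Continuous fun Y : Fin (m + 1) → Fin m → ℂ => (krylov Y).det := by
  refine Continuous.matrix_det (continuous_matrix fun i k => ?_)
  have h : Continuous fun Y : Fin (m + 1) → Fin m → ℂ =>
      lowerRows Y ^ (i : ℕ) :=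
    Continuous.pow (continuous_matrix fun j k => by
      simp only [lowerRows, Matrix.of_apply]; fun_prop) _
  simp only [krylov, Matrix.of_apply, Matrix.vecMul, dotProduct]
  exact continuous_finsetSum _ fun j _ => Continuous.mul (by fun_prop) (h.matrix_elem j k)

/-- On every complex line in the direction `krylovBase m` the Krylov determinant vanishes at
finitely many points only; Fubini along these lines gives a null set. -/
theorem ae_isGenericChart : ∀ᵐ Y : Fin (m + 1) → Fin m → ℂ, IsGenericChart Y := by
  have : (volume : Measure (Fin (m + 1) → Fin m → ℂ)).IsAddHaarMeasure :=
    Measure.pi.isAddHaarMeasure fun _ => (volume : Measure (Fin m → ℂ))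
  have h : ∀ᵐ Y : Fin (m + 1) → Fin m → ℂ, Y ∈ {Y | (krylov Y).det ≠ 0} := by
    refine ae_mem_of_ae_add_linearMap_mem
      ((LinearMap.toSpanSingleton ℂ (Fin (m + 1) → Fin m → ℂ) (krylovBase m)).restrictScalars ℝ)
      (volume : Measure ℂ) volume
      (isOpen_ne_fun continuous_det_krylov continuous_const).measurableSet fun Y => ?_
    have hf : ({0} ∪ (fun s : ℂ => s⁻¹) ⁻¹'
        {s : ℂ | (krylov (krylovBase m + s • Y)).det = 0}).Finite :=
      (Set.finite_singleton _).union
        ((finite_det_krylov_eq_zero Y).preimage inv_injective.injOn)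
    filter_upwards [measure_eq_zero_iff_ae_notMem.1 (hf.measure_zero volume)] with s hs h0
    rw [Set.mem_union, not_or] at hs
    have hs0 : s ≠ 0 := hs.1
    refine hs.2 ?_
    -- Homogeneity moves the parameter from `krylovBase m` to `Y`, as in
    -- `finite_det_krylov_eq_zero`.
    have he : Y + s • krylovBase m = s • (krylovBase m + s⁻¹ • Y) := by
      rw [smul_add, smul_smul, mul_inv_cancel₀ hs0, one_smul, add_comm Y]
    change (krylov (Y + s • krylovBase m)).det = 0 at h0
    rw [he, krylov_smul] at h0
    exact (mul_eq_zero.1 h0).resolve_left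
      (Finset.prod_ne_zero_iff.2 fun i _ => pow_ne_zero _ hs0)
  filter_upwards [h] with Y hY
  exact isGenericChart_of_det_krylov_ne_zero Y hY

end Genericity

/-! ### Continuity of eigenvalue sums -/

section Continuity

open Matrix

variable {N : ℕ}

/-- Gershgorin: beyond this bound `z - X` is strictly diagonally dominant. -/
theorem norm_le_sum_norm_of_mem_roots_charpoly (X : Matrix (Fin N) (Fin N) ℂ) {z : ℂ}
    (hz : z ∈ X.charpoly.roots) : ‖z‖ ≤ ∑ i, ∑ j, ‖X i j‖ := by
  have h1 := (Polynomial.mem_roots (Matrix.charpoly_monic X).ne_zero).1 hz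
  rw [Polynomial.IsRoot, Matrix.eval_charpoly] at h1
  by_contra! hlt
  refine det_ne_zero_of_sum_row_lt_diag (A := Matrix.scalar (Fin N) z - X) (fun k => ?_) h1
  have h2 : ∑ j ∈ Finset.univ.erase k, ‖(Matrix.scalar (Fin N) z - X) k j‖ =
      ∑ j ∈ Finset.univ.erase k, ‖X k j‖ := by
    refine Finset.sum_congr rfl fun j hj => ?_
    rw [Matrix.sub_apply, Matrix.scalar_apply, Matrix.diagonal_apply_ne _
      (Finset.ne_of_mem_erase hj).symm, zero_sub, norm_neg]
  have h3 : ‖z‖ - ‖X k k‖ ≤ ‖(Matrix.scalar (Fin N) z - X) k k‖ := by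
    rw [Matrix.sub_apply, Matrix.scalar_apply, Matrix.diagonal_apply_eq]
    exact norm_sub_norm_le _ _
  have h4 : ∑ j, ‖X k j‖ ≤ ∑ i, ∑ j, ‖X i j‖ :=
    Finset.single_le_sum (f := fun i => ∑ j, ‖X i j‖)
      (fun i _ => Finset.sum_nonneg fun j _ => norm_nonneg _) (Finset.mem_univ k)
  rw [← Finset.add_sum_erase _ _ (Finset.mem_univ k)] at h4
  rw [h2]
  linarith

/-- `l` lists the eigenvalues of `X` with multiplicity. -/
def IsEigenvalueList (X : Matrix (Fin N) (Fin N) ℂ) (l : Fin N → ℂ) : Prop :=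
  ∀ z, (Matrix.scalar (Fin N) z - X).det = ∏ i, (z - l i)

theorem IsEigenvalueList.roots_eq {X : Matrix (Fin N) (Fin N) ℂ} {l : Fin N → ℂ}
    (h : IsEigenvalueList X l) : X.charpoly.roots = Finset.univ.val.map l := by
  have hp : X.charpoly = (Finset.univ.val.map fun i => Polynomial.X - Polynomial.C (l i)).prod := by
    refine Polynomial.funext fun z => ?_
    rw [Matrix.eval_charpoly, h z]
    change _ = Polynomial.eval z (∏ i, (Polynomial.X - Polynomial.C (l i)))
    simp [Polynomial.eval_prod]
  rw [hp, ← Polynomial.roots_multiset_prod_X_sub_C (Finset.univ.val.map l), Multiset.map_map]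
  rfl

theorem IsEigenvalueList.eigenvalueSum_eq {X : Matrix (Fin N) (Fin N) ℂ} {l : Fin N → ℂ}
    (h : IsEigenvalueList X l) (f : ℂ → ℝ) : eigenvalueSum X f = ∑ i, f (l i) := by
  rw [eigenvalueSum, h.roots_eq, Multiset.map_map]
  rfl

theorem exists_isEigenvalueList (X : Matrix (Fin N) (Fin N) ℂ) : ∃ l, IsEigenvalueList X l := by
  have hcard : X.charpoly.roots.card = N := by
    rw [IsAlgClosed.card_roots_eq_natDegree, Matrix.charpoly_natDegree_eq_dim, Fintype.card_fin]
  obtain ⟨l, hl⟩ : ∃ l : Fin N → ℂ, Finset.univ.val.map l = X.charpoly.roots := by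
    revert hcard
    refine Quotient.inductionOn X.charpoly.roots fun L hL => ?_
    have hL' : L.length = N := hL
    subst hL'
    exact ⟨L.get, by rw [Fin.univ_val_map, List.ofFn_get]; rfl⟩
  refine ⟨l, fun z => ?_⟩
  rw [← Matrix.eval_charpoly, (IsAlgClosed.splits X.charpoly).eval_eq_prod_roots_of_monic
    (Matrix.charpoly_monic X), ← hl, Multiset.map_map]
  rfl

/-- Along a convergent sequence of matrices the eigenvalue lists stay bounded, and a subsequential
limit lists the eigenvalues of the limit matrix. No continuous labelling of eigenvalues is needed.
-/
theorem continuous_eigenvalueSum {f : ℂ → ℝ} (hf : Continuous f) :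
    Continuous fun X : Matrix (Fin N) (Fin N) ℂ => eigenvalueSum X f := by
  have : SequentialSpace (Matrix (Fin N) (Fin N) ℂ) :=
    inferInstanceAs (SequentialSpace (Fin N → Fin N → ℂ))
  choose l hl using exists_isEigenvalueList (N := N)
  refine continuous_iff_isClosed.2 fun C hC => IsSeqClosed.isClosed fun Xs X hXs hX => ?_
  have hb : ∃ R, ∀ n i, ‖l (Xs n) i‖ ≤ R := by
    have hc : Continuous fun X : Matrix (Fin N) (Fin N) ℂ => ∑ i, ∑ j, ‖X i j‖ := by fun_prop
    obtain ⟨R, hR⟩ := ((hc.tendsto X).comp hX).bddAbove_range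
    refine ⟨R, fun n i => le_trans (norm_le_sum_norm_of_mem_roots_charpoly (Xs n) ?_)
      (hR ⟨n, rfl⟩)⟩
    rw [(hl (Xs n)).roots_eq]
    exact Multiset.mem_map_of_mem _ (Finset.mem_univ i)
  obtain ⟨R, hR⟩ := hb
  have hR0 : 0 ≤ max R 0 := le_max_right _ _
  obtain ⟨a, -, φ, hφ, ha⟩ := tendsto_subseq_of_bounded
    (Metric.isBounded_closedBall (x := (0 : Fin N → ℂ)) (r := max R 0))
    (x := fun n => l (Xs n)) (fun n => by
      rw [mem_closedBall_zero_iff, pi_norm_le_iff_of_nonneg hR0]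
      exact fun i => (hR n i).trans (le_max_left _ _))
  have hXφ : Tendsto (fun n => Xs (φ n)) atTop (𝓝 X) := hX.comp hφ.tendsto_atTop
  have haX : IsEigenvalueList X a := by
    intro z
    have h1 : Continuous fun X : Matrix (Fin N) (Fin N) ℂ => (Matrix.scalar (Fin N) z - X).det :=
      (continuous_const.sub continuous_id).matrix_det
    have h2 : Continuous fun l : Fin N → ℂ => ∏ i, (z - l i) := by fun_prop
    refine tendsto_nhds_unique ((h1.tendsto X).comp hXφ) ?_
    refine ((h2.tendsto a).comp ha).congr fun n => ?_
    exact (hl (Xs (φ n)) z).symm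
  have h3 : Continuous fun l : Fin N → ℂ => ∑ i, f (l i) := by fun_prop
  have h4 := (h3.tendsto a).comp ha
  change eigenvalueSum X f ∈ C
  rw [haX.eigenvalueSum_eq f]
  refine hC.mem_of_tendsto h4 (Eventually.of_forall fun n => ?_)
  have h5 : eigenvalueSum (Xs (φ n)) f ∈ C := hXs (φ n)
  rwa [(hl (Xs (φ n))).eigenvalueSum_eq f] at h5

end Continuity

/-! ### The mean eigenvalue sum as an integral over eigenvalues and eigenvectors -/

section JointDensity

open Complex ComplexConjugate Matrix

variable {m : ℕ}

theorem measurable_chartDensity {N : ℕ} (τ : ℝ) :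
    Measurable fun p : ℂ × (Fin N → ℂ) => chartDensity τ p.1 p.2 := by
  have h1 : Measurable (vnorm : (Fin N → ℂ) → ℝ) := by
    have := continuous_normSq
    exact Continuous.measurable (by unfold vnorm; fun_prop)
  have h2 : Measurable (vsq : (Fin N → ℂ) → ℂ) := by
    exact Continuous.measurable (by unfold vsq; fun_prop)
  have h3 : Measurable normSq := continuous_normSq.measurable
  have h4 : Measurable (vdisc τ : (Fin N → ℂ) → ℝ) := by
    unfold vdisc; fun_prop
  have h5 : Measurable (reducedMean τ : (Fin N → ℂ) → ℝ) := by
    unfold reducedMean; fun_prop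
  have h6 : Measurable (reducedVar τ : (Fin N → ℂ) → ℝ) := by
    unfold reducedVar; fun_prop
  have h7 : ∀ n, Measurable (ginibreMoment n) := fun n => by
    exact Continuous.measurable (by unfold ginibreMoment truncExp; fun_prop)
  have h8 : Measurable (fun z : ℂ => conj z) := continuous_conj.measurable
  have h9 := h7 (N - 1)
  have h10 := h7 (N - 2)
  have h11 := measurable_re
  have h12 := measurable_ofReal
  unfold chartDensity reducedMoment
  fun_prop

theorem measurable_normSq_det_chartJacobian :
    Measurable fun p : (Fin (m + 1) → ℂ) × (Fin (m + 1) → Fin m → ℂ) =>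
      ENNReal.ofReal (normSq (chartJacobian (p.1 0) (Fin.tail p.1) p.2).det) := by
  refine Measurable.ennreal_ofReal (Continuous.measurable ?_)
  refine continuous_normSq.comp (Continuous.matrix_det ?_)
  refine continuous_pi fun j => continuous_pi fun k => ?_
  unfold chartJacobian
  refine Fin.cases ?_ (fun k => ?_) k
  · simp only [Matrix.of_apply, Fin.cons_zero]
    refine Fin.cases ?_ (fun j => ?_) j
    · simp only [Fin.cons_zero]; fun_prop
    · simp only [Fin.cons_succ, Fin.tail]; fun_prop
  · simp only [Matrix.of_apply, Fin.cons_succ]; fun_prop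

/-- The density of the matrix with last columns `Y`, eigenvalue `u 0` and eigenvector
`(1, u 1, …, u m)`. -/
def chartMatrixDensity (τ : ℝ) (u : Fin (m + 1) → ℂ) (Y : Fin (m + 1) → Fin m → ℂ) : ℝ :=
  matrixDensity τ (chartMatrix (Fin.tail u)
    (fun j => u 0 * (Fin.cons 1 (Fin.tail u) : Fin (m + 1) → ℂ) j) Y)

theorem measurable_chartMatrixDensity (τ : ℝ) :
    Measurable fun p : (Fin (m + 1) → ℂ) × (Fin (m + 1) → Fin m → ℂ) =>
      ENNReal.ofReal (chartMatrixDensity τ p.1 p.2) := by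
  refine Measurable.ennreal_ofReal (Continuous.measurable ?_)
  unfold chartMatrixDensity
  refine (continuous_matrixDensity τ).comp (continuous_chartMatrix.comp
    (Continuous.prodMk ?_ (Continuous.prodMk ?_ continuous_snd)))
  · exact continuous_pi fun k => (continuous_apply _).comp continuous_fst
  · refine continuous_pi fun j => ?_
    refine Fin.cases ?_ (fun j => ?_) j
    · simp only [Fin.cons_zero]; fun_prop
    · simp only [Fin.cons_succ, Fin.tail]; fun_prop

/-- The area formula for fixed `Y`. The matrix density is constant on a fibre of `chartMap Y`, so
the sum over the fibre is the eigenvalue sum times that density. -/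
theorem lintegral_firstColumn {Y : Fin (m + 1) → Fin m → ℂ} (hY : IsGenericChart Y) (τ : ℝ)
    {f : ℂ → ℝ} (hf : Measurable f) (hf0 : ∀ z, 0 ≤ f z) :
    ∫⁻ x : Fin (m + 1) → ℂ, ENNReal.ofReal (matrixDensity τ fun j => Fin.cons (x j) (Y j)) *
        ENNReal.ofReal (eigenvalueSum (Matrix.of fun j =>
          (Fin.cons (x j) (Y j) : Fin (m + 1) → ℂ)) f) =
      ∫⁻ u : Fin (m + 1) → ℂ,
        ENNReal.ofReal (normSq (chartJacobian (u 0) (Fin.tail u) Y).det) *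
        (ENNReal.ofReal (f (u 0)) * ENNReal.ofReal (chartMatrixDensity τ u Y)) := by
  have h1 : Measurable fun u : Fin (m + 1) → ℂ => ENNReal.ofReal (f (u 0)) :=
    (hf.comp (measurable_pi_apply 0)).ennreal_ofReal
  have h2 : Measurable fun u : Fin (m + 1) → ℂ => ENNReal.ofReal (chartMatrixDensity τ u Y) := by
    have := (measurable_chartMatrixDensity (m := m) τ).comp
      (measurable_id.prodMk (measurable_const (a := Y)))
    simpa only [Function.comp_def, id] using this
  rw [lintegral_normSq_chartJacobian_mul Y
    (fun u => ENNReal.ofReal (f (u 0)) * ENNReal.ofReal (chartMatrixDensity τ u Y)) (h1.mul h2)]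
  refine lintegral_congr_ae ?_
  filter_upwards [ae_chartJacobian_det_ne_zero Y] with x hx
  rw [mul_comm, ← tsum_chartMap_preimage Y hY x hx f hf0]
  refine tsum_congr fun u => ?_
  by_cases hu : u ∈ chartMap Y ⁻¹' {x}
  · rw [Set.indicator_of_mem hu, Set.indicator_of_mem hu, chartMatrixDensity,
      chartMatrix_eq_cons_chartMap, show chartMap Y u = x from hu]
  · rw [Set.indicator_of_notMem hu, Set.indicator_of_notMem hu]

theorem lintegral_eigenvalueSum_matrixLaw_eq_lintegral_pi {τ : ℝ} (hτ : |τ| < 1) (hm : 1 ≤ m)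
    {f : ℂ → ℝ} (hf : Continuous f) (hf0 : ∀ z, 0 ≤ f z) :
    ∫⁻ X, ENNReal.ofReal (eigenvalueSum (Matrix.of X) f) ∂matrixLaw (m + 1) τ =
      ∫⁻ u : Fin (m + 1) → ℂ, ENNReal.ofReal (f (u 0)) *
        ENNReal.ofReal (chartDensity τ (u 0) (Fin.cons 1 (Fin.tail u) : Fin (m + 1) → ℂ)) := by
  have hE : Measurable fun X : Fin (m + 1) → Fin (m + 1) → ℂ =>
      ENNReal.ofReal (eigenvalueSum (Matrix.of X) f) := by
    have h : Continuous fun X : Fin (m + 1) → Fin (m + 1) → ℂ => eigenvalueSum (Matrix.of X) f :=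
      continuous_eigenvalueSum (N := m + 1) hf
    exact h.measurable.ennreal_ofReal
  have hD := (continuous_matrixDensity (N := m + 1) τ).measurable.ennreal_ofReal
  have hG : Measurable fun p : (Fin (m + 1) → Fin m → ℂ) × (Fin (m + 1) → ℂ) =>
      ENNReal.ofReal (normSq (chartJacobian (p.2 0) (Fin.tail p.2) p.1).det) *
        (ENNReal.ofReal (f (p.2 0)) * ENNReal.ofReal (chartMatrixDensity τ p.2 p.1)) := by
    have h1 := (measurable_normSq_det_chartJacobian (m := m)).comp measurable_swap
    have h2 := (measurable_chartMatrixDensity (m := m) τ).comp measurable_swap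
    have h3 : Measurable fun p : (Fin (m + 1) → Fin m → ℂ) × (Fin (m + 1) → ℂ) =>
      ENNReal.ofReal (f (p.2 0)) :=
      (hf.measurable.comp ((measurable_pi_apply 0).comp measurable_snd)).ennreal_ofReal
    exact h1.mul (h3.mul h2)
  rw [lintegral_matrixLaw _ hτ hE, lintegral_matrix_eq_lintegral_cons
    (fun X => ENNReal.ofReal (matrixDensity τ X) * ENNReal.ofReal (eigenvalueSum (Matrix.of X) f))
    (hD.mul hE)]
  have h1 := (ae_isGenericChart (m := m)).mono fun Y hY =>
    lintegral_firstColumn hY τ hf.measurable hf0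
  rw [lintegral_congr_ae h1, lintegral_lintegral_swap hG.aemeasurable]
  have hz : ∀ᵐ u : Fin (m + 1) → ℂ, u 0 ≠ 0 := by
    have h := Measure.quasiMeasurePreserving_eval (μ := fun _ : Fin (m + 1) => (volume : Measure ℂ)) 0
    exact h.ae (Measure.ae_ne volume 0)
  have h2 : ∀ᵐ u : Fin (m + 1) → ℂ, ∫⁻ Y : Fin (m + 1) → Fin m → ℂ,
        ENNReal.ofReal (normSq (chartJacobian (u 0) (Fin.tail u) Y).det) *
        (ENNReal.ofReal (f (u 0)) * ENNReal.ofReal (chartMatrixDensity τ u Y)) =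
      ENNReal.ofReal (f (u 0)) *
        ENNReal.ofReal (chartDensity τ (u 0) (Fin.cons 1 (Fin.tail u) : Fin (m + 1) → ℂ)) := by
    filter_upwards [hz] with u hu
    rw [← lintegral_chartJacobian hτ hm hu (Fin.tail u), ← lintegral_const_mul']
    · exact lintegral_congr fun Y => by rw [chartMatrixDensity]; ring
    · exact ENNReal.ofReal_ne_top
  exact lintegral_congr_ae h2

theorem lintegral_eigenvalueSum_matrixLaw {τ : ℝ} (hτ : |τ| < 1) (hm : 1 ≤ m) {f : ℂ → ℝ}
    (hf : Continuous f) (hf0 : ∀ z, 0 ≤ f z) :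
    ∫⁻ X, ENNReal.ofReal (eigenvalueSum (Matrix.of X) f) ∂matrixLaw (m + 1) τ =
      ∫⁻ z, ENNReal.ofReal (f z) *
        ∫⁻ w : Fin m → ℂ, ENNReal.ofReal (chartDensity τ z (Fin.cons 1 w : Fin (m + 1) → ℂ)) := by
  have hfm : Measurable fun z => ENNReal.ofReal (f z) := hf.measurable.ennreal_ofReal
  rw [lintegral_eigenvalueSum_matrixLaw_eq_lintegral_pi hτ hm hf hf0]
  have hp := (volume_preserving_piFinSuccAbove (fun _ : Fin (m + 1) => ℂ) 0).symm
  rw [hp.lintegral_map_equiv _ _]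
  have hc : ∀ a : ℂ × (Fin m → ℂ),
      (MeasurableEquiv.piFinSuccAbove (fun _ : Fin (m + 1) => ℂ) 0).symm a = Fin.cons a.1 a.2 :=
    fun a => Fin.insertNth_zero' a.1 a.2
  simp only [hc, Fin.cons_zero, Fin.tail_cons]
  have hcc : Measurable fun a : ℂ × (Fin m → ℂ) =>
      chartDensity τ a.1 (Fin.cons 1 a.2 : Fin (m + 1) → ℂ) := by
    have hv : Measurable fun a : ℂ × (Fin m → ℂ) => (a.1, (Fin.cons 1 a.2 : Fin (m + 1) → ℂ)) := by
      refine measurable_fst.prodMk (measurable_pi_lambda _ fun k => ?_)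
      refine Fin.cases ?_ (fun k => ?_) k
      · simp only [Fin.cons_zero]; fun_prop
      · simp only [Fin.cons_succ]; fun_prop
    have := (measurable_chartDensity (N := m + 1) τ).comp hv
    simpa only [Function.comp_def] using this
  change ∫⁻ a : ℂ × (Fin m → ℂ), ENNReal.ofReal (f a.1) * ENNReal.ofReal
    (chartDensity τ a.1 (Fin.cons 1 a.2 : Fin (m + 1) → ℂ)) ∂(volume.prod volume) = _
  have hff : Measurable fun a : ℂ × (Fin m → ℂ) => ENNReal.ofReal (f a.1) :=
    hfm.comp measurable_fst
  rw [lintegral_prod (fun a : ℂ × (Fin m → ℂ) => ENNReal.ofReal (f a.1) * ENNReal.ofReal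
    (chartDensity τ a.1 (Fin.cons 1 a.2 : Fin (m + 1) → ℂ)))
    (hff.mul hcc.ennreal_ofReal).aemeasurable]
  refine lintegral_congr fun z => ?_
  exact lintegral_const_mul' (ENNReal.ofReal (f z)) (fun w : Fin m → ℂ =>
    ENNReal.ofReal (chartDensity τ z (Fin.cons 1 w : Fin (m + 1) → ℂ))) ENNReal.ofReal_ne_top

end JointDensity

/-! ### Linear changes of variables and polar coordinates -/

section Scaling

open Complex

theorem lintegral_comp_linearEquiv {E : Type*} [NormedAddCommGroup E] [NormedSpace ℝ E]
    [FiniteDimensional ℝ E] [MeasurableSpace E] [BorelSpace E] (μ : Measure E)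
    [μ.IsAddHaarMeasure] (L : E ≃ₗ[ℝ] E) (g : E → ENNReal) :
    ∫⁻ x, g x ∂μ = ENNReal.ofReal |LinearMap.det (L : E →ₗ[ℝ] E)| * ∫⁻ x, g (L x) ∂μ := by
  have h := lintegral_image_eq_lintegral_abs_det_fderiv_mul μ MeasurableSet.univ
    (f := L) (f' := fun _ => (L.toContinuousLinearEquiv : E →L[ℝ] E))
    (fun x _ => (L.toContinuousLinearEquiv.hasFDerivAt).hasFDerivWithinAt) L.injective.injOn g
  rw [Set.image_univ, L.surjective.range_eq, Measure.restrict_univ] at h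
  rw [h, lintegral_const_mul' _ _ ENNReal.ofReal_ne_top]
  rfl

theorem lintegral_comp_smul_real {E : Type*} [NormedAddCommGroup E] [NormedSpace ℝ E]
    [FiniteDimensional ℝ E] [MeasurableSpace E] [BorelSpace E] (μ : Measure E)
    [μ.IsAddHaarMeasure] {r : ℝ} (hr : 0 < r) (g : E → ENNReal) :
    ∫⁻ x, g x ∂μ = ENNReal.ofReal (r ^ Module.finrank ℝ E) * ∫⁻ x, g (r • x) ∂μ := by
  have h := lintegral_comp_linearEquiv μ (LinearEquiv.smulOfNeZero ℝ E r hr.ne') g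
  have hd : LinearMap.det ((LinearEquiv.smulOfNeZero ℝ E r hr.ne' : E ≃ₗ[ℝ] E) : E →ₗ[ℝ] E) =
      r ^ Module.finrank ℝ E := by
    have : ((LinearEquiv.smulOfNeZero ℝ E r hr.ne' : E ≃ₗ[ℝ] E) : E →ₗ[ℝ] E) =
      r • LinearMap.id := rfl
    rw [this, LinearMap.det_smul, LinearMap.det_id, mul_one]
  rw [hd, abs_of_pos (pow_pos hr _)] at h
  exact h

theorem lintegral_comp_smul_complex {m : ℕ} {c : ℂ} (hc : c ≠ 0) (g : (Fin m → ℂ) → ENNReal) :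
    ∫⁻ w, g w = ENNReal.ofReal (normSq c ^ m) * ∫⁻ w, g (c • w) := by
  have h := lintegral_comp_linearEquiv (volume : Measure (Fin m → ℂ))
    ((LinearEquiv.smulOfNeZero ℂ (Fin m → ℂ) c hc).restrictScalars ℝ) g
  have hd : LinearMap.det (((LinearEquiv.smulOfNeZero ℂ (Fin m → ℂ) c hc).restrictScalars ℝ :
      (Fin m → ℂ) ≃ₗ[ℝ] (Fin m → ℂ)) : (Fin m → ℂ) →ₗ[ℝ] (Fin m → ℂ)) = normSq c ^ m := by
    have : (((LinearEquiv.smulOfNeZero ℂ (Fin m → ℂ) c hc).restrictScalars ℝ :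
      (Fin m → ℂ) ≃ₗ[ℝ] (Fin m → ℂ)) : (Fin m → ℂ) →ₗ[ℝ] (Fin m → ℂ)) =
      (c • (LinearMap.id : (Fin m → ℂ) →ₗ[ℂ] (Fin m → ℂ))).restrictScalars ℝ := rfl
    rw [this, LinearMap.det_restrictScalars, LinearMap.det_smul, LinearMap.det_id, mul_one,
      Algebra.norm_complex_apply, map_pow, Module.finrank_fin_fun]
  rw [hd, abs_of_nonneg (pow_nonneg (normSq_nonneg _) _)] at h
  exact h

theorem lintegral_fun_norm {E : Type*} [NormedAddCommGroup E] [NormedSpace ℝ E]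
    [FiniteDimensional ℝ E] [MeasurableSpace E] [BorelSpace E] [Nontrivial E] (μ : Measure E)
    [μ.IsAddHaarMeasure] {f : ℝ → ENNReal} (hf : Measurable f) :
    ∫⁻ x, f ‖x‖ ∂μ = μ.toSphere Set.univ *
      ∫⁻ r in Set.Ioi (0 : ℝ), ENNReal.ofReal (r ^ (Module.finrank ℝ E - 1)) * f r := by
  have h1 : ∫⁻ x, f ‖x‖ ∂μ = ∫⁻ x : ({(0)}ᶜ : Set E), f ‖x.1‖ ∂(μ.comap (↑)) := by
    rw [lintegral_subtype_comap (measurableSet_singleton _).compl fun x => f ‖x‖,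
      restrict_compl_singleton]
  have h2 : ∫⁻ x : ({(0)}ᶜ : Set E), f ‖x.1‖ ∂(μ.comap (↑)) =
      ∫⁻ x, f x.2 ∂μ.toSphere.prod (.volumeIoiPow (Module.finrank ℝ E - 1)) := by
    have := μ.measurePreserving_homeomorphUnitSphereProd.lintegral_comp_emb
        (Homeomorph.measurableEmbedding _) (f ∘ Subtype.val ∘ Prod.snd)
    simpa using this
  have hf' : Measurable fun x : Set.Ioi (0 : ℝ) => f x := hf.comp measurable_subtype_coe
  rw [h1, h2, lintegral_prod (fun x : Metric.sphere (0 : E) 1 × Set.Ioi (0 : ℝ) => f x.2)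
    (hf'.comp measurable_snd).aemeasurable]
  simp only [lintegral_const]
  rw [mul_comm]
  congr 1
  rw [Measure.volumeIoiPow, lintegral_withDensity_eq_lintegral_mul _ (by fun_prop) hf']
  exact lintegral_subtype_comap measurableSet_Ioi
    fun r => ENNReal.ofReal (r ^ (Module.finrank ℝ E - 1)) * f r

end Scaling

/-! ### From the projective chart to Gaussian vectors -/

section Projective

open Complex

variable {m : ℕ}

/-- `1 - |vᵀ v|² / |v|⁴`, the squared normalised area spanned by the real and the imaginary part
of `v`. -/
def gramRatio {N : ℕ} (v : Fin N → ℂ) : ℝ := 1 - normSq (vsq v) / vnorm v ^ 2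

theorem vnorm_smul {N : ℕ} (c : ℂ) (v : Fin N → ℂ) : vnorm (c • v) = normSq c * vnorm v := by
  simp only [vnorm, Pi.smul_apply, smul_eq_mul, normSq_mul, Finset.mul_sum]

theorem vsq_smul {N : ℕ} (c : ℂ) (v : Fin N → ℂ) : vsq (c • v) = c ^ 2 * vsq v := by
  simp only [vsq, Pi.smul_apply, smul_eq_mul, Finset.mul_sum]
  exact Finset.sum_congr rfl fun _ _ => by ring

theorem gramRatio_smul {N : ℕ} {c : ℂ} (hc : c ≠ 0) (v : Fin N → ℂ) :
    gramRatio (c • v) = gramRatio v := by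
  have h := (normSq_pos.2 hc).ne'
  rw [gramRatio, gramRatio, vnorm_smul, vsq_smul, normSq_mul, map_pow, mul_pow,
    mul_div_mul_left _ _ (pow_ne_zero 2 h)]

theorem continuous_vnorm {N : ℕ} : Continuous (vnorm : (Fin N → ℂ) → ℝ) := by
  have := continuous_normSq
  unfold vnorm; fun_prop

theorem measurable_gramRatio {N : ℕ} : Measurable (gramRatio : (Fin N → ℂ) → ℝ) := by
  have h1 := (continuous_vnorm (N := N)).measurable
  have h2 : Measurable fun v : Fin N → ℂ => normSq (vsq v) :=
    (continuous_normSq.comp (by unfold vsq; fun_prop)).measurable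
  unfold gramRatio; fun_prop

theorem lintegral_normSq_pow_mul_exp (m : ℕ) {b : ℝ} (hb : 0 < b) :
    ∫⁻ c : ℂ, ENNReal.ofReal (normSq c ^ m * Real.exp (-(normSq c * b))) =
      ENNReal.ofReal (Real.pi * m.factorial * (b ^ (m + 1))⁻¹) := by
  have h := Complex.integral_rpow_mul_exp_neg_mul_rpow (p := 2) (q := 2 * m) one_le_two
    (by have : (0 : ℝ) ≤ m := Nat.cast_nonneg m
        linarith) hb
  have he : ∀ c : ℂ, ‖c‖ ^ (2 * m : ℝ) * Real.exp (-b * ‖c‖ ^ (2 : ℝ)) =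
      normSq c ^ m * Real.exp (-(normSq c * b)) := by
    intro c
    rw [Real.rpow_mul (norm_nonneg _), Real.rpow_two, Real.rpow_natCast, ← normSq_eq_norm_sq]
    congr 2; ring
  have hr : (2 * Real.pi / 2) * b ^ (-(2 * m + 2 : ℝ) / 2) * Real.Gamma ((2 * m + 2 : ℝ) / 2) =
      Real.pi * m.factorial * (b ^ (m + 1))⁻¹ := by
    have e1 : -(2 * m + 2 : ℝ) / 2 = -((m + 1 : ℕ) : ℝ) := by push_cast; ring
    have e2 : (2 * m + 2 : ℝ) / 2 = m + 1 := by ring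
    rw [e1, e2, Real.Gamma_nat_eq_factorial, Real.rpow_neg hb.le, Real.rpow_natCast]
    ring
  simp only [he] at h
  rw [hr] at h
  have hpos : 0 < Real.pi * m.factorial * (b ^ (m + 1))⁻¹ := by positivity
  have hi : Integrable fun c : ℂ => normSq c ^ m * Real.exp (-(normSq c * b)) := by
    by_contra hn
    rw [integral_undef hn] at h
    exact hpos.ne h
  rw [← h, ofReal_integral_eq_lintegral_ofReal hi]
  exact Eventually.of_forall fun c => mul_nonneg (pow_nonneg (normSq_nonneg _) _) (Real.exp_nonneg _)

/-- In coordinates `v = c (1, w)`, with Jacobian `|c| ^ (2 m)`, the Gram ratio does not involve `c`,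
which integrates out to `π m! / vnorm (1, w) ^ (m + 1)`. -/
theorem lintegral_exp_neg_vnorm_mul {φ : ℝ → ENNReal} (hφ : Measurable φ) :
    ∫⁻ v : Fin (m + 1) → ℂ, ENNReal.ofReal (Real.exp (-vnorm v)) * φ (gramRatio v) =
      ENNReal.ofReal (Real.pi * m.factorial) * ∫⁻ w : Fin m → ℂ,
        ENNReal.ofReal ((vnorm (Fin.cons 1 w : Fin (m + 1) → ℂ) ^ (m + 1))⁻¹) *
          φ (gramRatio (Fin.cons 1 w : Fin (m + 1) → ℂ)) := by
  have hp := (volume_preserving_piFinSuccAbove (fun _ : Fin (m + 1) => ℂ) 0).symm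
  rw [hp.lintegral_map_equiv _ _]
  have hc : ∀ a : ℂ × (Fin m → ℂ),
      (MeasurableEquiv.piFinSuccAbove (fun _ : Fin (m + 1) => ℂ) 0).symm a = Fin.cons a.1 a.2 :=
    fun a => Fin.insertNth_zero' a.1 a.2
  simp only [hc]
  have hcons : Measurable fun a : ℂ × (Fin m → ℂ) => (Fin.cons a.1 a.2 : Fin (m + 1) → ℂ) := by
    refine measurable_pi_lambda _ fun k => ?_
    refine Fin.cases ?_ (fun k => ?_) k
    · simp only [Fin.cons_zero]; fun_prop
    · simp only [Fin.cons_succ]; fun_prop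
  have hcons1 : Measurable fun w : Fin m → ℂ => (Fin.cons 1 w : Fin (m + 1) → ℂ) :=
    hcons.comp (measurable_const.prodMk measurable_id)
  have hvn := (continuous_vnorm (N := m + 1)).measurable
  have hg := measurable_gramRatio (N := m + 1)
  have hF : Measurable fun a : ℂ × (Fin m → ℂ) =>
      ENNReal.ofReal (Real.exp (-vnorm (Fin.cons a.1 a.2 : Fin (m + 1) → ℂ))) *
        φ (gramRatio (Fin.cons a.1 a.2 : Fin (m + 1) → ℂ)) := by
    have h1 := hvn.comp hcons
    have h2 := hφ.comp (hg.comp hcons)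
    simp only [Function.comp_def] at h1 h2
    fun_prop
  change ∫⁻ a : ℂ × (Fin m → ℂ), _ ∂(volume.prod volume) = _
  rw [lintegral_prod (fun a : ℂ × (Fin m → ℂ) =>
      ENNReal.ofReal (Real.exp (-vnorm (Fin.cons a.1 a.2 : Fin (m + 1) → ℂ))) *
        φ (gramRatio (Fin.cons a.1 a.2 : Fin (m + 1) → ℂ))) hF.aemeasurable]
  have h1 : ∀ᵐ c : ℂ, ∫⁻ w : Fin m → ℂ,
      ENNReal.ofReal (Real.exp (-vnorm (Fin.cons c w : Fin (m + 1) → ℂ))) *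
        φ (gramRatio (Fin.cons c w : Fin (m + 1) → ℂ)) =
      ∫⁻ w : Fin m → ℂ, ENNReal.ofReal (normSq c ^ m *
        Real.exp (-(normSq c * vnorm (Fin.cons 1 w : Fin (m + 1) → ℂ)))) *
        φ (gramRatio (Fin.cons 1 w : Fin (m + 1) → ℂ)) := by
    filter_upwards [Measure.ae_ne volume 0] with c hc0
    rw [lintegral_comp_smul_complex hc0, ← lintegral_const_mul' _ _ ENNReal.ofReal_ne_top]
    refine lintegral_congr fun w => ?_
    have hcw : (Fin.cons c (c • w) : Fin (m + 1) → ℂ) = c • (Fin.cons 1 w : Fin (m + 1) → ℂ) := by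
      funext k
      refine Fin.cases ?_ (fun k => ?_) k <;> simp
    rw [hcw, vnorm_smul, gramRatio_smul hc0, ← mul_assoc,
      ← ENNReal.ofReal_mul (pow_nonneg (normSq_nonneg _) _)]
  rw [lintegral_congr_ae h1]
  have hn1 := hvn.comp hcons1
  have hn2 := hφ.comp (hg.comp hcons1)
  simp only [Function.comp_def] at hn1 hn2
  have hns : Measurable normSq := continuous_normSq.measurable
  rw [lintegral_lintegral_swap (by
    refine Measurable.aemeasurable ?_
    change Measurable fun p : ℂ × (Fin m → ℂ) => ENNReal.ofReal (normSq p.1 ^ m *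
        Real.exp (-(normSq p.1 * vnorm (Fin.cons 1 p.2 : Fin (m + 1) → ℂ)))) *
        φ (gramRatio (Fin.cons 1 p.2 : Fin (m + 1) → ℂ))
    have h3 := hn1.comp (measurable_snd : Measurable (Prod.snd : ℂ × (Fin m → ℂ) → _))
    have h4 := hn2.comp (measurable_snd : Measurable (Prod.snd : ℂ × (Fin m → ℂ) → _))
    simp only [Function.comp_def] at h3 h4
    fun_prop), ← lintegral_const_mul' _ _ ENNReal.ofReal_ne_top]
  refine lintegral_congr fun w => ?_
  have hw : 0 < vnorm (Fin.cons 1 w : Fin (m + 1) → ℂ) :=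
    vnorm_pos fun h0 => by simpa using congrFun h0 0
  rw [lintegral_mul_const _ (by fun_prop), lintegral_normSq_pow_mul_exp m hw, ← mul_assoc,
    ← ENNReal.ofReal_mul (by positivity)]

theorem lintegral_exp_neg_vnorm (N : ℕ) :
    ∫⁻ v : Fin N → ℂ, ENNReal.ofReal (Real.exp (-vnorm v)) = ENNReal.ofReal (Real.pi ^ N) := by
  have h1 : ∫⁻ c : ℂ, ENNReal.ofReal (Real.exp (-normSq c)) = ENNReal.ofReal Real.pi := by
    simpa using lintegral_normSq_pow_mul_exp 0 one_pos
  have h := lintegral_fin_prod_eq_prod (fun _ : Fin N => (volume : Measure ℂ))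
    (fun _ c => ENNReal.ofReal (Real.exp (-normSq c)))
    (fun _ => by have := continuous_normSq.measurable; fun_prop)
  simp only [h1, Finset.prod_const, Finset.card_univ, Fintype.card_fin] at h
  rw [ENNReal.ofReal_pow Real.pi_pos.le, ← h]
  change _ = ∫⁻ x : Fin N → ℂ, _
  refine lintegral_congr fun v => ?_
  rw [← ENNReal.ofReal_prod_of_nonneg fun _ _ => Real.exp_nonneg _, ← Real.exp_sum,
    Finset.sum_neg_distrib]
  rfl

end Projective

/-! ### Hyperbolic area as a function of distance -/

section Hyperbolic

/-- Passage to the hyperboloid: for `y = (ρ (1 + p²) - ρ⁻¹) / 2` one has `√(1 + p² + y²) = (ρ (1 +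
p²) + ρ⁻¹) / 2` and `dρ / ρ = dy / √(1 + p² + y²)`. -/
theorem lintegral_Ioi_inv_mul_comp (p : ℝ) (ψ : ℝ → ENNReal) :
    ∫⁻ ρ in Set.Ioi (0 : ℝ), ENNReal.ofReal ρ⁻¹ * ψ ((1 + (ρ * p) ^ 2 + ρ ^ 2) / (2 * ρ)) =
      ∫⁻ y : ℝ, ENNReal.ofReal (Real.sqrt (1 + p ^ 2 + y ^ 2))⁻¹ *
        ψ (Real.sqrt (1 + p ^ 2 + y ^ 2)) := by
  set h : ℝ → ℝ := fun ρ => (ρ * (1 + p ^ 2) - ρ⁻¹) / 2 with hh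
  have hp : 0 < 1 + p ^ 2 := by positivity
  have hsq : ∀ ρ, 0 < ρ → Real.sqrt (1 + p ^ 2 + h ρ ^ 2) = (ρ * (1 + p ^ 2) + ρ⁻¹) / 2 := by
    intro ρ hρ
    rw [Real.sqrt_eq_iff_mul_self_eq (by positivity) (by positivity), hh]
    field_simp
    ring
  have himg : h '' Set.Ioi 0 = Set.univ := by
    refine Set.eq_univ_of_forall fun y => ?_
    have hs : Real.sqrt (y ^ 2 + (1 + p ^ 2)) ^ 2 = y ^ 2 + (1 + p ^ 2) := Real.sq_sqrt (by positivity)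
    set s := Real.sqrt (y ^ 2 + (1 + p ^ 2)) with hs'
    have hs0 : 0 ≤ s := Real.sqrt_nonneg _
    have hpos : 0 < y + s := by
      by_contra! hle
      nlinarith
    refine ⟨(y + s) / (1 + p ^ 2), by simp only [Set.mem_Ioi]; positivity, ?_⟩
    simp only [hh]
    field_simp
    nlinarith
  have hder : ∀ ρ ∈ Set.Ioi (0 : ℝ),
      HasDerivWithinAt h ((1 * (1 + p ^ 2) - -(ρ ^ 2)⁻¹) / 2) (Set.Ioi 0) ρ := by
    intro ρ hρ
    exact ((((hasDerivAt_id ρ).mul_const (1 + p ^ 2)).sub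
      (hasDerivAt_inv (ne_of_gt hρ))).div_const 2).hasDerivWithinAt
  have hinj : Set.InjOn h (Set.Ioi 0) := by
    intro a ha b hb hab
    have ha' : 0 < a := ha
    have hb' : 0 < b := hb
    simp only [hh] at hab
    field_simp at hab
    have : (a - b) * (a * b * (1 + p ^ 2) + 1) = 0 := by linear_combination hab
    rcases mul_eq_zero.1 this with h0 | h0
    · linarith
    · have : 0 < a * b * (1 + p ^ 2) + 1 := by positivity
      linarith
  have key := lintegral_image_eq_lintegral_abs_deriv_mul measurableSet_Ioi hder hinj
    (fun y => ENNReal.ofReal (Real.sqrt (1 + p ^ 2 + y ^ 2))⁻¹ *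
        ψ (Real.sqrt (1 + p ^ 2 + y ^ 2)))
  rw [himg, Measure.restrict_univ] at key
  rw [key]
  refine setLIntegral_congr_fun measurableSet_Ioi fun ρ hρ => ?_
  have hρ' : 0 < ρ := hρ
  simp only [hsq ρ hρ']
  rw [← mul_assoc, ← ENNReal.ofReal_mul (abs_nonneg _), abs_of_pos (by
    rw [one_mul, sub_neg_eq_add]; positivity)]
  congr 2
  · field_simp
    ring
  · field_simp
    ring

theorem lintegral_sqrt_one_add_sq {ψ : ℝ → ENNReal} (hψ : Measurable ψ) :
    ∫⁻ p : ℝ, ∫⁻ y : ℝ, ENNReal.ofReal (Real.sqrt (1 + p ^ 2 + y ^ 2))⁻¹ *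
        ψ (Real.sqrt (1 + p ^ 2 + y ^ 2)) =
      ENNReal.ofReal (2 * Real.pi) * ∫⁻ t in Set.Ioi (1 : ℝ), ψ t := by
  have hm : Measurable fun q : ℝ × ℝ => ENNReal.ofReal (Real.sqrt (1 + q.1 ^ 2 + q.2 ^ 2))⁻¹ *
        ψ (Real.sqrt (1 + q.1 ^ 2 + q.2 ^ 2)) := by fun_prop
  have h1 := lintegral_prod _ (hm.aemeasurable (μ := volume.prod volume))
  rw [← h1]
  change ∫⁻ q : ℝ × ℝ, _ = _
  rw [← lintegral_comp_polarCoord_symm]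
  have h2 : ∀ q ∈ polarCoord.target, ENNReal.ofReal q.1 • (ENNReal.ofReal
      (Real.sqrt (1 + (polarCoord.symm q).1 ^ 2 + (polarCoord.symm q).2 ^ 2))⁻¹ *
        ψ (Real.sqrt (1 + (polarCoord.symm q).1 ^ 2 + (polarCoord.symm q).2 ^ 2))) =
      ENNReal.ofReal (q.1 / Real.sqrt (1 + q.1 ^ 2)) * ψ (Real.sqrt (1 + q.1 ^ 2)) := by
    intro q hq
    have hq0 : 0 < q.1 := hq.1
    have : 1 + (polarCoord.symm q).1 ^ 2 + (polarCoord.symm q).2 ^ 2 = 1 + q.1 ^ 2 := by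
      simp only [polarCoord_symm_apply]
      linear_combination q.1 ^ 2 * Real.cos_sq_add_sin_sq q.2
    rw [this, smul_eq_mul, ← mul_assoc, ← ENNReal.ofReal_mul hq0.le, div_eq_mul_inv]
  rw [setLIntegral_congr_fun polarCoord.open_target.measurableSet h2, polarCoord_target,
    Measure.volume_eq_prod, ← Measure.prod_restrict]
  have hm2 : Measurable fun r : ℝ => ENNReal.ofReal (r / Real.sqrt (1 + r ^ 2)) *
      ψ (Real.sqrt (1 + r ^ 2)) := by fun_prop
  rw [lintegral_prod (fun q : ℝ × ℝ => ENNReal.ofReal (q.1 / Real.sqrt (1 + q.1 ^ 2)) *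
      ψ (Real.sqrt (1 + q.1 ^ 2))) (hm2.comp measurable_fst).aemeasurable]
  simp only [lintegral_const, Measure.restrict_apply MeasurableSet.univ, Set.univ_inter,
    Real.volume_Ioo]
  rw [lintegral_mul_const _ hm2, mul_comm, show Real.pi - -Real.pi = 2 * Real.pi by ring]
  congr 1
  have hder : ∀ r ∈ Set.Ioi (0 : ℝ), HasDerivWithinAt (fun r => Real.sqrt (1 + r ^ 2))
      (r / Real.sqrt (1 + r ^ 2)) (Set.Ioi 0) r := by
    intro r _
    have h : HasDerivAt (fun r : ℝ => 1 + r ^ 2) (2 * r) r := by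
      simpa using (hasDerivAt_pow 2 r).const_add 1
    refine ((h.sqrt (by positivity)).congr_deriv ?_).hasDerivWithinAt
    rw [mul_div_mul_left _ _ two_ne_zero]
  have hinj : Set.InjOn (fun r : ℝ => Real.sqrt (1 + r ^ 2)) (Set.Ioi 0) := by
    intro a ha b hb hab
    have h := (Real.sqrt_inj (by positivity) (by positivity)).1 hab
    exact (sq_eq_sq₀ (le_of_lt ha) (le_of_lt hb)).1 (by linarith)
  have himg : (fun r : ℝ => Real.sqrt (1 + r ^ 2)) '' Set.Ioi 0 = Set.Ioi 1 := by
    ext t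
    constructor
    · rintro ⟨r, hr, rfl⟩
      have : 0 < r := hr
      exact Real.lt_sqrt_of_sq_lt (by nlinarith)
    · intro ht
      have ht' : 1 < t := ht
      refine ⟨Real.sqrt (t ^ 2 - 1), Real.sqrt_pos.2 (by nlinarith), ?_⟩
      simp only
      rw [Real.sq_sqrt (by nlinarith), add_sub_cancel, Real.sqrt_sq (by linarith)]
  rw [← himg, lintegral_image_eq_lintegral_abs_deriv_mul measurableSet_Ioi hder hinj ψ]
  refine setLIntegral_congr_fun measurableSet_Ioi fun r hr => ?_
  have : 0 < r := hr
  rw [abs_of_pos (by positivity)]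

/-- `dx dρ / ρ²` is hyperbolic area and `(1 + x² + ρ²) / (2 ρ)` is the hyperbolic cosine of the
distance to `i`. Discs have area `2π (cosh R - 1)`, so the image measure is `2π dt`. The
substitution `x = ρ p` leads to hyperboloid coordinates. -/
theorem lintegral_upperHalfPlane {ψ : ℝ → ENNReal} (hψ : Measurable ψ) :
    ∫⁻ x : ℝ, ∫⁻ ρ in Set.Ioi (0 : ℝ), ENNReal.ofReal (ρ ^ 2)⁻¹ *
        ψ ((1 + x ^ 2 + ρ ^ 2) / (2 * ρ)) =
      ENNReal.ofReal (2 * Real.pi) * ∫⁻ t in Set.Ioi (1 : ℝ), ψ t := by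
  rw [← lintegral_sqrt_one_add_sq hψ, lintegral_lintegral_swap (by fun_prop)]
  have h1 : ∀ ρ ∈ Set.Ioi (0 : ℝ), ∫⁻ x : ℝ, ENNReal.ofReal (ρ ^ 2)⁻¹ *
        ψ ((1 + x ^ 2 + ρ ^ 2) / (2 * ρ)) =
      ∫⁻ p : ℝ, ENNReal.ofReal ρ⁻¹ * ψ ((1 + (ρ * p) ^ 2 + ρ ^ 2) / (2 * ρ)) := by
    intro ρ hρ
    have hρ' : 0 < ρ := hρ
    rw [lintegral_comp_smul_real volume hρ', ← lintegral_const_mul' _ _ ENNReal.ofReal_ne_top]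
    refine lintegral_congr fun p => ?_
    rw [← mul_assoc, ← ENNReal.ofReal_mul (by positivity), Module.finrank_self, smul_eq_mul]
    congr 2
    field_simp
  rw [setLIntegral_congr_fun measurableSet_Ioi h1, lintegral_lintegral_swap (by fun_prop)]
  exact lintegral_congr fun p => lintegral_Ioi_inv_mul_comp p ψ

end Hyperbolic

/-! ### The Gram ratio of a Gaussian vector -/

section GramLaw

open Complex

theorem lintegral_complex_pi_eq_lintegral_euclidean {N : ℕ} {g : (Fin N → ℂ) → ENNReal}
    (hg : Measurable g) :
    ∫⁻ v, g v = ∫⁻ b : EuclideanSpace ℝ (Fin N), ∫⁻ a : EuclideanSpace ℝ (Fin N),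
      g fun j => ⟨a j, b j⟩ := by
  have e1 := volume_measurePreserving_arrowProdEquivProdArrow ℝ ℝ (Fin N)
  have e2 : MeasurePreserving (MeasurableEquiv.piCongrRight fun _ : Fin N =>
      Complex.measurableEquivRealProd.symm) (volume : Measure (Fin N → ℝ × ℝ)) volume :=
    volume_preserving_pi fun _ => Complex.volume_preserving_equiv_real_prod.symm
  have e3 := PiLp.volume_preserving_ofLp (Fin N)
  have hm : Measurable fun q : (Fin N → ℝ) × (Fin N → ℝ) => g fun j => ⟨q.1 j, q.2 j⟩ := by
    refine hg.comp (measurable_pi_lambda _ fun j => ?_)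
    have : (fun q : (Fin N → ℝ) × (Fin N → ℝ) => (⟨q.1 j, q.2 j⟩ : ℂ)) = fun q =>
        ((q.1 j : ℝ) : ℂ) + ((q.2 j : ℝ) : ℂ) * I := by
      funext q
      exact (mk_eq_add_mul_I _ _)
    rw [this]
    fun_prop
  rw [e2.lintegral_map_equiv g _, e1.symm.lintegral_map_equiv _ _]
  change ∫⁻ q : (Fin N → ℝ) × (Fin N → ℝ), g (fun j => ⟨q.1 j, q.2 j⟩) ∂(volume.prod volume) = _
  rw [lintegral_prod_symm _ hm.aemeasurable, ← e3.lintegral_comp hm.lintegral_prod_left']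
  refine lintegral_congr fun b => ?_
  exact (e3.lintegral_comp (f := fun a => g fun j => ⟨a j, WithLp.ofLp b j⟩)
    (hm.comp measurable_prodMk_right)).symm

theorem lintegral_euclidean_succ {m : ℕ} {g : ℝ → ℝ → ENNReal}
    (hg : Measurable fun p : ℝ × ℝ => g p.1 p.2) :
    ∫⁻ a : EuclideanSpace ℝ (Fin (m + 1)), g (a 0) (‖a‖ ^ 2 - a 0 ^ 2) =
      ∫⁻ x : ℝ, ∫⁻ y : EuclideanSpace ℝ (Fin m), g x (‖y‖ ^ 2) := by
  have e3 := PiLp.volume_preserving_ofLp (Fin (m + 1))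
  have e4 := PiLp.volume_preserving_ofLp (Fin m)
  have hp := (volume_preserving_piFinSuccAbove (fun _ : Fin (m + 1) => ℝ) 0).symm
  have hc : ∀ a : ℝ × (Fin m → ℝ),
      (MeasurableEquiv.piFinSuccAbove (fun _ : Fin (m + 1) => ℝ) 0).symm a = Fin.cons a.1 a.2 :=
    fun a => Fin.insertNth_zero' a.1 a.2
  have h1 : ∀ a : EuclideanSpace ℝ (Fin (m + 1)), g (a 0) (‖a‖ ^ 2 - a 0 ^ 2) =
      (fun u : Fin (m + 1) → ℝ => g (u 0) (∑ k : Fin m, u k.succ ^ 2)) (WithLp.ofLp a) := by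
    intro a
    simp only
    congr 1
    rw [EuclideanSpace.real_norm_sq_eq, Fin.sum_univ_succ, add_sub_cancel_left]
  have h2 : ∀ y : EuclideanSpace ℝ (Fin m), ‖y‖ ^ 2 =
      ∑ k : Fin m, (WithLp.ofLp y) k ^ 2 := fun y => EuclideanSpace.real_norm_sq_eq y
  have hm : Measurable fun u : Fin (m + 1) → ℝ => g (u 0) (∑ k : Fin m, u k.succ ^ 2) := by
    have : Measurable fun u : Fin (m + 1) → ℝ => (u 0, ∑ k : Fin m, u k.succ ^ 2) := by fun_prop
    exact hg.comp this
  have hm2 : Measurable fun q : ℝ × (Fin m → ℝ) => g q.1 (∑ k : Fin m, q.2 k ^ 2) := by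
    have : Measurable fun q : ℝ × (Fin m → ℝ) => (q.1, ∑ k : Fin m, q.2 k ^ 2) := by fun_prop
    exact hg.comp this
  simp only [h1]
  rw [e3.lintegral_comp hm, hp.lintegral_map_equiv _ _]
  simp only [hc, Fin.cons_zero, Fin.cons_succ]
  change ∫⁻ q : ℝ × (Fin m → ℝ), _ ∂(volume.prod volume) = _
  rw [lintegral_prod _ hm2.aemeasurable]
  refine lintegral_congr fun x => ?_
  simp only [h2]
  exact (e4.lintegral_comp (f := fun u => g x (∑ k : Fin m, u k ^ 2))
    (hm2.comp measurable_prodMk_left)).symm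

theorem vnorm_mk {N : ℕ} (a b : EuclideanSpace ℝ (Fin N)) :
    vnorm (fun j => (⟨a j, b j⟩ : ℂ)) = ‖a‖ ^ 2 + ‖b‖ ^ 2 := by
  rw [EuclideanSpace.real_norm_sq_eq, EuclideanSpace.real_norm_sq_eq, vnorm,
    ← Finset.sum_add_distrib]
  exact Finset.sum_congr rfl fun j _ => by rw [normSq_mk]; ring

theorem normSq_vsq_mk {N : ℕ} (a b : EuclideanSpace ℝ (Fin N)) :
    normSq (vsq (fun j => (⟨a j, b j⟩ : ℂ))) =
      (‖a‖ ^ 2 - ‖b‖ ^ 2) ^ 2 + 4 * inner ℝ a b ^ 2 := by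
  have hre : (vsq (fun j => (⟨a j, b j⟩ : ℂ))).re = ‖a‖ ^ 2 - ‖b‖ ^ 2 := by
    rw [EuclideanSpace.real_norm_sq_eq, EuclideanSpace.real_norm_sq_eq, vsq, re_sum,
      ← Finset.sum_sub_distrib]
    exact Finset.sum_congr rfl fun j _ => by simp only [mul_re]; ring
  have him : (vsq (fun j => (⟨a j, b j⟩ : ℂ))).im = 2 * inner ℝ a b := by
    rw [PiLp.inner_apply, vsq, im_sum, Finset.mul_sum]
    exact Finset.sum_congr rfl fun j _ => by
      simp only [mul_im, RCLike.inner_apply, conj_trivial]; ring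
  rw [normSq_apply, hre, him]
  ring

/-- The squared normalised area of the parallelogram with sides of squared lengths `s` and `r` and
inner product `p`. -/
def gramFun (s r p : ℝ) : ℝ := 1 - ((s - r) ^ 2 + 4 * p ^ 2) / (s + r) ^ 2

theorem gramRatio_mk {N : ℕ} (a b : EuclideanSpace ℝ (Fin N)) :
    gramRatio (fun j => (⟨a j, b j⟩ : ℂ)) = gramFun (‖a‖ ^ 2) (‖b‖ ^ 2) (inner ℝ a b) := by
  rw [gramRatio, gramFun, vnorm_mk, normSq_vsq_mk]

/-- A reflection carries `b` to a multiple of the first basis vector; then `a` is rescaled by `‖b‖`,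
under which the normalised area is invariant. -/
theorem lintegral_exp_neg_gramFun {m : ℕ} {φ : ℝ → ENNReal} {b : EuclideanSpace ℝ (Fin (m + 1))}
    (hb : b ≠ 0) :
    ∫⁻ a : EuclideanSpace ℝ (Fin (m + 1)), ENNReal.ofReal (Real.exp (-(‖a‖ ^ 2 + ‖b‖ ^ 2))) *
        φ (gramFun (‖a‖ ^ 2) (‖b‖ ^ 2) (inner ℝ a b)) =
      ∫⁻ a : EuclideanSpace ℝ (Fin (m + 1)),
        ENNReal.ofReal (‖b‖ ^ (m + 1) * Real.exp (-(‖b‖ ^ 2 * (1 + ‖a‖ ^ 2)))) *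
        φ (gramFun (‖a‖ ^ 2) 1 (a 0)) := by
  have hb' : 0 < ‖b‖ := norm_pos_iff.2 hb
  set e : EuclideanSpace ℝ (Fin (m + 1)) := ‖b‖ • EuclideanSpace.single 0 1 with he
  have hbe : ‖b‖ = ‖e‖ := by
    rw [he, norm_smul, PiLp.norm_single, norm_norm, norm_one, mul_one]
  set R := (Submodule.span ℝ {b - e})ᗮ.reflection with hR
  have hRb : R b = e := Submodule.reflection_sub hbe
  have hin : ∀ a, inner ℝ (R a) e = inner ℝ a b := fun a => by rw [← hRb, R.inner_map_map]
  have h1 : ∀ a, ENNReal.ofReal (Real.exp (-(‖a‖ ^ 2 + ‖b‖ ^ 2))) *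
        φ (gramFun (‖a‖ ^ 2) (‖b‖ ^ 2) (inner ℝ a b)) =
      (fun a => ENNReal.ofReal (Real.exp (-(‖a‖ ^ 2 + ‖b‖ ^ 2))) *
        φ (gramFun (‖a‖ ^ 2) (‖b‖ ^ 2) (inner ℝ a e))) (R a) := fun a => by
    simp only [hin, R.norm_map]
  simp only [h1]
  have h2 := R.measurePreserving.lintegral_comp_emb
    R.toHomeomorph.measurableEmbedding (fun a => ENNReal.ofReal (Real.exp (-(‖a‖ ^ 2 + ‖b‖ ^ 2))) *
        φ (gramFun (‖a‖ ^ 2) (‖b‖ ^ 2) (inner ℝ a e)))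
  rw [h2, lintegral_comp_smul_real volume hb', ← lintegral_const_mul' _ _ ENNReal.ofReal_ne_top]
  refine lintegral_congr fun a => ?_
  have hina : inner ℝ (‖b‖ • a) e = ‖b‖ ^ 2 * a 0 := by
    rw [he, inner_smul_left, inner_smul_right, EuclideanSpace.inner_single_right]
    simp
    ring
  rw [← mul_assoc, ← ENNReal.ofReal_mul (by positivity), finrank_euclideanSpace_fin, norm_smul,
    norm_norm, hina, mul_pow]
  congr 2
  · congr 2
    ring
  · rw [gramFun, gramFun]
    congr 1
    rw [show ‖b‖ ^ 2 * ‖a‖ ^ 2 - ‖b‖ ^ 2 = ‖b‖ ^ 2 * (‖a‖ ^ 2 - 1) by ring,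
      show ‖b‖ ^ 2 * ‖a‖ ^ 2 + ‖b‖ ^ 2 = ‖b‖ ^ 2 * (‖a‖ ^ 2 + 1) by ring]
    field_simp

theorem lintegral_norm_pow_mul_exp {m : ℕ} {c : ℝ} (hc : 0 < c) :
    ∫⁻ b : EuclideanSpace ℝ (Fin m), ENNReal.ofReal (‖b‖ ^ m * Real.exp (-(‖b‖ ^ 2 * c))) =
      ENNReal.ofReal (c ^ m)⁻¹ *
        ∫⁻ b : EuclideanSpace ℝ (Fin m), ENNReal.ofReal (‖b‖ ^ m * Real.exp (-‖b‖ ^ 2)) := by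
  have hs : 0 < Real.sqrt c := Real.sqrt_pos.2 hc
  have hs2 : Real.sqrt c ^ 2 = c := Real.sq_sqrt hc.le
  have h := lintegral_comp_smul_real (volume : Measure (EuclideanSpace ℝ (Fin m))) hs
    fun b => ENNReal.ofReal (‖b‖ ^ m * Real.exp (-‖b‖ ^ 2))
  rw [h, ← mul_assoc, ← ENNReal.ofReal_mul (by positivity),
    ← lintegral_const_mul' _ _ ENNReal.ofReal_ne_top]
  refine lintegral_congr fun b => ?_
  rw [← ENNReal.ofReal_mul (by positivity), finrank_euclideanSpace_fin, norm_smul,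
    Real.norm_of_nonneg hs.le, mul_pow, mul_pow, hs2, mul_comm (‖b‖ ^ 2)]
  congr 1
  have : c ^ m = Real.sqrt c ^ m * Real.sqrt c ^ m := by rw [← mul_pow, ← sq, hs2]
  rw [this]
  field_simp

/-- Once `b` is integrated out, `a` enters through `x = a 0` and the norm `ρ` of its other
coordinates. For `t = (1 + x² + ρ²) / (2 ρ)` the Gram ratio is `t⁻²`, and the weight `ρ ^ (m - 1) /
(1 + x² + ρ²) ^ (m + 1)` is `ρ⁻² (2 t) ^ (-(m + 1))`, so hyperbolic area appears. The constant is
evaluated later from the total mass. -/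
theorem exists_lintegral_gramRatio {m : ℕ} (hm : 1 ≤ m) :
    ∃ C : ENNReal, ∀ φ : ℝ → ENNReal, Measurable φ →
      ∫⁻ v : Fin (m + 1) → ℂ, ENNReal.ofReal (Real.exp (-vnorm v)) * φ (gramRatio v) =
        C * ∫⁻ t in Set.Ioi (1 : ℝ), ENNReal.ofReal (t ^ (m + 1))⁻¹ * φ (t ^ 2)⁻¹ := by
  have : Nonempty (Fin m) := ⟨⟨0, hm⟩⟩
  have hnt : Nontrivial (EuclideanSpace ℝ (Fin m)) := inferInstance
  set c₁ := ∫⁻ b : EuclideanSpace ℝ (Fin (m + 1)),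
    ENNReal.ofReal (‖b‖ ^ (m + 1) * Real.exp (-‖b‖ ^ 2)) with hc₁
  set c₂ := (volume : Measure (EuclideanSpace ℝ (Fin m))).toSphere Set.univ with hc₂
  refine ⟨c₁ * (c₂ * (ENNReal.ofReal (2 * Real.pi) * ENNReal.ofReal (2 ^ (m + 1))⁻¹)),
    fun φ hφ => ?_⟩
  have hvn := (continuous_vnorm (N := m + 1)).measurable
  have hgr := measurable_gramRatio (N := m + 1)
  have hgf : Measurable fun q : ℝ × ℝ × ℝ => gramFun q.1 q.2.1 q.2.2 := by
    unfold gramFun; fun_prop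
  rw [lintegral_complex_pi_eq_lintegral_euclidean (by fun_prop)]
  simp only [vnorm_mk, gramRatio_mk]
  have h1 : ∀ᵐ b : EuclideanSpace ℝ (Fin (m + 1)),
      ∫⁻ a : EuclideanSpace ℝ (Fin (m + 1)), ENNReal.ofReal (Real.exp (-(‖a‖ ^ 2 + ‖b‖ ^ 2))) *
        φ (gramFun (‖a‖ ^ 2) (‖b‖ ^ 2) (inner ℝ a b)) =
      ∫⁻ a : EuclideanSpace ℝ (Fin (m + 1)),
        ENNReal.ofReal (‖b‖ ^ (m + 1) * Real.exp (-(‖b‖ ^ 2 * (1 + ‖a‖ ^ 2)))) *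
        φ (gramFun (‖a‖ ^ 2) 1 (a 0)) := by
    filter_upwards [Measure.ae_ne volume 0] with b hb
    exact lintegral_exp_neg_gramFun hb
  have hφg : Measurable fun a : EuclideanSpace ℝ (Fin (m + 1)) =>
      φ (gramFun (‖a‖ ^ 2) 1 (a 0)) := by
    have h : Measurable fun a : EuclideanSpace ℝ (Fin (m + 1)) => (‖a‖ ^ 2, (1 : ℝ), a 0) := by
      fun_prop
    have h' := hφ.comp (hgf.comp h)
    simpa only [Function.comp_def] using h'
  have hφg2 : Measurable fun p : EuclideanSpace ℝ (Fin (m + 1)) × EuclideanSpace ℝ (Fin (m + 1)) =>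
      φ (gramFun (‖p.2‖ ^ 2) 1 (p.2 0)) := by
    have h' := hφg.comp (measurable_snd : Measurable (Prod.snd :
      EuclideanSpace ℝ (Fin (m + 1)) × EuclideanSpace ℝ (Fin (m + 1)) → _))
    simpa only [Function.comp_def] using h'
  rw [lintegral_congr_ae h1, lintegral_lintegral_swap (by fun_prop)]
  have h2 : ∀ a : EuclideanSpace ℝ (Fin (m + 1)), ∫⁻ b : EuclideanSpace ℝ (Fin (m + 1)),
        ENNReal.ofReal (‖b‖ ^ (m + 1) * Real.exp (-(‖b‖ ^ 2 * (1 + ‖a‖ ^ 2)))) *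
        φ (gramFun (‖a‖ ^ 2) 1 (a 0)) =
      c₁ * (fun x s => ENNReal.ofReal ((1 + x ^ 2 + s) ^ (m + 1))⁻¹ *
        φ (4 * s / (1 + x ^ 2 + s) ^ 2)) (a 0) (‖a‖ ^ 2 - a 0 ^ 2) := by
    intro a
    have hpos : 0 < 1 + ‖a‖ ^ 2 := by positivity
    rw [lintegral_mul_const _ (by fun_prop), lintegral_norm_pow_mul_exp hpos]
    simp only
    rw [show 1 + a 0 ^ 2 + (‖a‖ ^ 2 - a 0 ^ 2) = 1 + ‖a‖ ^ 2 by ring,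
      mul_comm (ENNReal.ofReal _) c₁, mul_assoc]
    congr 4
    rw [gramFun]
    field_simp
    ring
  have hg2 : Measurable fun p : ℝ × ℝ => ENNReal.ofReal ((1 + p.1 ^ 2 + p.2) ^ (m + 1))⁻¹ *
        φ (4 * p.2 / (1 + p.1 ^ 2 + p.2) ^ 2) := by fun_prop
  simp only [h2]
  rw [lintegral_const_mul _ (by
      have h : Measurable fun a : EuclideanSpace ℝ (Fin (m + 1)) => (a 0, ‖a‖ ^ 2 - a 0 ^ 2) := by
        fun_prop
      have h' := hg2.comp h
      simpa only [Function.comp_def] using h'),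
    lintegral_euclidean_succ (m := m) (g := fun x s => ENNReal.ofReal ((1 + x ^ 2 + s) ^ (m + 1))⁻¹ *
        φ (4 * s / (1 + x ^ 2 + s) ^ 2)) hg2, mul_assoc]
  congr 1
  set ψ : ℝ → ENNReal := fun t => ENNReal.ofReal (2 ^ (m + 1))⁻¹ *
    (ENNReal.ofReal (t ^ (m + 1))⁻¹ * φ (t ^ 2)⁻¹) with hψ
  have hψm : Measurable ψ := by fun_prop
  have h3 : ∀ x : ℝ, ∫⁻ y : EuclideanSpace ℝ (Fin m),
      ENNReal.ofReal ((1 + x ^ 2 + ‖y‖ ^ 2) ^ (m + 1))⁻¹ *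
        φ (4 * ‖y‖ ^ 2 / (1 + x ^ 2 + ‖y‖ ^ 2) ^ 2) =
      c₂ * ∫⁻ ρ in Set.Ioi (0 : ℝ), ENNReal.ofReal (ρ ^ 2)⁻¹ *
        ψ ((1 + x ^ 2 + ρ ^ 2) / (2 * ρ)) := by
    intro x
    rw [lintegral_fun_norm volume (f := fun r => ENNReal.ofReal ((1 + x ^ 2 + r ^ 2) ^ (m + 1))⁻¹ *
        φ (4 * r ^ 2 / (1 + x ^ 2 + r ^ 2) ^ 2)) (by fun_prop)]
    congr 1
    refine setLIntegral_congr_fun measurableSet_Ioi fun ρ hρ => ?_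
    have hρ' : 0 < ρ := hρ
    simp only [hψ]
    rw [← mul_assoc, ← mul_assoc, ← mul_assoc, ← ENNReal.ofReal_mul (by positivity),
      ← ENNReal.ofReal_mul (by positivity), ← ENNReal.ofReal_mul (by positivity),
      finrank_euclideanSpace_fin]
    congr 2
    · obtain ⟨k, rfl⟩ := Nat.exists_eq_add_of_le' hm
      rw [Nat.add_sub_cancel, div_pow, mul_pow]
      field_simp
      ring
    · field_simp
      ring
  simp only [h3]
  rw [lintegral_const_mul _ (by fun_prop), lintegral_upperHalfPlane hψm,
    lintegral_const_mul _ (by fun_prop), mul_assoc, mul_assoc]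

end GramLaw

/-! ### The Gram ratio in the projective chart -/

section ProjectiveLaw

open Complex

theorem image_inv_Ioo_zero_one : (fun s : ℝ => s⁻¹) '' Set.Ioo 0 1 = Set.Ioi 1 := by
  ext t
  constructor
  · rintro ⟨s, hs, rfl⟩
    exact (one_lt_inv₀ hs.1).2 hs.2
  · intro ht
    have ht' : 1 < t := ht
    exact ⟨t⁻¹, ⟨inv_pos.2 (by linarith), inv_lt_one_of_one_lt₀ ht'⟩, inv_inv t⟩

theorem lintegral_Ioi_one_inv (φ : ℝ → ENNReal) {m : ℕ} (hm : 1 ≤ m) :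
    ∫⁻ t in Set.Ioi (1 : ℝ), ENNReal.ofReal (t ^ (m + 1))⁻¹ * φ (t ^ 2)⁻¹ =
      ∫⁻ s in Set.Ioo (0 : ℝ) 1, ENNReal.ofReal (s ^ (m - 1)) * φ (s ^ 2) := by
  rw [← image_inv_Ioo_zero_one, lintegral_image_eq_lintegral_abs_deriv_mul measurableSet_Ioo
    (fun s hs => (hasDerivAt_inv (ne_of_gt hs.1)).hasDerivWithinAt) inv_injective.injOn]
  refine setLIntegral_congr_fun measurableSet_Ioo fun s hs => ?_
  have hs0 : 0 < s := hs.1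
  obtain ⟨k, rfl⟩ := Nat.exists_eq_add_of_le' hm
  rw [← mul_assoc, ← ENNReal.ofReal_mul (abs_nonneg _), abs_neg, abs_of_pos (by positivity),
    Nat.add_sub_cancel, inv_pow, inv_inv, inv_pow, inv_inv]
  congr 2
  field_simp
  ring

theorem lintegral_Ioo_pow {m : ℕ} (hm : 1 ≤ m) :
    ∫⁻ s in Set.Ioo (0 : ℝ) 1, ENNReal.ofReal (s ^ (m - 1)) = ENNReal.ofReal (m : ℝ)⁻¹ := by
  have h : ∫ s in (0 : ℝ)..1, s ^ (m - 1) = (m : ℝ)⁻¹ := by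
    rw [integral_pow]
    obtain ⟨k, rfl⟩ := Nat.exists_eq_add_of_le' hm
    simp
  rw [← h, intervalIntegral.integral_of_le zero_le_one, integral_Ioc_eq_integral_Ioo,
    ofReal_integral_eq_lintegral_ofReal]
  · exact ((continuous_pow _).integrableOn_Icc (a := (0 : ℝ)) (b := 1)).mono_set Set.Ioo_subset_Icc_self
  · filter_upwards [ae_restrict_mem measurableSet_Ioo] with s hs
    exact pow_nonneg hs.1.le _

theorem lintegral_projective_gramRatio {m : ℕ} (hm : 1 ≤ m) {φ : ℝ → ENNReal}
    (hφ : Measurable φ) :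
    ∫⁻ w : Fin m → ℂ, ENNReal.ofReal ((vnorm (Fin.cons 1 w : Fin (m + 1) → ℂ) ^ (m + 1))⁻¹) *
        φ (gramRatio (Fin.cons 1 w : Fin (m + 1) → ℂ)) =
      ENNReal.ofReal (Real.pi ^ m / (m - 1).factorial) *
        ∫⁻ s in Set.Ioo (0 : ℝ) 1, ENNReal.ofReal (s ^ (m - 1)) * φ (s ^ 2) := by
  obtain ⟨C, hC⟩ := exists_lintegral_gramRatio hm
  have hm0 : (0 : ℝ) < m := by exact_mod_cast hm
  -- The test function `φ = 1` fixes the constant, since the Gaussian mass is known.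
  have hC1 : C * ENNReal.ofReal (m : ℝ)⁻¹ = ENNReal.ofReal (Real.pi ^ (m + 1)) := by
    have h := hC (fun _ => 1) measurable_const
    have h' := lintegral_Ioi_one_inv (fun _ => 1) hm
    simp only [mul_one] at h h'
    rw [h', lintegral_Ioo_pow hm, lintegral_exp_neg_vnorm] at h
    exact h.symm
  have hCval : C = ENNReal.ofReal (Real.pi ^ (m + 1) * m) := by
    rw [ENNReal.ofReal_mul (by positivity), ← hC1, mul_assoc, ← ENNReal.ofReal_mul (by positivity),
      inv_mul_cancel₀ hm0.ne', ENNReal.ofReal_one, mul_one]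
  have h := hC φ hφ
  rw [lintegral_exp_neg_vnorm_mul hφ, lintegral_Ioi_one_inv φ hm, hCval] at h
  have hpos : 0 < Real.pi * m.factorial := by positivity
  have h1 : ENNReal.ofReal (Real.pi * m.factorial)⁻¹ * ENNReal.ofReal (Real.pi * m.factorial) = 1 := by
    rw [← ENNReal.ofReal_mul (by positivity), inv_mul_cancel₀ hpos.ne', ENNReal.ofReal_one]
  have h2 := congrArg (fun x => ENNReal.ofReal (Real.pi * m.factorial)⁻¹ * x) h
  simp only [← mul_assoc, h1, one_mul] at h2
  rw [h2, ← ENNReal.ofReal_mul (by positivity)]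
  congr 2
  obtain ⟨k, rfl⟩ := Nat.exists_eq_add_of_le' hm
  rw [Nat.add_sub_cancel, Nat.factorial_succ]
  push_cast
  field_simp
  ring

end ProjectiveLaw

/-! ### The explicit density -/

section Density

open Complex

/-- The ratio of the covariance discriminant to `|v|⁴`, for normalised area `s`. -/
def discProfile (τ s : ℝ) : ℝ := 1 - τ ^ 2 * (1 - s ^ 2)

/-- The joint density of an eigenvalue `z` and an eigenvector of unit length and normalised
area `s`. -/
def densityProfile (N : ℕ) (τ : ℝ) (z : ℂ) (s : ℝ) : ℝ :=
  reducedMoment N z (τ * s ^ 2 / discProfile τ s) ((1 - τ ^ 2) / discProfile τ s) *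
    Real.exp (-((normSq z - τ * (1 - s ^ 2) * (z ^ 2).re) / discProfile τ s)) /
    (Real.pi * Real.sqrt (discProfile τ s)) ^ N

/-- The mean eigenvalue density of the interpolating Ginibre ensemble. -/
def eigenvalueDensity (N : ℕ) (τ : ℝ) (z : ℂ) : ℝ :=
  Real.pi ^ (N - 1) / (N - 2).factorial * ∫ s in (0 : ℝ)..1, s ^ (N - 2) * densityProfile N τ z s

theorem discProfile_pos {τ : ℝ} (hτ : |τ| < 1) (s : ℝ) : 0 < discProfile τ s := by
  have h2 : τ ^ 2 < 1 := (sq_lt_one_iff_abs_lt_one τ).2 hτ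
  rw [discProfile]
  nlinarith [mul_nonneg (sq_nonneg τ) (sq_nonneg s)]

theorem continuous_densityProfile (N : ℕ) {τ : ℝ} (hτ : |τ| < 1) :
    Continuous fun p : ℂ × ℝ => densityProfile N τ p.1 p.2 := by
  have hd : Continuous fun p : ℂ × ℝ => discProfile τ p.2 := by unfold discProfile; fun_prop
  have hd0 : ∀ p : ℂ × ℝ, discProfile τ p.2 ≠ 0 := fun p => (discProfile_pos hτ p.2).ne'
  have hs0 : ∀ p : ℂ × ℝ, (Real.pi * Real.sqrt (discProfile τ p.2)) ^ N ≠ 0 := fun p =>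
    pow_ne_zero _ (mul_ne_zero Real.pi_ne_zero (Real.sqrt_pos.2 (discProfile_pos hτ p.2)).ne')
  have h1 : Continuous fun p : ℂ × ℝ => τ * p.2 ^ 2 / discProfile τ p.2 :=
    Continuous.div (by fun_prop) hd hd0
  have h2 : Continuous fun p : ℂ × ℝ => (1 - τ ^ 2) / discProfile τ p.2 :=
    Continuous.div (by fun_prop) hd hd0
  have hn := continuous_normSq
  have hre := continuous_re
  have h3 : Continuous fun p : ℂ × ℝ =>
      (normSq p.1 - τ * (1 - p.2 ^ 2) * (p.1 ^ 2).re) / discProfile τ p.2 :=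
    Continuous.div (by fun_prop) hd hd0
  have h7 : ∀ n, Continuous (ginibreMoment n) := fun n => by
    unfold ginibreMoment truncExp; fun_prop
  have h9 := h7 (N - 1)
  have h10 := h7 (N - 2)
  have hconj := continuous_conj
  have h4 : Continuous fun p : ℂ × ℝ => p.1 - ((τ * p.2 ^ 2 / discProfile τ p.2 : ℝ) : ℂ) *
      (starRingEnd ℂ) p.1 :=
    continuous_fst.sub ((continuous_ofReal.comp h1).mul (hconj.comp continuous_fst))
  unfold densityProfile reducedMoment
  refine Continuous.div (Continuous.mul (Continuous.add ?_ ?_) ?_) (by fun_prop) hs0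
  · exact (hn.comp h4).mul (h10.comp (hn.comp continuous_fst))
  · exact h2.mul (by fun_prop)
  · fun_prop

theorem chartDensity_eq {N : ℕ} {τ : ℝ} (hτ : |τ| < 1) (z : ℂ) {v : Fin N → ℂ} (hv : v ≠ 0) :
    chartDensity τ z v =
      (vnorm v ^ N)⁻¹ * densityProfile N τ z (Real.sqrt (gramRatio v)) := by
  have hn := vnorm_pos hv
  have hd := vdisc_pos hτ hv
  have hg : 0 ≤ gramRatio v := by
    rw [gramRatio, sub_nonneg, div_le_one (by positivity)]
    exact normSq_vsq_le v
  have hs : Real.sqrt (gramRatio v) ^ 2 = gramRatio v := Real.sq_sqrt hg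
  have hdisc : discProfile τ (Real.sqrt (gramRatio v)) = vdisc τ v / vnorm v ^ 2 := by
    rw [discProfile, hs, gramRatio, vdisc]
    field_simp
    ring
  have hsq : Real.sqrt (vdisc τ v / vnorm v ^ 2) = Real.sqrt (vdisc τ v) / vnorm v := by
    rw [Real.sqrt_div hd.le, Real.sqrt_sq hn.le]
  rw [chartDensity, densityProfile, hdisc, hsq, hs, reducedMean, reducedVar]
  have e1 : τ * gramRatio v / (vdisc τ v / vnorm v ^ 2) =
      τ * (vnorm v ^ 2 - normSq (vsq v)) / vdisc τ v := by
    rw [gramRatio]; field_simp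
  have e2 : (1 - τ ^ 2) / (vdisc τ v / vnorm v ^ 2) = (1 - τ ^ 2) * vnorm v ^ 2 / vdisc τ v := by
    field_simp
  have e3 : (normSq z - τ * (1 - gramRatio v) * (z ^ 2).re) / (vdisc τ v / vnorm v ^ 2) =
      (vnorm v ^ 2 * normSq z - τ * normSq (vsq v) * (z ^ 2).re) / vdisc τ v := by
    rw [gramRatio]; field_simp; ring
  rw [e1, e2, e3, mul_div_assoc', mul_div_assoc', div_pow]
  field_simp

/-- The difference is `n!` times the sum of `(n + 1 - j) r ^ j / j!` over `j ≤ n + 1`. -/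
theorem ginibreMoment_sub_nonneg (n : ℕ) {r : ℝ} (hr : 0 ≤ r) :
    0 ≤ ginibreMoment (n + 1) r - r * ginibreMoment n r := by
  have h1 : r * truncExp n r = ∑ j ∈ Finset.range (n + 2), j * (r ^ j / j.factorial) := by
    rw [truncExp, Finset.mul_sum]
    conv_rhs => rw [Finset.sum_range_succ', Nat.cast_zero, zero_mul, add_zero]
    refine Finset.sum_congr rfl fun j _ => ?_
    rw [Nat.factorial_succ]
    push_cast
    field_simp
    ring
  have h2 : ginibreMoment (n + 1) r - r * ginibreMoment n r =
      n.factorial * ∑ j ∈ Finset.range (n + 2), ((n : ℝ) + 1 - j) * (r ^ j / j.factorial) := by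
    simp only [sub_mul, Finset.sum_sub_distrib, ← h1, ← Finset.mul_sum]
    rw [ginibreMoment, ginibreMoment, Nat.factorial_succ, truncExp]
    push_cast
    ring
  rw [h2]
  refine mul_nonneg (by positivity) (Finset.sum_nonneg fun j hj => ?_)
  have h : (j : ℝ) ≤ n + 1 := by exact_mod_cast Finset.mem_range_succ_iff.1 hj
  exact mul_nonneg (by linarith) (by positivity)

theorem densityProfile_nonneg {N : ℕ} (hN : 2 ≤ N) {τ : ℝ} (hτ : |τ| < 1) (z : ℂ) (s : ℝ) :
    0 ≤ densityProfile N τ z s := by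
  obtain ⟨n, rfl⟩ := Nat.exists_eq_add_of_le' hN
  have h2 : τ ^ 2 < 1 := (sq_lt_one_iff_abs_lt_one τ).2 hτ
  have hd := discProfile_pos hτ s
  have h1 := ginibreMoment_sub_nonneg n (normSq_nonneg z)
  have h3 : 0 ≤ ginibreMoment n (normSq z) := by
    have := normSq_nonneg z
    unfold ginibreMoment truncExp
    positivity
  have h4 : 0 ≤ 1 - τ ^ 2 := by linarith
  unfold densityProfile reducedMoment
  refine div_nonneg (mul_nonneg (add_nonneg (mul_nonneg (normSq_nonneg _) h3)
    (mul_nonneg (div_nonneg h4 hd.le) h1)) (Real.exp_nonneg _)) (by positivity)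

theorem lintegral_chartDensity {m : ℕ} (hm : 1 ≤ m) {τ : ℝ} (hτ : |τ| < 1) (z : ℂ) :
    ∫⁻ w : Fin m → ℂ, ENNReal.ofReal (chartDensity τ z (Fin.cons 1 w : Fin (m + 1) → ℂ)) =
      ENNReal.ofReal (eigenvalueDensity (m + 1) τ z) := by
  have hc : Continuous fun s => densityProfile (m + 1) τ z s :=
    (continuous_densityProfile (m + 1) hτ).comp (by fun_prop : Continuous fun s : ℝ => (z, s))
  have hnn := densityProfile_nonneg (N := m + 1) (by omega) hτ z
  set φ : ℝ → ENNReal := fun q => ENNReal.ofReal (densityProfile (m + 1) τ z (Real.sqrt q)) with hφ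
  have hφm : Measurable φ := (hc.comp Real.continuous_sqrt).measurable.ennreal_ofReal
  have h1 : ∀ w : Fin m → ℂ,
      ENNReal.ofReal (chartDensity τ z (Fin.cons 1 w : Fin (m + 1) → ℂ)) =
      ENNReal.ofReal ((vnorm (Fin.cons 1 w : Fin (m + 1) → ℂ) ^ (m + 1))⁻¹) *
        φ (gramRatio (Fin.cons 1 w : Fin (m + 1) → ℂ)) := by
    intro w
    have hv : (Fin.cons 1 w : Fin (m + 1) → ℂ) ≠ 0 := fun h0 => by simpa using congrFun h0 0
    rw [chartDensity_eq hτ z hv, ENNReal.ofReal_mul (inv_nonneg.2 (pow_nonneg (vnorm_nonneg _) _))]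
  simp only [h1]
  rw [lintegral_projective_gramRatio hm hφm, eigenvalueDensity, ENNReal.ofReal_mul (by positivity)]
  congr 1
  rw [intervalIntegral.integral_of_le zero_le_one, integral_Ioc_eq_integral_Ioo,
    ofReal_integral_eq_lintegral_ofReal]
  · refine setLIntegral_congr_fun measurableSet_Ioo fun s hs => ?_
    simp only [hφ]
    rw [Real.sqrt_sq hs.1.le, ← ENNReal.ofReal_mul (pow_nonneg hs.1.le _)]
    rfl
  · exact (Continuous.integrableOn_Icc (a := (0 : ℝ)) (b := 1) (by fun_prop)).mono_set
      Set.Ioo_subset_Icc_self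
  · filter_upwards [ae_restrict_mem measurableSet_Ioo] with s hs
    exact mul_nonneg (pow_nonneg hs.1.le _) (hnn s)

theorem continuous_eigenvalueDensity (N : ℕ) {τ : ℝ} (hτ : |τ| < 1) :
    Continuous (eigenvalueDensity N τ) := by
  unfold eigenvalueDensity
  refine continuous_const.mul
    (intervalIntegral.continuous_parametric_intervalIntegral_of_continuous' ?_ 0 1)
  have := continuous_densityProfile N hτ
  simp only [Function.uncurry_def]
  fun_prop

theorem eigenvalueDensity_nonneg {N : ℕ} (hN : 2 ≤ N) {τ : ℝ} (hτ : |τ| < 1) (z : ℂ) :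
    0 ≤ eigenvalueDensity N τ z := by
  refine mul_nonneg (by positivity) (intervalIntegral.integral_nonneg zero_le_one fun s hs => ?_)
  exact mul_nonneg (pow_nonneg hs.1 _) (densityProfile_nonneg hN hτ z s)

end Density

/-! ### Existence and uniqueness of the mean density -/

section MeanDensity

theorem eigenvalueSum_nonneg {N : ℕ} (X : Matrix (Fin N) (Fin N) ℂ) {f : ℂ → ℝ}
    (hf : ∀ z, 0 ≤ f z) : 0 ≤ eigenvalueSum X f := by
  refine Multiset.sum_nonneg fun x hx => ?_
  obtain ⟨z, -, rfl⟩ := Multiset.mem_map.1 hx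
  exact hf z

theorem eigenvalueSum_sub {N : ℕ} (X : Matrix (Fin N) (Fin N) ℂ) (f g : ℂ → ℝ) :
    eigenvalueSum X (fun z => f z - g z) = eigenvalueSum X f - eigenvalueSum X g :=
  Multiset.sum_map_sub

theorem continuous_interpolatingMatrix {N : ℕ} (τ : ℝ) :
    Continuous fun G : (Fin N → Fin N → ℝ) × (Fin N → Fin N → ℝ) =>
      interpolatingMatrix τ G.1 G.2 := by
  refine continuous_matrix fun i j => ?_
  simp only [interpolatingMatrix, Matrix.of_apply]
  fun_prop

theorem lintegral_eigenvalueSum_interpolatingMatrix {N : ℕ} (hN : 2 ≤ N) {τ : ℝ} (hτ : |τ| < 1)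
    {f : ℂ → ℝ} (hf : Continuous f) (hf0 : ∀ z, 0 ≤ f z) :
    ∫⁻ G, ENNReal.ofReal (eigenvalueSum (interpolatingMatrix τ G.1 G.2) f)
        ∂((realGinibre N).prod (realGinibre N)) =
      ∫⁻ z, ENNReal.ofReal (f z * eigenvalueDensity N τ z) := by
  obtain ⟨m, rfl⟩ := Nat.exists_eq_add_of_le' (one_le_two.trans hN)
  have hm : 1 ≤ m := by omega
  have hE : Measurable fun X : Fin (m + 1) → Fin (m + 1) → ℂ =>
      ENNReal.ofReal (eigenvalueSum (Matrix.of X) f) := by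
    have h : Continuous fun X : Fin (m + 1) → Fin (m + 1) → ℂ => eigenvalueSum (Matrix.of X) f :=
      continuous_eigenvalueSum (N := m + 1) hf
    exact h.measurable.ennreal_ofReal
  have h1 := (measurePreserving_interpolatingMatrix (m + 1) hτ).lintegral_comp hE
  rw [lintegral_eigenvalueSum_matrixLaw hτ hm hf hf0] at h1
  refine h1.trans (lintegral_congr fun z => ?_)
  rw [lintegral_chartDensity hm hτ, ← ENNReal.ofReal_mul (hf0 z)]

theorem hasMean_eigenvalueSum_of_nonneg {N : ℕ} (hN : 2 ≤ N) {τ : ℝ} (hτ : |τ| < 1)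
    {f : ℂ → ℝ} (hf : Continuous f) (hf0 : ∀ z, 0 ≤ f z) (hfc : HasCompactSupport f) :
    Integrable (fun G : (Fin N → Fin N → ℝ) × (Fin N → Fin N → ℝ) =>
        eigenvalueSum (interpolatingMatrix τ G.1 G.2) f)
        ((realGinibre N).prod (realGinibre N)) ∧
      meanEigenvalueSum N τ f = ∫ z, f z * eigenvalueDensity N τ z := by
  have h := lintegral_eigenvalueSum_interpolatingMatrix hN hτ hf hf0
  have hp := continuous_eigenvalueDensity N hτ
  have hi : Integrable fun z => f z * eigenvalueDensity N τ z :=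
    (hf.mul hp).integrable_of_hasCompactSupport hfc.mul_right
  have hnn : ∀ z, 0 ≤ f z * eigenvalueDensity N τ z := fun z =>
    mul_nonneg (hf0 z) (eigenvalueDensity_nonneg hN hτ z)
  have hm : AEStronglyMeasurable (fun G : (Fin N → Fin N → ℝ) × (Fin N → Fin N → ℝ) =>
      eigenvalueSum (interpolatingMatrix τ G.1 G.2) f) ((realGinibre N).prod (realGinibre N)) :=
    ((continuous_eigenvalueSum hf).comp
      (continuous_interpolatingMatrix τ)).measurable.aestronglyMeasurable
  have h0 : ∀ G : (Fin N → Fin N → ℝ) × (Fin N → Fin N → ℝ),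
      0 ≤ eigenvalueSum (interpolatingMatrix τ G.1 G.2) f := fun G => eigenvalueSum_nonneg _ hf0
  constructor
  · refine ⟨hm, ?_⟩
    rw [hasFiniteIntegral_iff_ofReal (Eventually.of_forall h0), h,
      ← ofReal_integral_eq_lintegral_ofReal hi (Eventually.of_forall hnn)]
    exact ENNReal.ofReal_lt_top
  · rw [meanEigenvalueSum, integral_eq_lintegral_of_nonneg_ae (Eventually.of_forall h0) hm, h,
      ← integral_eq_lintegral_of_nonneg_ae (Eventually.of_forall hnn) hi.1]

/-- The area formula speaks of nonnegative functions, so a test function is split into its positive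
and negative parts. -/
theorem isMeanEigenvalueDensity_eigenvalueDensity {N : ℕ} (hN : 2 ≤ N) {τ : ℝ} (hτ : |τ| < 1) :
    IsMeanEigenvalueDensity N τ (eigenvalueDensity N τ) := by
  have hp := continuous_eigenvalueDensity N hτ
  refine ⟨hp, fun f hf hfc => ?_⟩
  have hc1 : HasCompactSupport fun z => max (f z) 0 :=
    hfc.comp_left (g := fun x : ℝ => max x 0) (max_self 0)
  have hc2 : HasCompactSupport fun z => max (-f z) 0 :=
    hfc.comp_left (g := fun x : ℝ => max (-x) 0) (by simp)
  have h1 : Continuous fun z => max (f z) 0 := by fun_prop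
  have h2 : Continuous fun z => max (-f z) 0 := by fun_prop
  obtain ⟨i1, e1⟩ := hasMean_eigenvalueSum_of_nonneg hN hτ h1 (fun z => le_max_right _ _) hc1
  obtain ⟨i2, e2⟩ := hasMean_eigenvalueSum_of_nonneg hN hτ h2 (fun z => le_max_right _ _) hc2
  have hsplit : ∀ z, f z = max (f z) 0 - max (-f z) 0 := fun z => by
    rcases le_total 0 (f z) with h | h
    · rw [max_eq_left h, max_eq_right (by linarith)]; ring
    · rw [max_eq_right h, max_eq_left (by linarith)]; ring
  have hf' : f = fun z => max (f z) 0 - max (-f z) 0 := funext hsplit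
  have j1 : Integrable fun z => max (f z) 0 * eigenvalueDensity N τ z :=
    (h1.mul hp).integrable_of_hasCompactSupport hc1.mul_right
  have j2 : Integrable fun z => max (-f z) 0 * eigenvalueDensity N τ z :=
    (h2.mul hp).integrable_of_hasCompactSupport hc2.mul_right
  have hl : meanEigenvalueSum N τ f =
      meanEigenvalueSum N τ (fun z => max (f z) 0) - meanEigenvalueSum N τ fun z => max (-f z) 0 := by
    rw [meanEigenvalueSum, meanEigenvalueSum, meanEigenvalueSum, ← integral_sub i1 i2]
    refine integral_congr_ae (Eventually.of_forall fun G => ?_)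
    simp only [← eigenvalueSum_sub, ← hsplit]
  rw [hl, e1, e2, ← integral_sub j1 j2]
  refine integral_congr_ae (Eventually.of_forall fun z => ?_)
  simp only [← sub_mul, ← hsplit]

theorem IsMeanEigenvalueDensity.unique {N : ℕ} {τ : ℝ} {p q : ℂ → ℝ}
    (hp : IsMeanEigenvalueDensity N τ p) (hq : IsMeanEigenvalueDensity N τ q) : p = q := by
  refine (Continuous.ae_eq_iff_eq volume hp.continuous hq.continuous).1 ?_
  refine ae_eq_of_integral_contDiff_smul_eq hp.continuous.locallyIntegrable
    hq.continuous.locallyIntegrable fun g hg hgc => ?_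
  have h := (hp.mean_eq g hg.continuous hgc).symm.trans (hq.mean_eq g hg.continuous hgc)
  exact h

end MeanDensity

/-! ### Poisson tails -/

section PoissonTail

theorem truncExp_nonneg (n : ℕ) {r : ℝ} (hr : 0 ≤ r) : 0 ≤ truncExp n r :=
  Finset.sum_nonneg fun _ _ => by positivity

theorem truncExp_le_exp (n : ℕ) {r : ℝ} (hr : 0 ≤ r) : truncExp n r ≤ Real.exp r :=
  Real.sum_le_exp_of_nonneg hr (n + 1)

theorem pow_div_factorial_le_exp_sub_truncExp (n : ℕ) {r : ℝ} (hr : 0 ≤ r) :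
    r ^ (n + 1) / (n + 1).factorial ≤ Real.exp r - truncExp n r := by
  have h := truncExp_le_exp (n + 1) hr
  rw [truncExp, Finset.sum_range_succ, ← truncExp] at h
  linarith

/-- Chernoff's bound: in the tail term of index `k > n`, `c ^ (n + 1) ≤ c ^ k`. -/
theorem exp_sub_truncExp_le (n : ℕ) {r c : ℝ} (hr : 0 ≤ r) (hc : 1 ≤ c) :
    Real.exp r - truncExp n r ≤ Real.exp (c * r) / c ^ (n + 1) := by
  have hsum : ∀ x : ℝ, HasSum (fun j : ℕ => x ^ j / j.factorial) (Real.exp x) := fun x => by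
    rw [Real.exp_eq_exp_ℝ]
    exact NormedSpace.expSeries_div_hasSum_exp x
  have h1 : Real.exp r - truncExp n r = ∑' j : ℕ, r ^ (j + (n + 1)) / (j + (n + 1)).factorial := by
    rw [← (hsum r).tsum_eq, ← (hsum r).summable.sum_add_tsum_nat_add (n + 1), truncExp]
    ring
  have h2 := (hsum (c * r)).summable.sum_add_tsum_nat_add (n + 1)
  rw [(hsum (c * r)).tsum_eq] at h2
  have h3 : 0 ≤ ∑ j ∈ Finset.range (n + 1), (c * r) ^ j / j.factorial :=
    truncExp_nonneg n (by positivity)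
  have hcp : 0 < c ^ (n + 1) := by positivity
  rw [le_div_iff₀ hcp, h1, ← tsum_mul_right]
  have s1 := (summable_nat_add_iff (n + 1)).2 (hsum r).summable
  have s2 := (summable_nat_add_iff (n + 1)).2 (hsum (c * r)).summable
  have h4 : ∑' j : ℕ, r ^ (j + (n + 1)) / (j + (n + 1)).factorial * c ^ (n + 1) ≤
      ∑' j : ℕ, (c * r) ^ (j + (n + 1)) / (j + (n + 1)).factorial := by
    refine Summable.tsum_le_tsum (fun j => ?_) (s1.mul_right _) s2
    rw [mul_pow, div_mul_eq_mul_div, mul_comm (c ^ _)]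
    refine div_le_div_of_nonneg_right (mul_le_mul_of_nonneg_left
      (pow_le_pow_right₀ hc (by omega)) (by positivity)) (by positivity)
  linarith

/-- The quantity is the probability that a Poisson variable of mean `N a + b` is at most `N - 2`. -/
theorem tendsto_exp_neg_mul_truncExp {a : ℝ} (ha0 : 0 ≤ a) (ha : a < 1) {b : ℝ} (hb : 0 ≤ b) :
    Tendsto (fun N : ℕ => Real.exp (-(N * a + b)) * truncExp (N - 2) (N * a + b)) atTop (𝓝 1) := by
  -- Any `c > 1` with `(c - 1) a < log c` gives exponential decay. Here `log c ≥ 1 - c⁻¹ = (1 - a) /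
  -- 2 = (c - 1) (1 + a) / 2`, which leaves the rate `(c - 1) (1 - a) / 2`.
  set c := 2 / (1 + a) with hc
  have hc1 : 1 < c := by rw [hc, one_lt_div (by linarith)]; linarith
  have hpos : 0 < (c - 1) * ((1 - a) / 2) := mul_pos (by linarith) (by linarith)
  have hlog : (1 - a) / 2 ≤ Real.log c := by
    have := Real.one_sub_inv_le_log_of_pos (by linarith : 0 < c)
    refine le_trans (le_of_eq ?_) this
    rw [hc, inv_div]; ring
  have hlim : Tendsto (fun N : ℕ => 1 - Real.exp ((c - 1) * b + Real.log c -
      ((c - 1) * ((1 - a) / 2)) * N)) atTop (𝓝 1) := by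
    have h1 : Tendsto (fun N : ℕ => (c - 1) * b + Real.log c - ((c - 1) * ((1 - a) / 2)) * N)
        atTop atBot :=
      tendsto_atBot_add_const_left _ _ (tendsto_neg_atTop_atBot.comp
        (tendsto_natCast_atTop_atTop.const_mul_atTop hpos))
    simpa using (Real.tendsto_exp_atBot.comp h1).const_sub 1
  refine tendsto_of_tendsto_of_tendsto_of_le_of_le' hlim tendsto_const_nhds ?_ ?_
  · filter_upwards [eventually_ge_atTop 2] with N hN
    have hr : 0 ≤ N * a + b := by positivity
    set r := N * a + b with hrdef
    have h := exp_sub_truncExp_le (N - 2) hr hc1.le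
    have hN' : ((N - 2 + 1 : ℕ) : ℝ) = N - 1 := by
      rw [show N - 2 + 1 = N - 1 by omega, Nat.cast_sub (by omega)]; norm_num
    have hcN : c ^ (N - 2 + 1) = Real.exp ((N - 1) * Real.log c) := by
      rw [← hN', mul_comm, Real.exp_mul, Real.exp_log (by linarith), Real.rpow_natCast]
    rw [hcN, ← Real.exp_sub] at h
    have h5 : Real.exp (-r) * (Real.exp r - truncExp (N - 2) r) ≤
        Real.exp (-r) * Real.exp (c * r - (N - 1) * Real.log c) :=
      mul_le_mul_of_nonneg_left h (Real.exp_nonneg _)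
    rw [mul_sub, ← Real.exp_add, ← Real.exp_add, neg_add_cancel, Real.exp_zero] at h5
    have h6 : -r + (c * r - (N - 1) * Real.log c) ≤
        (c - 1) * b + Real.log c - ((c - 1) * ((1 - a) / 2)) * N := by
      have h7 : (c - 1) * ((1 + a) / 2) = (1 - a) / 2 := by rw [hc]; field_simp; ring
      have h8 := mul_le_mul_of_nonneg_left hlog (Nat.cast_nonneg (α := ℝ) N)
      rw [hrdef]
      linear_combination h8 + (N : ℝ) * h7
    have := Real.exp_le_exp.2 h6
    linarith
  · filter_upwards with N
    have hr : 0 ≤ N * a + b := by positivity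
    calc _ ≤ Real.exp (-(N * a + b)) * Real.exp (N * a + b) :=
          mul_le_mul_of_nonneg_left (truncExp_le_exp _ hr) (Real.exp_nonneg _)
      _ = 1 := by rw [← Real.exp_add, neg_add_cancel, Real.exp_zero]

end PoissonTail

/-! ### The integrand in the variable `v = s⁻² - 1` -/

section WeakNonReality

open Complex

/-- The bracket of squared conditional moments in `scaledProfile`. -/
def scaledMoment (N τ κ x y v e q : ℝ) : ℝ :=
  (N * x ^ 2 * (1 - τ / (1 + κ * v)) ^ 2 + y ^ 2 * (1 + τ / (1 + κ * v)) ^ 2 +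
    κ * (1 + v) / (1 + κ * v) * (N - 1 - (N * x ^ 2 + y ^ 2))) * e +
    κ * (1 + v) / (1 + κ * v) * (N - 1) * q

/-- The integrand of the eigenvalue density at `√N x + i y` in the variable `v = s⁻² - 1`. -/
def scaledProfile (N τ κ x y v e q : ℝ) : ℝ :=
  Real.pi⁻¹ * (1 + v) * Real.exp (-(N / 2) * Real.log (1 + κ * v) +
    τ * v * (N * (1 - τ) * x ^ 2 - (1 + τ) * y ^ 2) / (1 + κ * v)) *
    scaledMoment N τ κ x y v e q

/-- `discProfile τ s = s² (1 + κ v)`, so the powers of `s` combine to `s⁻² = 1 + v`. A factor `exp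
(-r)` with `r = |z|²` splits off from the exponential and turns the truncated series and its next
term into Poisson probabilities. -/
theorem densityProfile_eq_scaledProfile {N : ℕ} (hN : 2 ≤ N) {τ : ℝ} (hτ : |τ| < 1) (x y : ℝ) {s : ℝ}
    (hs : 0 < s) (hs1 : s ≤ 1) :
    Real.pi ^ (N - 1) / (N - 2).factorial *
        (s ^ (N - 2) * densityProfile N τ ⟨Real.sqrt N * x, y⟩ s) =
      scaledProfile N τ (1 - τ ^ 2) x y ((s ^ 2)⁻¹ - 1)
        (Real.exp (-(N * x ^ 2 + y ^ 2)) * truncExp (N - 2) (N * x ^ 2 + y ^ 2))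
        (Real.exp (-(N * x ^ 2 + y ^ 2)) *
          ((N * x ^ 2 + y ^ 2) ^ (N - 1) / (N - 1).factorial)) := by
  obtain ⟨n, rfl⟩ := Nat.exists_eq_add_of_le' hN
  have hN0 : (0 : ℝ) ≤ (n + 2 : ℕ) := Nat.cast_nonneg _
  have hsqN : Real.sqrt (n + 2 : ℕ) ^ 2 = (n + 2 : ℕ) := Real.sq_sqrt hN0
  set M : ℝ := ((n + 2 : ℕ) : ℝ) with hM
  set κ := 1 - τ ^ 2 with hκ
  set v := (s ^ 2)⁻¹ - 1 with hv
  have hκ0 : 0 < κ := by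
    have := (sq_lt_one_iff_abs_lt_one τ).2 hτ
    linarith
  have hv0 : 0 ≤ v := by
    rw [hv, sub_nonneg, one_le_inv₀ (by positivity)]
    nlinarith
  have hs2 : s ^ 2 * (1 + v) = 1 := by
    rw [hv]; field_simp; ring
  set c := 1 + κ * v with hc
  have hc0 : 0 < c := by positivity
  have hD : discProfile τ s = s ^ 2 * c := by
    rw [discProfile, hc]
    linear_combination (-κ) * hs2
  have hr : normSq (⟨Real.sqrt M * x, y⟩ : ℂ) = M * x ^ 2 + y ^ 2 := by
    rw [normSq_mk]; linear_combination x ^ 2 * hsqN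
  set r := M * x ^ 2 + y ^ 2 with hrd
  have hre : ((⟨Real.sqrt M * x, y⟩ : ℂ) ^ 2).re = M * x ^ 2 - y ^ 2 := by
    rw [sq, mul_re]; linear_combination x ^ 2 * hsqN
  have hmean : τ * s ^ 2 / (s ^ 2 * c) = τ / c := by
    rw [mul_comm τ, mul_div_mul_left _ _ (by positivity)]
  have hvar : κ / (s ^ 2 * c) = κ * (1 + v) / c := by
    have : (1 + v) = (s ^ 2)⁻¹ := by rw [hv]; ring
    rw [this]; field_simp
  have hsub : normSq ((⟨Real.sqrt M * x, y⟩ : ℂ) - ((τ / c : ℝ) : ℂ) *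
      (starRingEnd ℂ) (⟨Real.sqrt M * x, y⟩ : ℂ)) =
      M * x ^ 2 * (1 - τ / c) ^ 2 + y ^ 2 * (1 + τ / c) ^ 2 := by
    rw [normSq_apply, sub_re, sub_im, re_ofReal_mul, im_ofReal_mul, conj_re, conj_im]
    linear_combination x ^ 2 * (1 - τ / c) ^ 2 * hsqN
  have hexp : -((r - τ * (1 - s ^ 2) * (M * x ^ 2 - y ^ 2)) / (s ^ 2 * c)) =
      τ * v * (M * (1 - τ) * x ^ 2 - (1 + τ) * y ^ 2) / c + -r := by
    have h1 : r - τ * (1 - s ^ 2) * (M * x ^ 2 - y ^ 2) =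
        r * (s ^ 2 * c) - s ^ 2 * (τ * v * (M * (1 - τ) * x ^ 2 - (1 + τ) * y ^ 2)) := by
      rw [hrd, hc, hκ]
      linear_combination (-(M * x ^ 2 + y ^ 2) + τ * (M * x ^ 2 - y ^ 2)) * hs2
    rw [h1]
    field_simp
    ring
  have hpow : s ^ n / (Real.pi * Real.sqrt (s ^ 2 * c)) ^ (n + 2) =
      (Real.pi ^ (n + 2))⁻¹ * (1 + v) * Real.exp (-(M / 2) * Real.log c) := by
    have h1 : Real.sqrt c = Real.exp (Real.log c / 2) := by
      rw [Real.exp_half, Real.exp_log hc0]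
    have h2 : 1 + v = (s ^ 2)⁻¹ := by rw [hv]; ring
    have h3 : Real.exp (-(M / 2) * Real.log c) = (Real.sqrt c ^ (n + 2))⁻¹ := by
      rw [h1, ← Real.exp_nat_mul, ← Real.exp_neg, ← hM]
      congr 1; ring
    have h4 : 0 < Real.sqrt c := Real.sqrt_pos.2 hc0
    rw [h3, h2, Real.sqrt_mul (sq_nonneg s), Real.sqrt_sq hs.le, mul_pow, mul_pow]
    field_simp
    ring
  have hginibre : ginibreMoment (n + 1) r - r * ginibreMoment n r =
      n.factorial * ((M - 1 - r) * truncExp n r + (M - 1) * (r ^ (n + 1) / (n + 1).factorial)) := by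
    have h1 : truncExp (n + 1) r = truncExp n r + r ^ (n + 1) / (n + 1).factorial := by
      rw [truncExp, Finset.sum_range_succ, ← truncExp]
    have h2 : M - 1 = n + 1 := by rw [hM]; push_cast; ring
    rw [ginibreMoment, ginibreMoment, h1, h2, Nat.factorial_succ]
    push_cast
    ring
  rw [show n + 2 - 1 = n + 1 by omega, show n + 2 - 2 = n by omega, densityProfile, reducedMoment,
    show n + 2 - 1 = n + 1 by omega, show n + 2 - 2 = n by omega, hD, hr, hre, hmean, hvar, hsub,
    hexp, hginibre, ginibreMoment, Real.exp_add, scaledProfile, scaledMoment, Real.exp_add, ← hc, ← hrd]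
  have hfac : (n.factorial : ℝ) ≠ 0 := by positivity
  have hpi : Real.pi ^ (n + 2) = Real.pi ^ (n + 1) * Real.pi := pow_succ _ _
  calc _ = (Real.pi ^ (n + 1) / n.factorial) * (s ^ n / (Real.pi * Real.sqrt (s ^ 2 * c)) ^ (n + 2)) *
        (((M * x ^ 2 * (1 - τ / c) ^ 2 + y ^ 2 * (1 + τ / c) ^ 2) * (n.factorial * truncExp n r) +
          κ * (1 + v) / c * (n.factorial * ((M - 1 - r) * truncExp n r +
            (M - 1) * (r ^ (n + 1) / (n + 1).factorial)))) *
          (Real.exp (τ * v * (M * (1 - τ) * x ^ 2 - (1 + τ) * y ^ 2) / c) * Real.exp (-r))) := by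
        ring
    _ = _ := by
        rw [hpow, hpi]
        field_simp
        ring

end WeakNonReality

/-! ### A majorant uniform in `N` and `v` -/

section Domination

/-- Every explicit factor `N` is paired with `κ ≤ 2 d / N` or with `1 - τ / c ≤ 2 d (1 + v) / N`,
where `c = 1 + κ v`. -/
theorem abs_scaledMoment_le {N τ d x y v e q : ℝ} (hN : 1 ≤ N) (hτ0 : 0 ≤ τ) (hτ1 : τ ≤ 1)
    (hd : N * (1 - τ) = d) (hv : 0 ≤ v) (he0 : 0 ≤ e) (he1 : e ≤ 1) (hq0 : 0 ≤ q) (hq1 : q ≤ 1) :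
    |scaledMoment N τ (1 - τ ^ 2) x y v e q| ≤
      (2 * d * x ^ 2 + 4 * y ^ 2 + 2 * d * (1 + x ^ 2 + y ^ 2) + 2 * d) * (1 + v) := by
  set κ := 1 - τ ^ 2 with hκ
  have hκ0 : 0 ≤ κ := by nlinarith
  have hNκ : N * κ ≤ 2 * d := by
    rw [← hd, hκ]
    nlinarith [mul_nonneg (mul_nonneg (by linarith : 0 ≤ N) (by linarith : 0 ≤ 1 - τ))
      (by linarith : 0 ≤ 1 - τ)]
  have hd0 : 0 ≤ d := by rw [← hd]; exact mul_nonneg (by linarith) (by linarith)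
  set c := 1 + κ * v with hc
  have hc1 : 1 ≤ c := by rw [hc]; nlinarith [mul_nonneg hκ0 hv]
  have hc0 : 0 < c := by linarith
  have hμ0 : 0 ≤ τ / c := by positivity
  have hμ1 : τ / c ≤ 1 := by rw [div_le_one hc0]; linarith
  have h1μ : N * (1 - τ / c) ≤ 2 * d * (1 + v) := by
    have h : 1 - τ / c = ((1 - τ) + κ * v) / c := by rw [hc]; field_simp; ring
    rw [h, mul_div_assoc', div_le_iff₀ hc0]
    have h2 : N * (1 - τ + κ * v) ≤ 2 * d * (1 + v) := by
      rw [mul_add, hd, ← mul_assoc]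
      nlinarith [mul_le_mul_of_nonneg_right hNκ hv]
    have h3 : 2 * d * (1 + v) * 1 ≤ 2 * d * (1 + v) * c :=
      mul_le_mul_of_nonneg_left hc1 (by positivity)
    linarith
  have hσ : κ * (1 + v) / c ≤ κ * (1 + v) := div_le_self (by positivity) hc1
  have hσ0 : 0 ≤ κ * (1 + v) / c := by positivity
  have t1 : |N * x ^ 2 * (1 - τ / c) ^ 2| ≤ 2 * d * x ^ 2 * (1 + v) := by
    rw [abs_of_nonneg (by positivity)]
    calc N * x ^ 2 * (1 - τ / c) ^ 2 = x ^ 2 * (1 - τ / c) * (N * (1 - τ / c)) := by ring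
      _ ≤ x ^ 2 * 1 * (2 * d * (1 + v)) := by
          refine mul_le_mul (mul_le_mul_of_nonneg_left (by linarith) (sq_nonneg x)) h1μ
            (mul_nonneg (by linarith) (by linarith)) (by positivity)
      _ = _ := by ring
  have t2 : |y ^ 2 * (1 + τ / c) ^ 2| ≤ 4 * y ^ 2 * (1 + v) := by
    rw [abs_of_nonneg (by positivity)]
    have h : (1 + τ / c) ^ 2 ≤ 4 := by nlinarith
    calc y ^ 2 * (1 + τ / c) ^ 2 ≤ y ^ 2 * 4 := mul_le_mul_of_nonneg_left h (sq_nonneg y)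
      _ ≤ 4 * y ^ 2 * (1 + v) := by nlinarith [mul_nonneg (sq_nonneg y) hv]
  have t3 : |κ * (1 + v) / c * (N - 1 - (N * x ^ 2 + y ^ 2))| ≤
      2 * d * (1 + x ^ 2 + y ^ 2) * (1 + v) := by
    rw [abs_mul, abs_of_nonneg hσ0]
    have h : |N - 1 - (N * x ^ 2 + y ^ 2)| ≤ N * (1 + x ^ 2 + y ^ 2) := by
      rw [abs_le]
      constructor <;> nlinarith [mul_nonneg (by linarith : 0 ≤ N) (sq_nonneg x),
        mul_nonneg (by linarith : 0 ≤ N - 1) (sq_nonneg y)]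
    calc _ ≤ κ * (1 + v) * (N * (1 + x ^ 2 + y ^ 2)) :=
          mul_le_mul hσ h (abs_nonneg _) (by positivity)
      _ = N * κ * ((1 + v) * (1 + x ^ 2 + y ^ 2)) := by ring
      _ ≤ 2 * d * ((1 + v) * (1 + x ^ 2 + y ^ 2)) := mul_le_mul_of_nonneg_right hNκ (by positivity)
      _ = _ := by ring
  have t4 : |κ * (1 + v) / c * (N - 1)| ≤ 2 * d * (1 + v) := by
    rw [abs_mul, abs_of_nonneg hσ0, abs_of_nonneg (by linarith)]
    calc _ ≤ κ * (1 + v) * N := mul_le_mul hσ (by linarith) (by linarith) (by positivity)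
      _ = N * κ * (1 + v) := by ring
      _ ≤ _ := mul_le_mul_of_nonneg_right hNκ (by positivity)
  rw [scaledMoment, ← hc]
  have u1 := abs_add_three (N * x ^ 2 * (1 - τ / c) ^ 2) (y ^ 2 * (1 + τ / c) ^ 2)
    (κ * (1 + v) / c * (N - 1 - (N * x ^ 2 + y ^ 2)))
  refine (abs_add_le _ _).trans ?_
  rw [abs_mul, abs_mul _ q, abs_of_nonneg he0, abs_of_nonneg hq0]
  have u2 := mul_le_of_le_one_right (abs_nonneg (N * x ^ 2 * (1 - τ / c) ^ 2 +
    y ^ 2 * (1 + τ / c) ^ 2 + κ * (1 + v) / c * (N - 1 - (N * x ^ 2 + y ^ 2)))) he1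
  have u3 := mul_le_of_le_one_right (abs_nonneg (κ * (1 + v) / c * (N - 1))) hq1
  linarith

/-- The share `θ` of `(N / 2) log c` absorbs the positive part of the exponent, because `κ v / c ≤
log c`. The rest is `2 a log c` with `a = (1 - θ) N / 4`, and Bernoulli's inequality gives `c ^ a ≥
1 + a κ v ≥ b (1 + v)`. Its square cancels the factor `1 + v` in front and the one from
`abs_scaledMoment_le`. -/
theorem abs_scaledProfile_le {N τ d θ x y v e q : ℝ} (hN : 1 ≤ N) (hτ0 : 0 ≤ τ) (hτ1 : τ ≤ 1)
    (hd : N * (1 - τ) = d) (hd0 : 0 < d) (hθ0 : 0 ≤ θ) (hθ1 : θ < 1)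
    (hx : x ^ 2 ≤ θ * ((1 + τ) / 2)) (ha : 1 ≤ (1 - θ) * N / 4)
    (hv : 0 ≤ v) (he0 : 0 ≤ e) (he1 : e ≤ 1) (hq0 : 0 ≤ q) (hq1 : q ≤ 1) :
    |scaledProfile N τ (1 - τ ^ 2) x y v e q| ≤
      Real.pi⁻¹ * (2 * d * x ^ 2 + 4 * y ^ 2 + 2 * d * (1 + x ^ 2 + y ^ 2) + 2 * d) /
        (min 1 ((1 - θ) * d / 4)) ^ 2 := by
  have hM := abs_scaledMoment_le (x := x) (y := y) hN hτ0 hτ1 hd hv he0 he1 hq0 hq1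
  set K := 2 * d * x ^ 2 + 4 * y ^ 2 + 2 * d * (1 + x ^ 2 + y ^ 2) + 2 * d with hK
  have hK0 : 0 ≤ K := by positivity
  set κ := 1 - τ ^ 2 with hκ
  have hκ0 : 0 ≤ κ := by nlinarith
  have hNκ : N * κ = d * (1 + τ) := by rw [← hd, hκ]; ring
  set c := 1 + κ * v with hc
  have hc1 : 1 ≤ c := by rw [hc]; nlinarith [mul_nonneg hκ0 hv]
  have hc0 : 0 < c := by linarith
  set a := (1 - θ) * N / 4 with hadef
  set b := min 1 ((1 - θ) * d / 4) with hb
  have hb0 : 0 < b := lt_min one_pos (by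
    have : 0 < 1 - θ := by linarith
    positivity)
  have hL : κ * v / c ≤ Real.log c := by
    have := Real.one_sub_inv_le_log_of_pos hc0
    refine le_trans (le_of_eq ?_) this
    rw [hc]; field_simp; ring
  have hexp1 : -(N / 2) * Real.log c + τ * v * (N * (1 - τ) * x ^ 2 - (1 + τ) * y ^ 2) / c ≤
      -2 * (a * Real.log c) := by
    have h1 : τ * v * (N * (1 - τ) * x ^ 2 - (1 + τ) * y ^ 2) / c ≤ v * (d * x ^ 2) / c := by
      rw [hd]
      refine div_le_div_of_nonneg_right ?_ hc0.le
      have e1 : τ * v * (d * x ^ 2 - (1 + τ) * y ^ 2) ≤ τ * v * (d * x ^ 2) :=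
        mul_le_mul_of_nonneg_left (by nlinarith [mul_nonneg (by linarith : 0 ≤ 1 + τ) (sq_nonneg y)])
          (by positivity)
      have e2 : τ * (v * (d * x ^ 2)) ≤ 1 * (v * (d * x ^ 2)) :=
        mul_le_mul_of_nonneg_right hτ1 (by positivity)
      linarith
    have h2 : v * (d * x ^ 2) / c ≤ θ * (N / 2) * (κ * v / c) := by
      have : θ * (N / 2) * (κ * v / c) = v * (d * (θ * ((1 + τ) / 2))) / c := by
        field_simp
        linear_combination θ * v * hNκ
      rw [this]
      gcongr
    have h3 : θ * (N / 2) * (κ * v / c) ≤ θ * (N / 2) * Real.log c :=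
      mul_le_mul_of_nonneg_left hL (by positivity)
    rw [hadef]
    linarith
  have hpow : b * (1 + v) ≤ Real.exp (a * Real.log c) := by
    have h1 : 1 + a * (κ * v) ≤ c ^ a := by
      rw [hc]
      exact one_add_mul_self_le_rpow_one_add (by nlinarith [mul_nonneg hκ0 hv]) ha
    have h2 : c ^ a = Real.exp (a * Real.log c) := by
      rw [Real.rpow_def_of_pos hc0, mul_comm]
    rw [← h2]
    refine le_trans ?_ h1
    have h3 : (1 - θ) * d / 4 ≤ a * κ := by
      have : a * κ = (1 - θ) * (d * (1 + τ)) / 4 := by rw [hadef, ← hNκ]; ring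
      rw [this]
      have : (1 - θ) * d * 1 ≤ (1 - θ) * d * (1 + τ) :=
        mul_le_mul_of_nonneg_left (by linarith) (mul_nonneg (by linarith) hd0.le)
      linarith
    have h4 : b ≤ 1 := min_le_left _ _
    have h5 : b ≤ a * κ := (min_le_right _ _).trans h3
    nlinarith [mul_le_mul_of_nonneg_right h5 hv]
  have hexp2 : Real.exp (-(N / 2) * Real.log c +
      τ * v * (N * (1 - τ) * x ^ 2 - (1 + τ) * y ^ 2) / c) ≤ ((b * (1 + v)) ^ 2)⁻¹ := by
    refine (Real.exp_le_exp.2 hexp1).trans ?_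
    have : Real.exp (-2 * (a * Real.log c)) = (Real.exp (a * Real.log c) ^ 2)⁻¹ := by
      rw [← Real.exp_nat_mul, ← Real.exp_neg]; congr 1; push_cast; ring
    rw [this]
    have hpos : 0 < b * (1 + v) := by positivity
    gcongr
  rw [scaledProfile, ← hc, abs_mul, abs_of_nonneg (by positivity)]
  have hpi := Real.pi_pos
  calc _ ≤ Real.pi⁻¹ * (1 + v) * ((b * (1 + v)) ^ 2)⁻¹ * (K * (1 + v)) :=
        mul_le_mul (mul_le_mul_of_nonneg_left hexp2 (by positivity)) hM (abs_nonneg _)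
          (by positivity)
    _ = Real.pi⁻¹ * K / b ^ 2 := by
        have : (1 + v) ≠ 0 := by positivity
        field_simp

theorem tendsto_weakTau (δ : ℝ) : Tendsto (fun N : ℕ => 1 - δ ^ 2 / (N : ℝ)) atTop (𝓝 1) := by
  simpa using (tendsto_const_div_atTop_nhds_zero_nat (δ ^ 2)).const_sub 1

theorem eventually_abs_weakTau_lt {δ : ℝ} (hδ : δ ≠ 0) :
    ∀ᶠ N : ℕ in atTop, |1 - δ ^ 2 / (N : ℝ)| < 1 := by
  have hδ2 : 0 < δ ^ 2 := by positivity
  filter_upwards [(tendsto_weakTau δ).eventually_const_lt (show (0 : ℝ) < 1 from one_pos),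
    eventually_ge_atTop 1] with N h1 h2
  have hN : (0 : ℝ) < N := by exact_mod_cast h2
  have : 0 < δ ^ 2 / N := by positivity
  rw [abs_lt]
  constructor <;> linarith

theorem exists_bound_scaledProfile {δ x : ℝ} (hδ : δ ≠ 0) (hx : x ^ 2 < 1) (y : ℝ) :
    ∃ C, ∀ᶠ N : ℕ in atTop, ∀ v e q : ℝ, 0 ≤ v → 0 ≤ e → e ≤ 1 → 0 ≤ q → q ≤ 1 →
      |scaledProfile N (1 - δ ^ 2 / N) (1 - (1 - δ ^ 2 / N) ^ 2) x y v e q| ≤ C := by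
  have hδ2 : 0 < δ ^ 2 := by positivity
  -- Midway between `x²` and `1`: below `1` to keep decay, above `x²` to leave room for the factor
  -- `(1 + τ) / 2 < 1`.
  set θ := (1 + x ^ 2) / 2 with hθ
  have hθ1 : θ < 1 := by rw [hθ]; linarith
  have hθx : x ^ 2 < θ := by rw [hθ]; linarith
  have hθ0 : 0 ≤ θ := by positivity
  refine ⟨Real.pi⁻¹ * (2 * δ ^ 2 * x ^ 2 + 4 * y ^ 2 + 2 * δ ^ 2 * (1 + x ^ 2 + y ^ 2) + 2 * δ ^ 2) /
    (min 1 ((1 - θ) * δ ^ 2 / 4)) ^ 2, ?_⟩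
  have hlim : Tendsto (fun N : ℕ => θ * ((1 + (1 - δ ^ 2 / (N : ℝ))) / 2)) atTop (𝓝 θ) := by
    have := (((tendsto_weakTau δ).const_add 1).div_const 2).const_mul θ
    convert this using 2
    ring
  have hlarge : Tendsto (fun N : ℕ => (1 - θ) * (N : ℝ) / 4) atTop atTop :=
    (tendsto_natCast_atTop_atTop.const_mul_atTop (by linarith)).atTop_div_const (by norm_num)
  filter_upwards [(tendsto_weakTau δ).eventually_const_lt (show (0 : ℝ) < 1 from one_pos),
    eventually_ge_atTop 1, hlim.eventually_const_lt hθx, hlarge.eventually_ge_atTop 1]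
    with N h1 h2 h3 h4 v e q hv he0 he1 hq0 hq1
  have hN : (1 : ℝ) ≤ N := by exact_mod_cast h2
  have : 0 < δ ^ 2 / (N : ℝ) := by positivity
  exact abs_scaledProfile_le (d := δ ^ 2) (θ := θ) hN h1.le (by linarith)
    (by field_simp; ring) hδ2 hθ0 hθ1 h3.le h4 hv he0 he1 hq0 hq1

end Domination

/-! ### The limit in the weak non-reality regime -/

section Limit

/-- The limit of `scaledProfile` in the weak non-reality regime. -/
def limitProfile (δ x y v : ℝ) : ℝ :=
  Real.pi⁻¹ * (1 + v) * Real.exp (-(δ ^ 2 * v) + v * (δ ^ 2 * x ^ 2 - 2 * y ^ 2)) *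
    (4 * y ^ 2 + 2 * δ ^ 2 * (1 - x ^ 2) * (1 + v))

theorem tendsto_scaledProfile (δ x y v : ℝ) {e q : ℕ → ℝ}
    (he : Tendsto e atTop (𝓝 1)) (hq : Tendsto q atTop (𝓝 0)) :
    Tendsto (fun N : ℕ => scaledProfile N (1 - δ ^ 2 / N) (1 - (1 - δ ^ 2 / N) ^ 2) x y v (e N) (q N))
      atTop (𝓝 (limitProfile δ x y v)) := by
  set τ : ℕ → ℝ := fun N => 1 - δ ^ 2 / (N : ℝ) with hτ
  set κ : ℕ → ℝ := fun N => 1 - τ N ^ 2 with hκ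
  set c : ℕ → ℝ := fun N => 1 + κ N * v with hc
  have tτ : Tendsto τ atTop (𝓝 1) := tendsto_weakTau δ
  have tκ : Tendsto κ atTop (𝓝 0) := by simpa using (tτ.pow 2).const_sub 1
  have tc : Tendsto c atTop (𝓝 1) := by simpa using (tκ.mul_const v).const_add 1
  have hNτ : ∀ᶠ N : ℕ in atTop, (N : ℝ) * (1 - τ N) = δ ^ 2 := by
    filter_upwards [eventually_ge_atTop 1] with N hN
    have : (N : ℝ) ≠ 0 := by positivity
    simp only [hτ]; field_simp; ring
  have tNκ : Tendsto (fun N : ℕ => (N : ℝ) * κ N) atTop (𝓝 (2 * δ ^ 2)) := by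
    have h : Tendsto (fun N : ℕ => δ ^ 2 * (1 + τ N)) atTop (𝓝 (δ ^ 2 * (1 + 1))) :=
      (tτ.const_add 1).const_mul _
    rw [show 2 * δ ^ 2 = δ ^ 2 * (1 + 1) by ring]
    refine h.congr' ?_
    filter_upwards [hNτ] with N hN
    simp only [hκ]; rw [← hN]; ring
  have tNτ : Tendsto (fun N : ℕ => (N : ℝ) * (1 - τ N)) atTop (𝓝 (δ ^ 2)) :=
    tendsto_const_nhds.congr' (hNτ.mono fun N h => h.symm)
  have tμ : Tendsto (fun N => τ N / c N) atTop (𝓝 1) := by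
    have h := tτ.div tc one_ne_zero
    rw [div_one] at h
    exact h
  have hc0 : ∀ᶠ N in atTop, c N ≠ 0 := tc.eventually_ne one_ne_zero
  have tlog : Tendsto (fun N : ℕ => -((N : ℝ) / 2) * Real.log (c N)) atTop (𝓝 (-(δ ^ 2 * v))) := by
    have h1 : Tendsto (fun N : ℕ => (N : ℝ) * (κ N * v)) atTop (𝓝 (2 * δ ^ 2 * v)) :=
      (tNκ.mul_const v).congr fun N => by ring
    have h2 := (Real.tendsto_nat_mul_log_one_add_of_tendsto h1).const_mul (-(1 / 2))
    convert h2 using 2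
    · simp only [hc]; ring
    · ring
  have tB : Tendsto (fun N : ℕ => τ N * v * (N * (1 - τ N) * x ^ 2 - (1 + τ N) * y ^ 2) / c N) atTop
      (𝓝 (v * (δ ^ 2 * x ^ 2 - 2 * y ^ 2))) := by
    have := ((tτ.mul_const v).mul ((tNτ.mul_const (x ^ 2)).sub
      ((tτ.const_add 1).mul_const (y ^ 2)))).div tc one_ne_zero
    have hlim : v * (δ ^ 2 * x ^ 2 - 2 * y ^ 2) =
        1 * v * (δ ^ 2 * x ^ 2 - (1 + 1) * y ^ 2) / 1 := by ring
    rw [hlim]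
    exact this
  -- One factor `1 - τ / c` is of order `1 / N` and absorbs `N`; the other tends to zero.
  have tM1 : Tendsto (fun N : ℕ => N * x ^ 2 * (1 - τ N / c N) ^ 2) atTop (𝓝 0) := by
    have h1 := ((((tNτ.add (tNκ.mul_const v)).div tc one_ne_zero).mul (tμ.const_sub 1)).const_mul
      (x ^ 2))
    rw [sub_self, mul_zero, mul_zero] at h1
    refine h1.congr' ?_
    filter_upwards [hc0] with N hN
    have h2 : 1 - τ N / c N = (1 - τ N + κ N * v) / c N := by
      rw [eq_div_iff hN, sub_mul, div_mul_cancel₀ _ hN]; simp only [hc]; ring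
    simp only [Pi.div_apply]
    rw [sq (1 - τ N / c N)]
    nth_rw 2 [h2]
    ring
  have tM2 : Tendsto (fun N : ℕ => y ^ 2 * (1 + τ N / c N) ^ 2) atTop (𝓝 (y ^ 2 * (1 + 1) ^ 2)) :=
    ((tμ.const_add 1).pow 2).const_mul _
  have tM3 : Tendsto (fun N : ℕ => κ N * (1 + v) / c N * (N - 1 - (N * x ^ 2 + y ^ 2))) atTop
      (𝓝 ((1 + v) / 1 * (2 * δ ^ 2 - 0 - (2 * δ ^ 2 * x ^ 2 + 0 * y ^ 2)))) := by
    have := ((tendsto_const_nhds (x := 1 + v)).div tc one_ne_zero).mul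
      ((tNκ.sub tκ).sub ((tNκ.mul_const (x ^ 2)).add (tκ.mul_const (y ^ 2))))
    refine this.congr fun N => ?_
    simp only [Pi.div_apply]
    ring
  have tM4 : Tendsto (fun N : ℕ => κ N * (1 + v) / c N * (N - 1) * q N) atTop
      (𝓝 ((1 + v) / 1 * (2 * δ ^ 2 - 0) * 0)) := by
    have := (((tendsto_const_nhds (x := 1 + v)).div tc one_ne_zero).mul (tNκ.sub tκ)).mul hq
    refine this.congr fun N => ?_
    simp only [Pi.div_apply]
    ring
  have tM := (((tM1.add tM2).add tM3).mul he).add tM4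
  have tE := ((tlog.add tB).rexp.const_mul (Real.pi⁻¹ * (1 + v))).mul tM
  have hlim : limitProfile δ x y v = Real.pi⁻¹ * (1 + v) *
      Real.exp (-(δ ^ 2 * v) + v * (δ ^ 2 * x ^ 2 - 2 * y ^ 2)) *
      ((0 + y ^ 2 * (1 + 1) ^ 2 + (1 + v) / 1 * (2 * δ ^ 2 - 0 - (2 * δ ^ 2 * x ^ 2 + 0 * y ^ 2))) * 1
        + (1 + v) / 1 * (2 * δ ^ 2 - 0) * 0) := by
    unfold limitProfile
    ring
  rw [hlim]
  exact tE

/-- Dominated convergence with a constant majorant. The second Poisson probability is at most the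
complement of the first, so it tends to `0` as the first tends to `1`. -/
theorem tendsto_eigenvalueDensity {δ x : ℝ} (hδ : δ ≠ 0) (hx : x ^ 2 < 1) (y : ℝ) :
    Tendsto (fun N : ℕ => eigenvalueDensity N (1 - δ ^ 2 / N) ⟨Real.sqrt N * x, y⟩) atTop
      (𝓝 (∫ s in (0 : ℝ)..1, limitProfile δ x y ((s ^ 2)⁻¹ - 1))) := by
  obtain ⟨C, hC⟩ := exists_bound_scaledProfile hδ hx y
  have hr : ∀ N : ℕ, 0 ≤ N * x ^ 2 + y ^ 2 := fun N => by positivity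
  have he0 : ∀ N : ℕ, 0 ≤ Real.exp (-(N * x ^ 2 + y ^ 2)) * truncExp (N - 2) (N * x ^ 2 + y ^ 2) :=
    fun N => mul_nonneg (Real.exp_nonneg _) (truncExp_nonneg _ (hr N))
  have hq0 : ∀ N : ℕ, 0 ≤ Real.exp (-(N * x ^ 2 + y ^ 2)) *
      ((N * x ^ 2 + y ^ 2) ^ (N - 1) / (N - 1).factorial) := fun N => by
    have := hr N
    positivity
  have hqe : ∀ N : ℕ, 2 ≤ N → Real.exp (-(N * x ^ 2 + y ^ 2)) *
      ((N * x ^ 2 + y ^ 2) ^ (N - 1) / (N - 1).factorial) ≤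
      1 - Real.exp (-(N * x ^ 2 + y ^ 2)) * truncExp (N - 2) (N * x ^ 2 + y ^ 2) := by
    intro N hN
    have h := mul_le_mul_of_nonneg_left (pow_div_factorial_le_exp_sub_truncExp (N - 2) (hr N))
      (Real.exp_nonneg (-(N * x ^ 2 + y ^ 2)))
    rwa [mul_sub, ← Real.exp_add, neg_add_cancel, Real.exp_zero,
      show N - 2 + 1 = N - 1 by omega] at h
  have te := tendsto_exp_neg_mul_truncExp (sq_nonneg x) hx (sq_nonneg y)
  have tq : Tendsto (fun N : ℕ => Real.exp (-(N * x ^ 2 + y ^ 2)) *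
      ((N * x ^ 2 + y ^ 2) ^ (N - 1) / (N - 1).factorial)) atTop (𝓝 0) := by
    have h := te.const_sub 1
    rw [sub_self] at h
    exact tendsto_of_tendsto_of_tendsto_of_le_of_le' tendsto_const_nhds h
      (Eventually.of_forall hq0) ((eventually_ge_atTop 2).mono hqe)
  have hv : ∀ s : ℝ, s ∈ Set.uIoc (0 : ℝ) 1 → 0 ≤ (s ^ 2)⁻¹ - 1 := by
    intro s hs
    rw [Set.uIoc_of_le zero_le_one] at hs
    have := hs.1
    rw [sub_nonneg, one_le_inv₀ (by positivity)]
    nlinarith [hs.2]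
  unfold eigenvalueDensity
  simp only [← intervalIntegral.integral_const_mul]
  refine intervalIntegral.tendsto_integral_filter_of_dominated_convergence (fun _ => C) ?_ ?_
    intervalIntegrable_const ?_
  · filter_upwards [eventually_abs_weakTau_lt hδ] with N hN
    have := continuous_densityProfile N hN
    exact Continuous.aestronglyMeasurable (by fun_prop)
  · filter_upwards [eventually_abs_weakTau_lt hδ, hC, eventually_ge_atTop 2] with N hN hCN hN2
    refine Eventually.of_forall fun s hs => ?_
    have hs' := hs
    rw [Set.uIoc_of_le zero_le_one] at hs'
    rw [densityProfile_eq_scaledProfile hN2 hN x y hs'.1 hs'.2, Real.norm_eq_abs]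
    have h1 := hqe N hN2
    have h2 := hq0 N
    have h3 := he0 N
    exact hCN _ _ _ (hv s hs) h3 (by linarith) h2 (by linarith)
  · refine Eventually.of_forall fun s hs => ?_
    have hs' := hs
    rw [Set.uIoc_of_le zero_le_one] at hs'
    refine (tendsto_scaledProfile δ x y _ te tq).congr' ?_
    filter_upwards [eventually_abs_weakTau_lt hδ, eventually_ge_atTop 2] with N hN hN2
    rw [densityProfile_eq_scaledProfile hN2 hN x y hs'.1 hs'.2]

/-- The uniform bound survives the limit, taken along the constant sequences `e = 1` and `q = 0`; it
provides the absolute convergence of the limiting integral. -/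
theorem exists_bound_limitProfile {δ x : ℝ} (hδ : δ ≠ 0) (hx : x ^ 2 < 1) (y : ℝ) :
    ∃ C, ∀ v, 0 ≤ v → |limitProfile δ x y v| ≤ C := by
  obtain ⟨C, hC⟩ := exists_bound_scaledProfile hδ hx y
  refine ⟨C, fun v hv => ?_⟩
  refine le_of_tendsto (tendsto_scaledProfile δ x y v (e := fun _ => 1) (q := fun _ => 0)
    tendsto_const_nhds tendsto_const_nhds).abs ?_
  filter_upwards [hC] with N hN
  exact hN v 1 0 hv zero_le_one le_rfl le_rfl zero_le_one

/-- The integrand of the limiting density. -/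
def weakIntegrand (y d t : ℝ) : ℝ :=
  Real.exp ((1 - t ^ 2) * (2 * y ^ 2 + d ^ 2)) * (d ^ 2 * t ^ 2 + 2 * y ^ 2)

/-- With `t = s⁻¹` one has `1 + v = t²`; the absolute value is the Jacobian of the inversion, kept
in the form that the change of variables needs. -/
theorem limitProfile_eq_weakIntegrand {δ x y d s : ℝ} (hd : d ^ 2 = δ ^ 2 * (1 - x ^ 2)) (hs : 0 < s) :
    limitProfile δ x y ((s ^ 2)⁻¹ - 1) =
      2 / Real.pi * (|-(s ^ 2)⁻¹| • weakIntegrand y d s⁻¹) := by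
  rw [limitProfile, weakIntegrand, abs_neg, abs_of_pos (by positivity), smul_eq_mul, inv_pow]
  have h : -(δ ^ 2 * ((s ^ 2)⁻¹ - 1)) + ((s ^ 2)⁻¹ - 1) * (δ ^ 2 * x ^ 2 - 2 * y ^ 2) =
      (1 - (s ^ 2)⁻¹) * (2 * y ^ 2 + d ^ 2) := by rw [hd]; ring
  rw [h, hd]
  field_simp
  ring

theorem integrableOn_weakIntegrand {δ x d : ℝ} (hδ : δ ≠ 0) (hx : x ^ 2 < 1) (y : ℝ)
    (hd : d ^ 2 = δ ^ 2 * (1 - x ^ 2)) : IntegrableOn (weakIntegrand y d) (Set.Ioi 1) := by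
  obtain ⟨C, hC⟩ := exists_bound_limitProfile hδ hx y
  rw [← image_inv_Ioo_zero_one, integrableOn_image_iff_integrableOn_abs_deriv_smul measurableSet_Ioo
    (fun s hs => (hasDerivAt_inv (ne_of_gt hs.1)).hasDerivWithinAt) inv_injective.injOn]
  refine Measure.integrableOn_of_bounded (M := Real.pi / 2 * C) (by simp) ?_ ?_
  · refine Measurable.aestronglyMeasurable ?_
    unfold weakIntegrand
    fun_prop
  · filter_upwards [ae_restrict_mem measurableSet_Ioo] with s hs
    have h := hC ((s ^ 2)⁻¹ - 1) (by
      have := hs.1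
      rw [sub_nonneg, one_le_inv₀ (by positivity)]
      nlinarith [hs.2])
    rw [limitProfile_eq_weakIntegrand hd hs.1, abs_mul, abs_of_pos (by positivity)] at h
    rw [Real.norm_eq_abs]
    have hpi := Real.pi_pos
    have h2 := mul_le_mul_of_nonneg_left h (by positivity : 0 ≤ Real.pi / 2)
    refine le_trans (le_of_eq ?_) h2
    field_simp

theorem integral_limitProfile {δ x y d : ℝ} (hd : d ^ 2 = δ ^ 2 * (1 - x ^ 2)) :
    ∫ s in (0 : ℝ)..1, limitProfile δ x y ((s ^ 2)⁻¹ - 1) =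
      2 / Real.pi * ∫ t in Set.Ioi (1 : ℝ), weakIntegrand y d t := by
  rw [← image_inv_Ioo_zero_one, integral_image_eq_integral_abs_deriv_smul measurableSet_Ioo
    (fun s hs => (hasDerivAt_inv (ne_of_gt hs.1)).hasDerivWithinAt) inv_injective.injOn,
    intervalIntegral.integral_of_le zero_le_one, integral_Ioc_eq_integral_Ioo, ← integral_const_mul]
  exact setIntegral_congr_fun measurableSet_Ioo fun s hs => limitProfile_eq_weakIntegrand hd hs.1

end Limit

end

theorem mainTheorem5 (δ : ℝ) (hδ : δ ≠ 0) :
    (∀ᶠ N : ℕ in atTop, ∃ p : ℂ → ℝ, IsMeanEigenvalueDensity N (1 - δ ^ 2 / (N : ℝ)) p) ∧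
    ∀ p : ℕ → ℂ → ℝ,
      (∀ᶠ N : ℕ in atTop, IsMeanEigenvalueDensity N (1 - δ ^ 2 / (N : ℝ)) (p N)) →
      ∀ xt y δx : ℝ, |xt| < 1 → δx = δ * Real.sqrt (1 - xt ^ 2) →
        IntegrableOn
          (fun t : ℝ => Real.exp ((1 - t ^ 2) * (2 * y ^ 2 + δx ^ 2)) *
            (δx ^ 2 * t ^ 2 + 2 * y ^ 2)) (Set.Ioi 1) ∧
        Tendsto (fun N : ℕ => p N ⟨Real.sqrt (N : ℝ) * xt, y⟩) atTop
          (𝓝 (2 / Real.pi * ∫ t in Set.Ioi (1 : ℝ),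
            Real.exp ((1 - t ^ 2) * (2 * y ^ 2 + δx ^ 2)) * (δx ^ 2 * t ^ 2 + 2 * y ^ 2))) := by
  refine ⟨?_, fun p hp xt y δx hxt hδx => ?_⟩
  · filter_upwards [eventually_abs_weakTau_lt hδ, eventually_ge_atTop 2] with N hN hN2
    exact ⟨_, isMeanEigenvalueDensity_eigenvalueDensity hN2 hN⟩
  · have hx : xt ^ 2 < 1 := (sq_lt_one_iff_abs_lt_one xt).2 hxt
    have hd : δx ^ 2 = δ ^ 2 * (1 - xt ^ 2) := by
      rw [hδx, mul_pow, Real.sq_sqrt (by linarith)]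
    refine ⟨integrableOn_weakIntegrand hδ hx y hd, ?_⟩
    have h := tendsto_eigenvalueDensity hδ hx y
    rw [integral_limitProfile hd] at h
    refine h.congr' ?_
    filter_upwards [hp, eventually_abs_weakTau_lt hδ, eventually_ge_atTop 2] with N hpN hN hN2
    -- Uniqueness identifies the given density with the explicit one for all large `N`.
    rw [(isMeanEigenvalueDensity_eigenvalueDensity hN2 hN).unique hpN]
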